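/- **Theorem 4.1.** Let $(M,g)$ be a compact smooth Riemannian manifold of dimension $n\ge 2$ with smooth (possibly empty) boundary $\partial M$, where $M$ includes its boundary and $\mathring M=M\setminus\partial M$ is the interior. Let $\chi$ be a smooth symmetric $(0,2)$ tensor on $M$. Let $\Gamma\subset\mathbb R^{n+1}$ be an open convex cone with vertex at the origin, symmetric under permutations of the coordinates and containing $\{\lambda:\lambda_i>0 \text{ for all } i\}$. Let $f$ be a smooth symmetric function on $\Gamma$ which is concave, satisfies $f_i=\partial f/\partial\lambda_i>0$ in $\Gamma$ for $1\le i\le n+1$, and for some constant $K_0\ge 0$ $$\sum_{i=1}^{n+1} f_i(\lambda)\lambda_i\ \ge\ -K_0\sum_{i=1}^{n+1} f_i(\lambda)\qquad\text{for all }\lambda\in\Gamma .$$ For $0<T\le\infty$ let $J_T=[0,T]$ ($J_T=[0,\infty)$ if $T=\infty$), $\overline{M_T}=M\times J_T$, let $M_T$ be the set of $(x,t)\in\overline{M_T}$ with $x\in\mathring M$ and $t>0$, and let $\mathcal PM_T=(M\times\{0\})\cup(\partial M\times J_T)$ be the parabolic boundary. $C^k(\overline{M_T})$ is the space of functions whose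 derivatives $\nabla^jD_t^rv$, $j+2r\le k$, exist and are continuous on $\overline{M_T}$, and $$|v|_{C^1}=\sup_{\overline{M_T}}|v|+\sup_{\overline{M_T}}|\nabla v|,\qquad |v|_{C^2}=|v|_{C^1}+\sup_{\overline{M_T}}|\nabla^2v|+\sup_{\overline{M_T}}|v_t| .$$ Let $\lambda(\nabla^2v+\chi)\in\mathbb R^n$ denote the eigenvalues of $\nabla^2v+\chi$ with respect to $g$. Then for all $A_1,A_2,A_3\ge 0$ and every compact set $K\subset\Gamma$ there is a constant $C>0$, depending only on $(M,g)$, $\chi$, $\Gamma$, $f$, $K_0$, $A_1,A_2,A_3$ and $K$, with the following property. Let $0<T\le\infty$; let $\psi\in C^2(\overline{M_T})$ with $|\psi|_{C^2}\le A_3$; let $\underline u\in C^2(\overline{M_T})$ with $|\underline u|_{C^2}\le A_2$ be an admissible subsolution with values in $K$, that is, at every point of $M_T$, $$(\lambda(\nabla^2\underline u+\chi),-\underline u_t)\in K\quad\text{(up to the order of the eigenvalues)}\qquad\text{and}\qquad f(\lambda(\nabla^2\underline u+\chi),-\underline u_t)\ge\psi ;$$ and let $u\in C^3(\overline{M_T})$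 with $|u|_{C^1}\le A_1$ be an admissible solution, that is, at every point of $M_T$, $$(\lambda(\nabla^2u+\chi),-u_t)\in\Gamma\qquad\text{and}\qquad f(\lambda(\nabla^2u+\chi),-u_t)=\psi .$$ Then $$\sup_{\overline{M_T}}|u_t|\ \le\ C\Bigl(1+\sup_{\mathcal PM_T}|u_t|\Bigr).$$ -/

import Mathlib

open scoped Manifold ContDiff Matrix ENNReal NNReal

noncomputable section

namespace ParabolicHessian

/-! ### The cone `Γ` and the function `f` -/

/-- The vector `(lam₁, …, lamₙ, τ)` of `ℝⁿ⁺¹`. -/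
def append {n : ℕ} (lam : Fin n → ℝ) (τ : ℝ) : Fin (n + 1) → ℝ :=
  Fin.snoc (α := fun _ => ℝ) lam τ

/-- An open convex symmetric cone with vertex at the origin that contains the positive cone. -/
structure IsSymmetricCone {m : ℕ} (Γ : Set (Fin m → ℝ)) : Prop where
  isOpen : IsOpen Γ
  convex : Convex ℝ Γ
  smul_mem : ∀ s : ℝ, 0 < s → ∀ lam ∈ Γ, s • lam ∈ Γ
  perm_mem : ∀ σ : Equiv.Perm (Fin m), ∀ lam ∈ Γ, lam ∘ σ ∈ Γ
  pos_mem : ∀ lam : Fin m → ℝ, (∀ i, 0 < lam i) → lam ∈ Γ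

/-- The partial derivative `f_i = ∂f/∂lam_i`. -/
def partialD {m : ℕ} (f : (Fin m → ℝ) → ℝ) (i : Fin m) (lam : Fin m → ℝ) : ℝ :=
  fderiv ℝ f lam (Pi.single i 1)

/-- `f` is a smooth symmetric function on `Γ` that is strictly increasing in each variable
(`f_i > 0`) and concave. -/
structure IsStructural {m : ℕ} (Γ : Set (Fin m → ℝ)) (f : (Fin m → ℝ) → ℝ) : Prop where
  smooth : ContDiffOn ℝ ∞ f Γ
  symmetric : ∀ σ : Equiv.Perm (Fin m), ∀ lam ∈ Γ, f (lam ∘ σ) = f lam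
  increasing : ∀ lam ∈ Γ, ∀ i, 0 < partialD f i lam
  concave : ConcaveOn ℝ Γ f

/-! ### Space-time cylinder -/

/-- The closed time interval: `[0, T]` if `T` is finite and `[0, ∞)` if `T = ∞`. -/
def timeInterval (T : EReal) : Set ℝ := {t | 0 ≤ t ∧ (t : EReal) ≤ T}

/-- The derivative `u_t`, one-sided at the ends of the time interval. -/
def timeDeriv {M : Type*} (T : EReal) (u : M → ℝ → ℝ) (x : M) (t : ℝ) : ℝ :=
  derivWithin (u x) (timeInterval T) t

section Manifold

variable {n : ℕ} [NeZero n] {M : Type*} [TopologicalSpace M]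
  [ChartedSpace (EuclideanHalfSpace n) M]

/-- The parabolic boundary: bottom `M × {0}` and lateral side `∂M × [0, T]`. -/
def parabolicBoundary (n : ℕ) [NeZero n] (M : Type*) [TopologicalSpace M]
    [ChartedSpace (EuclideanHalfSpace n) M] (T : EReal) : Set (M × ℝ) :=
  {p | p.2 ∈ timeInterval T ∧ (p.2 = 0 ∨ p.1 ∈ (𝓡∂ n).boundary M)}

/-- The space `C^k` of the closed cylinder: all derivatives `∇^j D_t^r u` with `j + 2 r ≤ k`
exist and are continuous on `M × [0, T]`, up to the boundary. Spatial derivatives are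
taken in the charts of `M`. -/
structure IsParabolicC (n : ℕ) [NeZero n] {M : Type*} [TopologicalSpace M]
    [ChartedSpace (EuclideanHalfSpace n) M] (k : ℕ) (T : EReal) (u : M → ℝ → ℝ) : Prop where
  time : ∀ x, ContDiffOn ℝ ((k / 2 : ℕ) : ℕ∞ω) (u x) (timeInterval T)
  space : ∀ r : ℕ, 2 * r ≤ k → ∀ t ∈ timeInterval T,
    ContMDiff (𝓡∂ n) 𝓘(ℝ, ℝ) ((k - 2 * r : ℕ) : ℕ∞ω)
      (fun x => iteratedDerivWithin r (u x) (timeInterval T) t)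
  continuous : ∀ r j : ℕ, j + 2 * r ≤ k → ∀ c : M,
    ContinuousOn
      (fun p : EuclideanSpace ℝ (Fin n) × ℝ =>
        iteratedFDerivWithin ℝ j
          (fun y => iteratedDerivWithin r (u ((extChartAt (𝓡∂ n) c).symm y)) (timeInterval T) p.2)
          (Set.range (𝓡∂ n)) p.1)
      ((extChartAt (𝓡∂ n) c).target ×ˢ timeInterval T)

/-! ### Local coordinates

Everything below is expressed in the local coordinates of the chart centred at a point `c` of
`M`; `y` is a point of the image of that chart (in the Euclidean half-space). -/

/-- The partial derivative `∂_i h` in coordinates (one-sided at the boundary of the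
half-space). -/
def coordDeriv (i : Fin n) (h : EuclideanSpace ℝ (Fin n) → ℝ) (y : EuclideanSpace ℝ (Fin n)) : ℝ :=
  fderivWithin ℝ h (Set.range (𝓡∂ n)) y (EuclideanSpace.single i 1)

/-- The function `v` on `M`, read in the chart centred at `c`. -/
def coordFun (v : M → ℝ) (c : M) (y : EuclideanSpace ℝ (Fin n)) : ℝ :=
  v ((extChartAt (𝓡∂ n) c).symm y)

/-- The coordinate vector field `∂_i` of the chart centred at `c`, at the point with
coordinates `y`. -/
def coordVector (c : M) (i : Fin n) (y : EuclideanSpace ℝ (Fin n)) :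
    TangentSpace (𝓡∂ n) ((extChartAt (𝓡∂ n) c).symm y) :=
  mfderivWithin 𝓘(ℝ, EuclideanSpace ℝ (Fin n)) (𝓡∂ n) (extChartAt (𝓡∂ n) c).symm
    (Set.range (𝓡∂ n)) y (EuclideanSpace.single i 1 : EuclideanSpace ℝ (Fin n))

/-- The components `B_ij = B(∂_i, ∂_j)` of a `(0,2)` tensor field `B`. -/
def coordTensor
    (B : (x : M) → TangentSpace (𝓡∂ n) x →L[ℝ] TangentSpace (𝓡∂ n) x →L[ℝ] ℝ)
    (c : M) (y : EuclideanSpace ℝ (Fin n)) : Matrix (Fin n) (Fin n) ℝ :=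
  Matrix.of fun i j =>
    B ((extChartAt (𝓡∂ n) c).symm y) (coordVector c i y) (coordVector c j y)

variable [IsManifold (𝓡∂ n) ∞ M]

/-- A smooth Riemannian metric on the manifold with boundary `M`. -/
abbrev Metric (n : ℕ) [NeZero n] (M : Type*) [TopologicalSpace M]
    [ChartedSpace (EuclideanHalfSpace n) M] [IsManifold (𝓡∂ n) ∞ M] :=
  Bundle.ContMDiffRiemannianMetric (𝓡∂ n) ∞ (EuclideanSpace ℝ (Fin n))
    (fun x : M => TangentSpace (𝓡∂ n) x)

/-- A smooth symmetric `(0,2)` tensor field on `M`. -/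
structure SymmetricTensor (n : ℕ) [NeZero n] (M : Type*) [TopologicalSpace M]
    [ChartedSpace (EuclideanHalfSpace n) M] [IsManifold (𝓡∂ n) ∞ M] where
  form : (x : M) → TangentSpace (𝓡∂ n) x →L[ℝ] TangentSpace (𝓡∂ n) x →L[ℝ] ℝ
  symm : ∀ x v w, form x v w = form x w v
  smooth : ContMDiff (𝓡∂ n)
    ((𝓡∂ n).prod 𝓘(ℝ, EuclideanSpace ℝ (Fin n) →L[ℝ] EuclideanSpace ℝ (Fin n) →L[ℝ] ℝ)) ∞
    (fun x : M => Bundle.TotalSpace.mk'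
      (EuclideanSpace ℝ (Fin n) →L[ℝ] EuclideanSpace ℝ (Fin n) →L[ℝ] ℝ) x (form x))

/-- The matrix `g_ij`. -/
def metricCoord (g : Metric n M) (c : M) (y : EuclideanSpace ℝ (Fin n)) :
    Matrix (Fin n) (Fin n) ℝ :=
  coordTensor g.inner c y

/-- The Christoffel symbol
`Γ^k_ij = 1/2 ∑_l g^{kl} (∂_i g_jl + ∂_j g_il - ∂_l g_ij)` of the Levi-Civita connection. -/
def christoffel (g : Metric n M) (c : M) (k i j : Fin n) (y : EuclideanSpace ℝ (Fin n)) : ℝ :=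
  (1 / 2) * ∑ l, (metricCoord g c y)⁻¹ k l *
    (coordDeriv i (fun z => metricCoord g c z j l) y
      + coordDeriv j (fun z => metricCoord g c z i l) y
      - coordDeriv l (fun z => metricCoord g c z i j) y)

/-- The components `∇_ij v = ∂_i ∂_j v - ∑_k Γ^k_ij ∂_k v` of the Hessian `∇² v`. -/
def hessianCoord (g : Metric n M) (v : M → ℝ) (c : M) (y : EuclideanSpace ℝ (Fin n)) :
    Matrix (Fin n) (Fin n) ℝ :=
  Matrix.of fun i j =>
    coordDeriv i (coordDeriv j (coordFun v c)) y
      - ∑ k, christoffel g c k i j y * coordDeriv k (coordFun v c) y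

/-- `|∇v| = (∑ g^{ij} ∂_i v ∂_j v)^{1/2}` at the point with coordinates `y`. -/
def gradNorm (g : Metric n M) (v : M → ℝ) (c : M) (y : EuclideanSpace ℝ (Fin n)) : ℝ :=
  Real.sqrt (∑ i, ∑ j, (metricCoord g c y)⁻¹ i j *
    coordDeriv i (coordFun v c) y * coordDeriv j (coordFun v c) y)

/-- `|∇²v| = (∑ g^{ik} g^{jl} ∇_ij v ∇_kl v)^{1/2}` at the point with coordinates `y`. -/
def hessNorm (g : Metric n M) (v : M → ℝ) (c : M) (y : EuclideanSpace ℝ (Fin n)) : ℝ :=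
  Real.sqrt (∑ i, ∑ j, ∑ k, ∑ l, (metricCoord g c y)⁻¹ i k * (metricCoord g c y)⁻¹ j l *
    hessianCoord g v c y i j * hessianCoord g v c y k l)

/-! ### Parabolic norms

The quantities `|∇v|` and `|∇²v|` do not depend on the chart in which they are computed, so the
supremum over all charts and all points of the chart domain is the supremum over `M`. The norms
take values in `[0, ∞]`. -/

/-- `sup |v|` over the closed cylinder. -/
def supNorm (T : EReal) (v : M → ℝ → ℝ) : ℝ≥0∞ :=
  ⨆ x, ⨆ t ∈ timeInterval T, ENNReal.ofReal |v x t|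

/-- `sup |∇v|` over the closed cylinder. -/
def supGradNorm (g : Metric n M) (T : EReal) (v : M → ℝ → ℝ) : ℝ≥0∞ :=
  ⨆ c : M, ⨆ y ∈ (extChartAt (𝓡∂ n) c).target, ⨆ t ∈ timeInterval T,
    ENNReal.ofReal (gradNorm g (fun x => v x t) c y)

/-- `sup |∇²v|` over the closed cylinder. -/
def supHessNorm (g : Metric n M) (T : EReal) (v : M → ℝ → ℝ) : ℝ≥0∞ :=
  ⨆ c : M, ⨆ y ∈ (extChartAt (𝓡∂ n) c).target, ⨆ t ∈ timeInterval T,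
    ENNReal.ofReal (hessNorm g (fun x => v x t) c y)

/-- The parabolic norm `|v|_{C^1}`. -/
def normC1 (g : Metric n M) (T : EReal) (v : M → ℝ → ℝ) : ℝ≥0∞ :=
  supNorm T v + supGradNorm g T v

/-- The parabolic norm `|v|_{C^2}`; it contains one time derivative. -/
def normC2 (g : Metric n M) (T : EReal) (v : M → ℝ → ℝ) : ℝ≥0∞ :=
  supNorm T v + supGradNorm g T v + supHessNorm g T v + supNorm T (timeDeriv T v)

/-! ### The operator -/

/-- `lam` lists the eigenvalues, with multiplicity, of the symmetric bilinear form `U` with respect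
to the inner product `G`: the columns of some `P` are a `G`-orthonormal basis in which
`U` is diagonal with entries `lam`. -/
def IsEigenvalueList (G U : Matrix (Fin n) (Fin n) ℝ) (lam : Fin n → ℝ) : Prop :=
  ∃ P : Matrix (Fin n) (Fin n) ℝ, Pᵀ * G * P = 1 ∧ Pᵀ * U * P = Matrix.diagonal lam

/-- `μ` is the vector `(λ(∇²u + χ), -u_t)` of `ℝⁿ⁺¹` at the point with coordinates `y` in the chart
centred at `c`, at time `t`; the eigenvalues are listed in some order. -/
def IsSpectralVector (g : Metric n M) (χ : SymmetricTensor n M) (T : EReal) (u : M → ℝ → ℝ)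
    (c : M) (y : EuclideanSpace ℝ (Fin n)) (t : ℝ) (μ : Fin (n + 1) → ℝ) : Prop :=
  ∃ lam : Fin n → ℝ,
    IsEigenvalueList (metricCoord g c y)
      (hessianCoord g (fun x => u x t) c y + coordTensor χ.form c y) lam ∧
    μ = append lam (-timeDeriv T u ((extChartAt (𝓡∂ n) c).symm y) t)

/-- The condition `Q (λ(∇²u + χ), -u_t) x t` holds at every point `x` of the interior of `M` and
every time `t` with `0 < t ≤ T`, in all charts. As the eigenvalues do not depend on
the chart, for a condition `Q` that is symmetric in the entries of the vector neither
the chart nor the order of the eigenvalues matters. -/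
def SpectralCondition (g : Metric n M) (χ : SymmetricTensor n M) (T : EReal) (u : M → ℝ → ℝ)
    (Q : (Fin (n + 1) → ℝ) → M → ℝ → Prop) : Prop :=
  ∀ c : M, ∀ y ∈ (extChartAt (𝓡∂ n) c).target,
    (extChartAt (𝓡∂ n) c).symm y ∈ (𝓡∂ n).interior M →
    ∀ t ∈ timeInterval T, 0 < t →
      ∃ μ, IsSpectralVector g χ T u c y t μ ∧ Q μ ((extChartAt (𝓡∂ n) c).symm y) t

/-- `u` is an admissible solution of `f(λ(∇²u + χ), -u_t) = ψ` in `M × (0, T]`. -/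
def IsAdmissibleSolution (g : Metric n M) (χ : SymmetricTensor n M)
    (Γ : Set (Fin (n + 1) → ℝ)) (f : (Fin (n + 1) → ℝ) → ℝ) (T : EReal) (ψ u : M → ℝ → ℝ) : Prop :=
  SpectralCondition g χ T u fun μ x t => μ ∈ Γ ∧ f μ = ψ x t

/-- `w` is a subsolution, `f(λ(∇²w + χ), -w_t) ≥ ψ` in `M × (0, T]`, and the vectors
`(λ(∇²w + χ), -w_t)` lie in the set `K`. For `K ⊆ Γ` it is an admissible subsolution. -/
def IsSubsolutionIn (g : Metric n M) (χ : SymmetricTensor n M)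
    (K : Set (Fin (n + 1) → ℝ)) (f : (Fin (n + 1) → ℝ) → ℝ) (T : EReal) (ψ w : M → ℝ → ℝ) : Prop :=
  SpectralCondition g χ T w fun μ x t => μ ∈ K ∧ ψ x t ≤ f μ

end Manifold

end ParabolicHessian

end

/-!
The a priori bound for `u_t` is a maximum principle argument. As `u` has only three derivatives,
`u_t` cannot be differentiated twice; it is replaced by the difference quotients
`z = (u(t + k) - u(t)) / |k|` for small `k` of either sign. By concavity of `f`
(`IsStructural.sub_le_sum`) together with Schur's inequality for the diagonal of a symmetric matrix
(`IsEigenvalueList.append_diag_mem`), `z` satisfies `L z ≥ -A₃`, where `L` is the linearization of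
the equation at `(x, t)`.

One looks at a maximum of `z exp (δ |∇u|² + b (w - u))`, with `w` the subsolution. If it lies on the
parabolic boundary, `z` is controlled by the boundary values of `u_t`, up to the oscillation of
`u_t` over a time of length `|k|`. At an interior maximum (`InteriorMaximum`), three facts are used.

* `L |∇u|²` is at least `∑ f_i (2 λ_i² - C |λ_i| - C) - C`
  (`PointBounds.linearized_testFun_ge`). Here `|∇u|²` is the supremum over `V` of
  `2 du(V) - g(V, V)`, and it suffices to use one field `V`, affine in the coordinates, that attains
  the supremum at the point. The third derivatives of `u` are eliminated with the equation
  differentiated once in space (`IsStructural.differentiated_equation`).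
* `L (w - u) = ∑ f_j (κ_j - μ_j)`, where `μ` is the vector of `u` and `κ` that of `w` in the
  eigenframe of `u`, which lies in the convex hull of the permutations of a vector of `K`. As
  `f κ ≥ f μ` and raising any entry of `κ` raises `f` by a definite amount, either
  `L (w - u) ≥ ε (1 + ∑ f_j)` or every `f_j` is at least `ε ∑ f_i` (`IsStructural.dichotomy`).
* `∑ f_j` is bounded below; this is where the condition with `K₀` enters
  (`IsStructural.sum_partialD_lower_bound`).

For suitable `δ` and `b` (`exists_weights`), the first alternative bounds `z`. In the second one the
`λ_i` are bounded, hence so is `u_t`, again by the condition with `K₀` (`abs_last_le`). All this is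
`exists_interior_estimate`, which is stated in a normed space. The part on charts reads the
manifold in coordinates, with bounds that are uniform by compactness (`exists_uniform_bounds`);
`difference_quotient_le` is the maximum principle on the whole cylinder, and
`exists_abs_timeDeriv_le` combines forward and backward quotients.
-/

set_option maxSynthPendingDepth 3

noncomputable section

namespace ParabolicHessian

/-! ### Eigenvalue lists and the Schur–Horn inequality -/

section Eigenvalues

variable {n : ℕ}

@[simp] lemma append_castSucc (lam : Fin n → ℝ) (τ : ℝ) (i : Fin n) :
    append lam τ i.castSucc = lam i := by simp [append]

@[simp] lemma append_last (lam : Fin n → ℝ) (τ : ℝ) : append lam τ (Fin.last n) = τ := by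
  simp [append]

lemma append_comp_perm (lam : Fin n → ℝ) (τ : ℝ) (σ : Equiv.Perm (Fin n)) :
    ∃ σ' : Equiv.Perm (Fin (n + 1)), append (lam ∘ σ) τ = append lam τ ∘ σ' := by
  refine ⟨finSuccEquivLast.symm.permCongr (Equiv.optionCongr σ), ?_⟩
  ext i
  refine Fin.lastCases ?_ (fun j => ?_) i
  · simp [Equiv.permCongr_apply]
  · simp [Equiv.permCongr_apply]

/-- The convex hull of all the vectors obtained from those of `K` by permuting the entries. -/
def symmHull {m : ℕ} (K : Set (Fin m → ℝ)) : Set (Fin m → ℝ) :=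
  convexHull ℝ (⋃ σ : Equiv.Perm (Fin m), (fun lam => lam ∘ σ) '' K)

/-- Schur's half of the Schur–Horn theorem: the diagonal of a symmetric matrix is a convex
combination of permutations of its eigenvalues, because the squared entries of an orthogonal
matrix form a doubly stochastic matrix. -/
lemma IsEigenvalueList.append_diag_mem {V : Matrix (Fin n) (Fin n) ℝ} {lam : Fin n → ℝ} {τ : ℝ}
    (h : IsEigenvalueList 1 V lam) {K : Set (Fin (n + 1) → ℝ)} (hK : append lam τ ∈ K) :
    append (fun i => V i i) τ ∈ symmHull K := by
  obtain ⟨P, hP, hV⟩ := h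
  rw [Matrix.mul_one] at hP
  have hP' : P * Pᵀ = 1 := mul_eq_one_comm.mp hP
  have hVeq : V = P * Matrix.diagonal lam * Pᵀ := by
    rw [← hV]
    calc V = (P * Pᵀ) * V * (P * Pᵀ) := by rw [hP']; simp
      _ = _ := by simp only [Matrix.mul_assoc]
  have hdiag : ∀ i, V i i = ∑ j, P i j ^ 2 * lam j := by
    intro i
    conv_lhs => rw [hVeq]
    rw [Matrix.mul_apply]
    refine Finset.sum_congr rfl fun j _ => ?_
    rw [Matrix.mul_diagonal, Matrix.transpose_apply]; ring
  have hD : (Matrix.of fun i j => P i j ^ 2) ∈ doublyStochastic ℝ (Fin n) := by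
    rw [mem_doublyStochastic_iff_sum]
    refine ⟨fun i j => sq_nonneg _, fun i => ?_, fun j => ?_⟩
    · have := congrFun (congrFun hP' i) i
      rw [Matrix.mul_apply, Matrix.one_apply_eq] at this
      rw [← this]
      exact Finset.sum_congr rfl fun j _ => by simp [sq]
    · have := congrFun (congrFun hP j) j
      rw [Matrix.mul_apply, Matrix.one_apply_eq] at this
      rw [← this]
      exact Finset.sum_congr rfl fun j _ => by simp [sq]
  obtain ⟨w, hw0, hw1, hw⟩ := exists_eq_sum_perm_of_mem_doublyStochastic hD
  have key : append (fun i => V i i) τ = ∑ σ, w σ • append (lam ∘ σ) τ := by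
    ext i
    refine Fin.lastCases ?_ (fun j => ?_) i
    · simp [Finset.sum_apply, ← Finset.sum_mul, hw1]
    · simp only [append_castSucc, Finset.sum_apply, Pi.smul_apply, smul_eq_mul]
      rw [hdiag]
      have : ∀ l, P j l ^ 2 = ∑ σ, w σ * (Equiv.Perm.permMatrix ℝ σ) j l := by
        intro l
        have := congrFun (congrFun hw j) l
        simp only [Matrix.of_apply] at this
        rw [← this]
        simp [Matrix.sum_apply]
      simp_rw [this, Finset.sum_mul]
      rw [Finset.sum_comm]
      refine Finset.sum_congr rfl fun σ _ => ?_
      simp_rw [mul_assoc, ← Finset.mul_sum]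
      congr 1
      simp [Equiv.Perm.permMatrix, PEquiv.toMatrix_apply]
  rw [key]
  refine (convex_convexHull ℝ _).sum_mem (fun σ _ => hw0 σ) hw1 fun σ _ => ?_
  obtain ⟨σ', hσ'⟩ := append_comp_perm lam τ σ
  exact subset_convexHull ℝ _ (Set.mem_iUnion.mpr ⟨σ', _, hK, hσ'.symm⟩)

lemma IsEigenvalueList.conj {G U Q : Matrix (Fin n) (Fin n) ℝ} {lam : Fin n → ℝ}
    (h : IsEigenvalueList G U lam) (hQ : IsUnit Q.det) :
    IsEigenvalueList (Qᵀ * G * Q) (Qᵀ * U * Q) lam := by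
  obtain ⟨P, hP, hU⟩ := h
  have h1 : Q * Q⁻¹ = 1 := Matrix.mul_nonsing_inv Q hQ
  have h2 : (Q⁻¹)ᵀ * Qᵀ = 1 := by rw [← Matrix.transpose_mul, h1, Matrix.transpose_one]
  have aux : ∀ B : Matrix (Fin n) (Fin n) ℝ,
      (Q⁻¹ * P)ᵀ * (Qᵀ * B * Q) * (Q⁻¹ * P) = Pᵀ * B * P := by
    intro B
    calc (Q⁻¹ * P)ᵀ * (Qᵀ * B * Q) * (Q⁻¹ * P)
        = Pᵀ * ((Q⁻¹)ᵀ * Qᵀ) * B * (Q * Q⁻¹) * P := by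
          simp only [Matrix.transpose_mul, Matrix.mul_assoc]
      _ = _ := by rw [h1, h2]; simp
  exact ⟨Q⁻¹ * P, by rw [aux, hP], by rw [aux, hU]⟩

end Eigenvalues

section Hull

variable {m : ℕ} {Γ K : Set (Fin m → ℝ)}

lemma symmHull_subset (hΓ : IsSymmetricCone Γ) (hK : K ⊆ Γ) : symmHull K ⊆ Γ := by
  refine convexHull_min ?_ hΓ.convex
  refine Set.iUnion_subset fun σ => ?_
  rintro _ ⟨lam, hlam, rfl⟩
  exact hΓ.perm_mem σ lam (hK hlam)

lemma le_of_mem_symmHull {f : (Fin m → ℝ) → ℝ} (hΓ : IsSymmetricCone Γ) (hf : IsStructural Γ f)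
    (hK : K ⊆ Γ) {a : ℝ} (ha : ∀ lam ∈ K, a ≤ f lam) {κ : Fin m → ℝ} (hκ : κ ∈ symmHull K) :
    a ≤ f κ := by
  have hsub : symmHull K ⊆ {x | x ∈ Γ ∧ a ≤ f x} := by
    refine convexHull_min ?_ (hf.concave.convex_ge a)
    refine Set.iUnion_subset fun σ => ?_
    rintro _ ⟨lam, hlam, rfl⟩
    refine ⟨hΓ.perm_mem σ lam (hK hlam), ?_⟩
    rw [hf.symmetric σ lam (hK hlam)]
    exact ha lam hlam
  exact (hsub hκ).2

end Hull

/-! ### Concave symmetric functions on a cone -/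

section Structural

open Filter Topology

variable {m : ℕ} {Γ : Set (Fin m → ℝ)} {f : (Fin m → ℝ) → ℝ}

lemma IsSymmetricCone.add_mem (hΓ : IsSymmetricCone Γ) {a b : Fin m → ℝ} (ha : a ∈ Γ)
    (hb : b ∈ Γ) : a + b ∈ Γ := by
  have h := hΓ.smul_mem 2 two_pos _ (hΓ.convex ha hb (by norm_num : (0 : ℝ) ≤ 1 / 2)
    (by norm_num : (0 : ℝ) ≤ 1 / 2) (by norm_num))
  rwa [← smul_add, smul_smul, show (2 : ℝ) * (1 / 2) = 1 by norm_num, one_smul] at h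

lemma IsSymmetricCone.add_nonneg_mem (hΓ : IsSymmetricCone Γ) {a v : Fin m → ℝ} (ha : a ∈ Γ)
    (hv : ∀ i, 0 ≤ v i) : a + v ∈ Γ := by
  have hc : Tendsto (fun s : ℝ => a - fun _ => s) (𝓝[>] 0) (𝓝 a) := by
    have : ContinuousAt (fun s : ℝ => a - fun _ => s) 0 := by fun_prop
    have h2 := this.tendsto
    simp only [show (a - fun _ => (0 : ℝ)) = a from sub_zero a] at h2
    exact h2.mono_left nhdsWithin_le_nhds
  obtain ⟨s, hs, hs0⟩ := ((hc.eventually (hΓ.isOpen.mem_nhds ha)).and self_mem_nhdsWithin).exists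
  have h1 := hΓ.add_mem hs (hΓ.pos_mem (v + fun _ => s) fun i =>
    add_pos_of_nonneg_of_pos (hv i) hs0)
  convert h1 using 1
  abel

lemma IsStructural.differentiableAt (hΓ : IsSymmetricCone Γ) (hf : IsStructural Γ f)
    {μ : Fin m → ℝ} (hμ : μ ∈ Γ) : DifferentiableAt ℝ f μ :=
  (hf.smooth.contDiffAt (hΓ.isOpen.mem_nhds hμ)).differentiableAt (by simp)

lemma fderiv_eq_sum_partialD (f : (Fin m → ℝ) → ℝ) (μ v : Fin m → ℝ) :
    fderiv ℝ f μ v = ∑ i, partialD f i μ * v i := by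
  conv_lhs => rw [← Finset.univ_sum_single v]
  rw [map_sum]
  refine Finset.sum_congr rfl fun i _ => ?_
  have : (Pi.single i (v i) : Fin m → ℝ) = v i • Pi.single i (1 : ℝ) := by
    rw [← Pi.single_smul]; simp
  rw [this, map_smul, smul_eq_mul, mul_comm, partialD]

/-- The graph of a concave function lies below its tangent planes. -/
lemma IsStructural.sub_le_sum (hΓ : IsSymmetricCone Γ) (hf : IsStructural Γ f)
    {μ η : Fin m → ℝ} (hμ : μ ∈ Γ) (hη : η ∈ Γ) :
    f η - f μ ≤ ∑ i, partialD f i μ * (η i - μ i) := by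
  have hd : HasDerivAt (fun t : ℝ => f (μ + t • (η - μ))) (fderiv ℝ f μ (η - μ)) 0 := by
    have h1 : HasDerivAt (fun t : ℝ => μ + t • (η - μ)) (η - μ) 0 := by
      simpa using ((hasDerivAt_id (0 : ℝ)).smul_const (η - μ)).const_add μ
    have h2 : HasFDerivAt f (fderiv ℝ f μ) (μ + (0 : ℝ) • (η - μ)) := by
      simpa using (hf.differentiableAt hΓ hμ).hasFDerivAt
    exact h2.comp_hasDerivAt 0 h1
  have ht := (hasDerivAt_iff_tendsto_slope.mp hd).mono_left
    (nhdsWithin_mono 0 (s := Set.Ioi 0) fun x hx => ne_of_gt hx)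
  rw [← show fderiv ℝ f μ (η - μ) = ∑ i, partialD f i μ * (η i - μ i) from
    fderiv_eq_sum_partialD f μ (η - μ)]
  refine ge_of_tendsto ht ?_
  filter_upwards [Ioo_mem_nhdsGT (zero_lt_one (α := ℝ))] with t ht
  have hc := hf.concave.2 hμ hη (by linarith [ht.2] : (0 : ℝ) ≤ 1 - t) ht.1.le (by ring)
  have he : (1 - t) • μ + t • η = μ + t • (η - μ) := by
    rw [sub_smul, smul_sub, one_smul]; abel
  rw [he] at hc
  simp only [slope_def_field, sub_zero, zero_smul, add_zero, smul_eq_mul] at hc ⊢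
  rw [le_div_iff₀ ht.1]
  linarith

/-- On a compact set `K ⊆ Γ`, raising one entry by `1` and lowering all entries by a small `s`
raises `f` by at least `s`. -/
lemma IsStructural.exists_raise (hΓ : IsSymmetricCone Γ) (hf : IsStructural Γ f)
    {K : Set (Fin m → ℝ)} (hK : IsCompact K) (hKΓ : K ⊆ Γ) :
    ∃ s : ℝ, 0 < s ∧ ∀ κ ∈ K, ∀ j, (κ + Pi.single j 1 - fun _ => s) ∈ Γ ∧
      f κ + s ≤ f (κ + Pi.single j 1 - fun _ => s) := by
  have key : ∀ j : Fin m, ∀ᶠ s in 𝓝 (0 : ℝ), ∀ κ ∈ K, (κ + Pi.single j 1 - fun _ => s) ∈ Γ ∧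
      f κ + s < f (κ + Pi.single j 1 - fun _ => s) := by
    intro j
    refine hK.eventually_forall_of_forall_eventually fun κ hκ => ?_
    have hΓ1 : κ + Pi.single j 1 ∈ Γ := hΓ.add_nonneg_mem (hKΓ hκ) fun i => by
      by_cases h : i = j
      · subst h; simp
      · simp [h]
    have hlt : f κ < f (κ + Pi.single j 1) := by
      have h1 := hf.sub_le_sum hΓ hΓ1 (hKΓ hκ)
      have h2 : ∑ i, partialD f i (κ + Pi.single j 1) * (κ i - (κ + Pi.single j 1 : Fin m → ℝ) i)
          = - partialD f j (κ + Pi.single j 1) := by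
        rw [Finset.sum_eq_single j]
        · simp
        · intro i _ hi
          simp [hi]
        · simp
      have h3 := hf.increasing _ hΓ1 j
      linarith
    have hcont : ∀ ν ∈ Γ, ContinuousAt f ν := fun ν hν => (hf.differentiableAt hΓ hν).continuousAt
    have h0 : ((κ + Pi.single j 1 - fun _ => (0 : ℝ)) : Fin m → ℝ) = κ + Pi.single j 1 :=
      sub_zero _
    have hmap' : ContinuousAt (fun p : ℝ × (Fin m → ℝ) =>
      (p.2 + Pi.single j 1 - fun _ => p.1 : Fin m → ℝ)) (0, κ) := by fun_prop
    refine Filter.Eventually.and ?_ ?_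
    · refine hmap'.eventually_mem (hΓ.isOpen.mem_nhds ?_)
      rw [h0]; exact hΓ1
    · have hl : ContinuousAt (fun p : ℝ × (Fin m → ℝ) => f p.2 + p.1) (0, κ) := by
        have : ContinuousAt (fun p : ℝ × (Fin m → ℝ) => f p.2) (0, κ) :=
          ContinuousAt.comp (f := Prod.snd) (hcont κ (hKΓ hκ)) continuousAt_snd
        exact this.add continuousAt_fst
      have hr : ContinuousAt (fun p : ℝ × (Fin m → ℝ) =>
          f (p.2 + Pi.single j 1 - fun _ => p.1)) (0, κ) := by
        refine ContinuousAt.comp (g := f) ?_ hmap'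
        rw [h0]; exact hcont _ hΓ1
      refine hl.eventually_lt hr ?_
      simp only [h0, add_zero]
      exact hlt
  have hall := (eventually_all.mpr key).filter_mono (nhdsWithin_le_nhds (s := Set.Ioi 0))
  obtain ⟨s, hs, hs0⟩ := (hall.and self_mem_nhdsWithin).exists
  exact ⟨s, hs0, fun κ hκ j => ⟨(hs j κ hκ).1, (hs j κ hκ).2.le⟩⟩

/-- The property of `exists_raise` passes from a vector to the convex hull of its permutations. -/
lemma IsStructural.raise_of_mem_symmHull (hΓ : IsSymmetricCone Γ) (hf : IsStructural Γ f)
    {κ₀ κ : Fin m → ℝ} {a s : ℝ} (ha : a ≤ f κ₀)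
    (h : ∀ j, (κ₀ + Pi.single j 1 - fun _ => s) ∈ Γ ∧
      f κ₀ + s ≤ f (κ₀ + Pi.single j 1 - fun _ => s)) (hκ : κ ∈ symmHull {κ₀}) (j : Fin m) :
    (κ + Pi.single j 1 - fun _ => s) ∈ Γ ∧ a + s ≤ f (κ + Pi.single j 1 - fun _ => s) := by
  have hconv : Convex ℝ {κ : Fin m → ℝ | (κ + Pi.single j 1 - fun _ => s) ∈ Γ ∧
      a + s ≤ f (κ + Pi.single j 1 - fun _ => s)} := by
    have hset : {κ : Fin m → ℝ | (κ + Pi.single j 1 - fun _ => s) ∈ Γ ∧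
        a + s ≤ f (κ + Pi.single j 1 - fun _ => s)}
        = (fun x => x + (Pi.single j 1 - fun _ => s : Fin m → ℝ)) ⁻¹'
          {x | x ∈ Γ ∧ a + s ≤ f x} := by
      ext x
      simp [← add_sub_assoc]
    rw [hset]
    exact (hf.concave.convex_ge (a + s)).translate_preimage_left _
  refine convexHull_min ?_ hconv hκ
  refine Set.iUnion_subset fun σ => ?_
  rintro _ ⟨lam, hlam, rfl⟩
  obtain rfl : lam = κ₀ := hlam
  have he : ((lam ∘ σ) + Pi.single j 1 - fun _ => s : Fin m → ℝ)
      = (lam + Pi.single (σ j) 1 - fun _ => s) ∘ σ := by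
    ext i
    simp [Pi.single_apply]
  obtain ⟨h1, h2⟩ := h (σ j)
  refine ⟨?_, ?_⟩
  · simp only [he]; exact hΓ.perm_mem σ _ h1
  · simp only [he]; rw [hf.symmetric σ _ h1]; linarith

lemma abs_le_of_mem_symmHull {κ₀ κ : Fin m → ℝ} {R : ℝ} (h : ∀ i, |κ₀ i| ≤ R)
    (hκ : κ ∈ symmHull {κ₀}) (i : Fin m) : |κ i| ≤ R := by
  have hconv : Convex ℝ {κ : Fin m → ℝ | |κ i| ≤ R} := by
    have hset : {κ : Fin m → ℝ | |κ i| ≤ R}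
        = LinearMap.proj (R := ℝ) (φ := fun _ => ℝ) i ⁻¹' Set.Icc (-R) R := by
      ext x
      simp [abs_le]
    rw [hset]
    exact (convex_Icc (-R) R).linear_preimage _
  refine convexHull_min ?_ hconv hκ
  refine Set.iUnion_subset fun σ => ?_
  rintro _ ⟨lam, hlam, rfl⟩
  obtain rfl : lam = κ₀ := hlam
  exact h (σ i)

section Dichotomy

variable {μ κ : Fin m → ℝ} {s : ℝ}

lemma IsStructural.le_sum_of_raise (hΓ : IsSymmetricCone Γ) (hf : IsStructural Γ f) (hμ : μ ∈ Γ)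
    (j : Fin m) (h : (κ + Pi.single j 1 - fun _ => s) ∈ Γ ∧
      f μ + s ≤ f (κ + Pi.single j 1 - fun _ => s)) :
    s ≤ ∑ i, partialD f i μ * (κ i - μ i) + partialD f j μ - s * ∑ i, partialD f i μ := by
  have h1 := hf.sub_le_sum hΓ hμ h.1
  have h2 : ∑ i, partialD f i μ * ((κ + Pi.single j 1 - fun _ => s : Fin m → ℝ) i - μ i)
      = ∑ i, partialD f i μ * (κ i - μ i) + partialD f j μ - s * ∑ i, partialD f i μ := by
    have h3 : ∑ i, partialD f i μ * (Pi.single j 1 : Fin m → ℝ) i = partialD f j μ := by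
      simp [Pi.single_apply]
    rw [Finset.mul_sum, ← h3, ← Finset.sum_add_distrib, ← Finset.sum_sub_distrib]
    refine Finset.sum_congr rfl fun i _ => ?_
    simp only [Pi.sub_apply, Pi.add_apply]
    ring
  linarith [h.2]

/-- Either the linearization at `μ` is strictly positive in the direction `κ - μ`, or all the
partial derivatives of `f` at `μ` are comparable. -/
lemma IsStructural.dichotomy (hΓ : IsSymmetricCone Γ) (hf : IsStructural Γ f) (hμ : μ ∈ Γ)
    (hs : 0 < s) (h : ∀ j, (κ + Pi.single j 1 - fun _ => s) ∈ Γ ∧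
      f μ + s ≤ f (κ + Pi.single j 1 - fun _ => s)) :
    s / 2 * (1 + ∑ i, partialD f i μ) ≤ ∑ i, partialD f i μ * (κ i - μ i) ∨
      ∀ j, s / 2 * ∑ i, partialD f i μ ≤ partialD f j μ := by
  by_cases hc : ∀ j, s / 2 * ∑ i, partialD f i μ ≤ partialD f j μ
  · exact Or.inr hc
  · push Not at hc
    obtain ⟨j, hj⟩ := hc
    have := hf.le_sum_of_raise hΓ hμ j (h j)
    left
    linarith

lemma IsStructural.sum_partialD_lower_bound (hΓ : IsSymmetricCone Γ) (hf : IsStructural Γ f)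
    (hμ : μ ∈ Γ) (hs : 0 < s) {K₀ R : ℝ}
    (hfK₀ : -K₀ * ∑ i, partialD f i μ ≤ ∑ i, partialD f i μ * μ i)
    (hκ : ∀ i, |κ i| ≤ R) (j : Fin m) (h : (κ + Pi.single j 1 - fun _ => s) ∈ Γ ∧
      f μ + s ≤ f (κ + Pi.single j 1 - fun _ => s)) :
    s ≤ (R + K₀ + 1) * ∑ i, partialD f i μ := by
  have h1 := hf.le_sum_of_raise hΓ hμ j h
  have hpos : ∀ i, 0 ≤ partialD f i μ := fun i => (hf.increasing μ hμ i).le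
  have h2 : ∑ i, partialD f i μ * κ i ≤ R * ∑ i, partialD f i μ := by
    rw [Finset.mul_sum]
    refine Finset.sum_le_sum fun i _ => ?_
    rw [mul_comm]
    exact mul_le_mul_of_nonneg_right ((le_abs_self _).trans (hκ i)) (hpos i)
  have h3 : partialD f j μ ≤ ∑ i, partialD f i μ :=
    Finset.single_le_sum (fun i _ => hpos i) (Finset.mem_univ j)
  have h4 : ∑ i, partialD f i μ * (κ i - μ i)
      = ∑ i, partialD f i μ * κ i - ∑ i, partialD f i μ * μ i := by
    rw [← Finset.sum_sub_distrib]; exact Finset.sum_congr rfl fun i _ => by ring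
  have h5 : 0 ≤ s * ∑ i, partialD f i μ := mul_nonneg hs.le (Finset.sum_nonneg fun i _ => hpos i)
  linarith

end Dichotomy

end Structural

/-! ### Differentiating the equation along a curve -/

section SquareRoot

open Filter Topology

/-- The inverse function theorem gives a differentiable square root near `1` in a Banach
algebra. -/
lemma exists_local_sqrt (A : Type*) [NormedRing A] [NormedAlgebra ℝ A] [CompleteSpace A] :
    ∃ σ : A → A, σ 1 = 1 ∧ HasFDerivAt σ ((1 / 2 : ℝ) • ContinuousLinearMap.id ℝ A) 1 ∧
      (∀ᶠ x in 𝓝 (1 : A), σ x * σ x = x) ∧ ∀ᶠ y in 𝓝 (1 : A), σ (y * y) = y := by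
  let e : A ≃L[ℝ] A := ContinuousLinearEquiv.smulLeft (Units.mk0 (2 : ℝ) two_ne_zero)
  have hd : HasStrictFDerivAt (fun y : A => y * y) (e : A →L[ℝ] A) 1 := by
    have h := (hasStrictFDerivAt_id (𝕜 := ℝ) (1 : A)).mul' (hasStrictFDerivAt_id (𝕜 := ℝ) (1 : A))
    refine h.congr_fderiv ?_
    ext x
    simp only [id, add_apply, smul_apply,
      ContinuousLinearMap.id_apply, smul_eq_mul, one_mul]
    change _ = (2 : ℝ) • x
    rw [two_smul]
    simp
  have h1 : (1 : A) * 1 = 1 := mul_one 1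
  refine ⟨hd.localInverse _ _ _, ?_, ?_, ?_, hd.eventually_left_inverse⟩
  · have := hd.localInverse_apply_image
    simpa only [h1] using this
  · have := hd.to_localInverse.hasFDerivAt
    simp only [h1] at this
    refine this.congr_fderiv ?_
    ext x
    apply e.injective
    change e (e.symm x) = (2 : ℝ) • ((1 / 2 : ℝ) • x)
    rw [e.apply_symm_apply, smul_smul]
    norm_num
  · have := hd.eventually_right_inverse
    simpa only [h1] using this

attribute [local instance] Matrix.linftyOpNormedRing Matrix.linftyOpNormedAlgebra

variable {n : ℕ}

/-- Along a differentiable curve of symmetric matrices through `1`, the frame `H ^ (-1/2)` is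
differentiable. -/
lemma exists_normalizing_frame {H : ℝ → Matrix (Fin n) (Fin n) ℝ} {H' : Matrix (Fin n) (Fin n) ℝ}
    (hH0 : H 0 = 1) (hH : ∀ i j, HasDerivAt (fun s => H s i j) (H' i j) 0)
    (hsymm : ∀ᶠ s in 𝓝 0, (H s)ᵀ = H s) :
    ∃ R : ℝ → Matrix (Fin n) (Fin n) ℝ, R 0 = 1 ∧
      (∀ i j, HasDerivAt (fun s => R s i j) (-(1 / 2) * H' i j) 0) ∧
      ∀ᶠ s in 𝓝 0, (R s)ᵀ * H s * R s = 1 ∧ IsUnit (R s).det := by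
  obtain ⟨σ, hσ1, hσd, hσr, hσl⟩ := exists_local_sqrt (Matrix (Fin n) (Fin n) ℝ)
  have hHd : HasDerivAt H H' 0 := by
    have h : HasDerivAt (fun s => ∑ i, ∑ j, H s i j • Matrix.single i j (1 : ℝ))
        (∑ i, ∑ j, H' i j • Matrix.single i j (1 : ℝ)) 0 :=
      HasDerivAt.fun_sum fun i _ => HasDerivAt.fun_sum fun j _ => (hH i j).smul_const _
    have e : ∀ B : Matrix (Fin n) (Fin n) ℝ,
        ∑ i, ∑ j, B i j • Matrix.single i j (1 : ℝ) = B := by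
      intro B
      conv_rhs => rw [Matrix.matrix_eq_sum_single B]
      simp
    simpa only [e] using h
  have hinv : HasDerivAt (fun s => Ring.inverse (H s)) (-H') 0 := by
    have h1 := hasFDerivAt_ringInverse (𝕜 := ℝ) (1 : (Matrix (Fin n) (Fin n) ℝ)ˣ)
    rw [Units.val_one, ← hH0] at h1
    have := h1.comp_hasDerivAt 0 hHd
    refine this.congr_deriv ?_
    simp
  have hinv0 : Ring.inverse (H 0) = 1 := by rw [hH0]; simp
  have hRd : HasDerivAt (fun s => σ (Ring.inverse (H s))) (-(1 / 2 : ℝ) • H') 0 := by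
    have h1 : HasFDerivAt σ ((1 / 2 : ℝ) • ContinuousLinearMap.id ℝ _) (Ring.inverse (H 0)) := by
      rw [hinv0]; exact hσd
    have := h1.comp_hasDerivAt 0 hinv
    refine this.congr_deriv ?_
    change (1 / 2 : ℝ) • (-H') = _
    rw [smul_neg, neg_smul]
  refine ⟨fun s => σ (Ring.inverse (H s)), by simp only [hinv0, hσ1], fun i j => ?_, ?_⟩
  · have := ((Matrix.entryLinearMap ℝ ℝ i j).toContinuousLinearMap.hasFDerivAt).comp_hasDerivAt
      0 hRd
    refine this.congr_deriv ?_
    change (-(1 / 2 : ℝ) • H') i j = _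
    simp
  · have hc1 : Tendsto (fun s => Ring.inverse (H s)) (𝓝 0) (𝓝 1) := by
      have := hinv.continuousAt.tendsto; rwa [hinv0] at this
    have hc2 : Tendsto (fun s => (σ (Ring.inverse (H s)))ᵀ) (𝓝 0) (𝓝 1) := by
      have h1 := hRd.continuousAt.tendsto
      rw [hinv0, hσ1] at h1
      have h2 : Continuous fun B : Matrix (Fin n) (Fin n) ℝ => Bᵀ := continuous_id.matrix_transpose
      have := (h2.tendsto 1).comp h1
      simpa [Function.comp_def] using this
    have hunit : ∀ᶠ s in 𝓝 0, IsUnit (H s) := by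
      have := hHd.continuousAt.tendsto
      rw [hH0] at this
      exact this.eventually (Units.nhds (1 : (Matrix (Fin n) (Fin n) ℝ)ˣ))
    filter_upwards [hc1.eventually hσr, hc2.eventually hσl, hunit, hsymm] with s hs1 hs2 hs3 hs4
    set X := Ring.inverse (H s) with hX
    have hXH : X * H s = 1 := Ring.inverse_mul_cancel _ hs3
    have hXT : Xᵀ = X := by
      have h1 : H s * Xᵀ = 1 := by
        have := congrArg Matrix.transpose hXH
        rwa [Matrix.transpose_mul, hs4, Matrix.transpose_one] at this
      exact (left_inv_eq_right_inv hXH h1).symm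
    have hsym : (σ X)ᵀ = σ X := by
      rw [← hs2, ← Matrix.transpose_mul, hs1, hXT]
    have h1 : σ X * (σ X * H s) = 1 := by rw [← mul_assoc, hs1, hXH]
    refine ⟨by rw [hsym]; exact mul_eq_one_comm.mp h1, ?_⟩
    exact Matrix.isUnit_det_of_right_inverse h1

end SquareRoot

section DifferentiatedEquation

open Filter Topology

variable {n : ℕ} {Γ : Set (Fin (n + 1) → ℝ)} {f : (Fin (n + 1) → ℝ) → ℝ}

/-- The equation `f (λ(V), τ) = ψ`, with eigenvalues taken relative to a varying inner product
`H`, differentiated at a point where `H = 1` and `V` is diagonal. By the Schur–Horn inequality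
and concavity, `f` of the diagonal entries in a normalized frame is at least `ψ`, with equality
at the point; the identity is the vanishing of the derivative at this minimum. -/
lemma IsStructural.differentiated_equation (hΓ : IsSymmetricCone Γ) (hf : IsStructural Γ f)
    {H V : ℝ → Matrix (Fin n) (Fin n) ℝ} {H' V' : Matrix (Fin n) (Fin n) ℝ} {τ ψ : ℝ → ℝ}
    {τ' ψ' : ℝ} {lam : Fin n → ℝ} (hH0 : H 0 = 1) (hV0 : V 0 = Matrix.diagonal lam)
    (hH : ∀ i j, HasDerivAt (fun s => H s i j) (H' i j) 0)
    (hV : ∀ i j, HasDerivAt (fun s => V s i j) (V' i j) 0)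
    (hτ : HasDerivAt τ τ' 0) (hψ : HasDerivAt ψ ψ' 0)
    (hsymm : ∀ᶠ s in 𝓝 0, (H s)ᵀ = H s) (hmem : append lam (τ 0) ∈ Γ)
    (h0 : f (append lam (τ 0)) = ψ 0)
    (heq : ∀ᶠ s in 𝓝 0, ∃ l, IsEigenvalueList (H s) (V s) l ∧ append l (τ s) ∈ Γ ∧
      f (append l (τ s)) = ψ s) :
    ∑ i, partialD f i.castSucc (append lam (τ 0)) * (V' i i - lam i * H' i i)
      + partialD f (Fin.last n) (append lam (τ 0)) * τ' = ψ' := by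
  obtain ⟨R, hR0, hR, hRH⟩ := exists_normalizing_frame hH0 hH hsymm
  set d : ℝ → Fin (n + 1) → ℝ := fun s => append (fun i => ((R s)ᵀ * V s * R s) i i) (τ s) with hd
  have hd0 : d 0 = append lam (τ 0) := by
    simp only [hd, hR0, hV0]
    simp
  have hdd : HasDerivAt d (append (fun i => V' i i - lam i * H' i i) τ') 0 := by
    rw [hasDerivAt_pi]
    refine Fin.lastCases ?_ (fun i => ?_)
    · simpa [hd] using hτ
    · simp only [hd, append_castSucc, Matrix.mul_apply, Matrix.transpose_apply]
      have h1 : HasDerivAt (fun s => ∑ k, (∑ j, R s j i * V s j k) * R s k i)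
          (∑ k, ((∑ j, (-(1 / 2) * H' j i * V 0 j k + R 0 j i * V' j k)) * R 0 k i
            + (∑ j, R 0 j i * V 0 j k) * (-(1 / 2) * H' k i))) 0 :=
        HasDerivAt.fun_sum fun k _ =>
          (HasDerivAt.fun_sum fun j _ => (hR j i).mul (hV j k)).mul (hR k i)
      refine h1.congr_deriv ?_
      simp only [hR0, hV0, Matrix.one_apply, Matrix.diagonal_apply]
      simp [Finset.sum_add_distrib]
      ring
  have hfd : HasDerivAt (fun s => f (d s) - ψ s)
      (fderiv ℝ f (d 0) (append (fun i => V' i i - lam i * H' i i) τ') - ψ') 0 :=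
    ((hf.differentiableAt hΓ (by rw [hd0]; exact hmem)).hasFDerivAt.comp_hasDerivAt 0 hdd).sub hψ
  have hmin : IsLocalMin (fun s => f (d s) - ψ s) 0 := by
    filter_upwards [hRH, heq] with s hs hs'
    obtain ⟨l, hl, hlΓ, hlf⟩ := hs'
    have h1 := hl.conj hs.2
    rw [hs.1] at h1
    have h2 := h1.append_diag_mem (K := {append l (τ s)}) rfl
    have h3 := le_of_mem_symmHull (a := ψ s) hΓ hf (Set.singleton_subset_iff.mpr hlΓ)
      (by rintro _ rfl; exact hlf.ge) h2
    simp only [hd0, h0, sub_self]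
    exact sub_nonneg.mpr h3
  have hz := hmin.hasDerivAt_eq_zero hfd
  rw [hd0, fderiv_eq_sum_partialD, Fin.sum_univ_castSucc] at hz
  simp only [append_castSucc, append_last] at hz
  linarith

end DifferentiatedEquation

/-! ### Calculus at a maximum point -/

section MaximumPoint

open Filter Topology

lemma second_deriv_nonpos_of_isLocalMax {r r' : ℝ → ℝ} {r'' : ℝ}
    (h1 : ∀ᶠ s in 𝓝 0, HasDerivAt r (r' s) s) (h2 : HasDerivAt r' r'' 0)
    (hmax : IsLocalMax r 0) : r'' ≤ 0 := by
  by_contra! hpos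
  have hd : deriv r =ᶠ[𝓝 0] r' := h1.mono fun s hs => hs.deriv
  have hdd : HasDerivAt (deriv r) r'' 0 := h2.congr_of_eventuallyEq hd
  have hr0 : deriv r 0 = 0 := hmax.deriv_eq_zero
  have hmin : IsLocalMin r 0 :=
    isLocalMin_of_deriv_deriv_pos (by rw [hdd.deriv]; exact hpos) hr0
      h1.self_of_nhds.continuousAt
  -- a local maximum that is a local minimum is locally constant
  have hconst : r =ᶠ[𝓝 0] fun _ => r 0 := by
    filter_upwards [hmax, hmin] with s hs hs'
    exact le_antisymm hs hs'
  have h0 : deriv r =ᶠ[𝓝 0] fun _ => 0 := by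
    have := hconst.deriv
    simpa using this
  have := hdd.congr_of_eventuallyEq h0.symm
  have h3 := this.unique (hasDerivAt_const (0 : ℝ) (0 : ℝ))
  linarith

/-- First and second order conditions at a maximum of `z * exp φ`. -/
lemma second_deriv_le_of_isLocalMax_mul_exp {z z' φ φ' : ℝ → ℝ} {z'' φ'' : ℝ}
    (hz : ∀ᶠ s in 𝓝 0, HasDerivAt z (z' s) s) (hz2 : HasDerivAt z' z'' 0)
    (hφ : ∀ᶠ s in 𝓝 0, HasDerivAt φ (φ' s) s) (hφ2 : HasDerivAt φ' φ'' 0)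
    (hmax : IsLocalMax (fun s => z s * Real.exp (φ s)) 0) :
    z' 0 = -(z 0 * φ' 0) ∧ z'' ≤ z 0 * (φ' 0 ^ 2 - φ'') := by
  have hr : ∀ᶠ s in 𝓝 0, HasDerivAt (fun s => z s * Real.exp (φ s))
      ((z' s + z s * φ' s) * Real.exp (φ s)) s := by
    filter_upwards [hz, hφ] with s h1 h2
    exact (h1.mul h2.exp).congr_deriv (by ring)
  have hr2 : HasDerivAt (fun s => (z' s + z s * φ' s) * Real.exp (φ s))
      ((z'' + (z' 0 * φ' 0 + z 0 * φ'')) * Real.exp (φ 0)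
        + (z' 0 + z 0 * φ' 0) * (Real.exp (φ 0) * φ' 0)) 0 :=
    (hz2.add (hz.self_of_nhds.mul hφ2)).mul hφ.self_of_nhds.exp
  have hE := Real.exp_pos (φ 0)
  have h0 : z' 0 + z 0 * φ' 0 = 0 := by
    have := hmax.hasDerivAt_eq_zero hr.self_of_nhds
    rcases mul_eq_zero.mp this with h | h
    · exact h
    · exact absurd h hE.ne'
  have h2 := second_deriv_nonpos_of_isLocalMax hr hr2 hmax
  have hz0 : z' 0 = -(z 0 * φ' 0) := by linarith
  refine ⟨hz0, ?_⟩
  rw [h0, zero_mul, add_zero] at h2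
  have h3 : z'' + (z' 0 * φ' 0 + z 0 * φ'') ≤ 0 := by
    by_contra! hc
    exact absurd h2 (not_le.mpr (mul_pos hc hE))
  rw [hz0] at h3
  linarith [h3]

/-- The one-sided time derivative at a maximum of `z * exp φ` over earlier times. -/
lemma deriv_nonneg_of_max_mul_exp {z φ : ℝ → ℝ} {z' φ' t₀ : ℝ}
    (hz : HasDerivWithinAt z z' (Set.Iic t₀) t₀) (hφ : HasDerivWithinAt φ φ' (Set.Iic t₀) t₀)
    (hmax : ∀ᶠ t in 𝓝[Set.Iio t₀] t₀, z t * Real.exp (φ t) ≤ z t₀ * Real.exp (φ t₀)) :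
    0 ≤ z' + z t₀ * φ' := by
  have hr : HasDerivWithinAt (fun t => z t * Real.exp (φ t))
      ((z' + z t₀ * φ') * Real.exp (φ t₀)) (Set.Iic t₀) t₀ :=
    (hz.mul hφ.exp).congr_deriv (by ring)
  have ht := hasDerivWithinAt_iff_tendsto_slope.mp hr
  rw [Set.Iic_sdiff_right] at ht
  have h0 : 0 ≤ (z' + z t₀ * φ') * Real.exp (φ t₀) := by
    refine ge_of_tendsto ht ?_
    filter_upwards [hmax, self_mem_nhdsWithin] with t h1 h2
    rw [slope_def_field]
    exact div_nonneg_of_nonpos (by linarith) (by linarith [Set.mem_Iio.mp h2])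
  exact nonneg_of_mul_nonneg_left h0 (Real.exp_pos _)

end MaximumPoint

section Lines

open Filter Topology

variable {E F : Type*} [NormedAddCommGroup E] [NormedSpace ℝ E] [NormedAddCommGroup F]
  [NormedSpace ℝ F]

lemma hasDerivAt_line {h : E → F} {y₀ e : E} {s : ℝ} (hd : DifferentiableAt ℝ h (y₀ + s • e)) :
    HasDerivAt (fun r : ℝ => h (y₀ + r • e)) (fderiv ℝ h (y₀ + s • e) e) s := by
  have h1 : HasDerivAt (fun r : ℝ => y₀ + r • e) e s := by
    simpa using ((hasDerivAt_id s).smul_const e).const_add y₀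
  exact hd.hasFDerivAt.comp_hasDerivAt s h1

lemma hasDerivAt_line_zero {h : E → F} {y₀ e : E} (hd : DifferentiableAt ℝ h y₀) :
    HasDerivAt (fun r : ℝ => h (y₀ + r • e)) (fderiv ℝ h y₀ e) 0 := by
  have := hasDerivAt_line (h := h) (y₀ := y₀) (e := e) (s := 0) (by simpa using hd)
  simpa using this

lemma tendsto_line (y₀ e : E) : Tendsto (fun s : ℝ => y₀ + s • e) (𝓝 0) (𝓝 y₀) := by
  have : Continuous fun s : ℝ => y₀ + s • e := by fun_prop
  simpa using this.tendsto 0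

lemma third_fderiv_rotate {v : E → ℝ} {y₀ : E} (hv : ContDiffAt ℝ 3 v y₀) (a p : E) :
    fderiv ℝ (fderiv ℝ (fderiv ℝ v)) y₀ a p p = fderiv ℝ (fderiv ℝ (fderiv ℝ v)) y₀ p p a := by
  have h1 : ContDiffAt ℝ 2 (fderiv ℝ v) y₀ := hv.fderiv_right (by norm_num)
  have hs1 : fderiv ℝ (fderiv ℝ (fderiv ℝ v)) y₀ a p = fderiv ℝ (fderiv ℝ (fderiv ℝ v)) y₀ p a :=
    (h1.isSymmSndFDerivAt (by simp)) a p
  have hd : DifferentiableAt ℝ (fderiv ℝ (fderiv ℝ v)) y₀ :=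
    (h1.fderiv_right (m := 1) (by norm_num)).differentiableAt (by simp)
  have happ : ∀ x y : E, HasDerivAt (fun r : ℝ => fderiv ℝ (fderiv ℝ v) (y₀ + r • p) x y)
      (fderiv ℝ (fderiv ℝ (fderiv ℝ v)) y₀ p x y) 0 := fun x y => by
    have := ((hasDerivAt_line_zero (e := p) hd).clm_apply (hasDerivAt_const (0 : ℝ) x)).clm_apply
      (hasDerivAt_const (0 : ℝ) y)
    simpa using this
  have hev : ∀ᶠ z in 𝓝 y₀, fderiv ℝ (fderiv ℝ v) z a p = fderiv ℝ (fderiv ℝ v) z p a := by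
    filter_upwards [hv.eventually (by simp)] with z hz
    exact (hz.of_le (m := 2) (by norm_num)).isSymmSndFDerivAt (by simp) a p
  rw [hs1]
  exact (happ a p).unique ((happ p a).congr_of_eventuallyEq ((tendsto_line y₀ p).eventually hev))

/-- The function `2 Dv(V) - G(V, V)` for a vector field `V`. Its supremum over all `V` is the squared
norm of the differential of `v`, for the metric `G`. -/
def testFun (v : E → ℝ) (G : E → E →L[ℝ] E →L[ℝ] ℝ) (V : E → E) (y : E) : ℝ :=
  2 * fderiv ℝ v y (V y) - G y (V y) (V y)

/-- The derivative of `testFun` in the direction `e` for a field `V` with derivative `c` in the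
direction `e`. -/
def testFunDeriv (v : E → ℝ) (G : E → E →L[ℝ] E →L[ℝ] ℝ) (V : E → E) (e c : E) (y : E) : ℝ :=
  2 * (fderiv ℝ (fderiv ℝ v) y e (V y) + fderiv ℝ v y c)
    - ((fderiv ℝ G y e (V y) + G y c) (V y) + G y (V y) c)

variable {v : E → ℝ} {G : E → E →L[ℝ] E →L[ℝ] ℝ} {y₀ : E}

lemma hasDerivAt_affine (y₀ a e : E) (A : E →L[ℝ] E) (s : ℝ) :
    HasDerivAt (fun r : ℝ => a + A (y₀ + r • e - y₀)) (A e) s := by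
  have : HasDerivAt (fun r : ℝ => a + r • A e) (A e) s := by
    simpa using ((hasDerivAt_id s).smul_const (A e)).const_add a
  simpa using this

lemma hasDerivAt_testFun (hv : ContDiffAt ℝ 3 v y₀) (hG : ContDiffAt ℝ 2 G y₀) (a e : E)
    (A : E →L[ℝ] E) :
    ∀ᶠ s : ℝ in 𝓝 0, HasDerivAt (fun r : ℝ => testFun v G (fun y => a + A (y - y₀)) (y₀ + r • e))
      (testFunDeriv v G (fun y => a + A (y - y₀)) e (A e) (y₀ + s • e)) s := by
  have h1 : ∀ᶠ y in 𝓝 y₀, DifferentiableAt ℝ (fderiv ℝ v) y ∧ DifferentiableAt ℝ G y := by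
    filter_upwards [hv.eventually (by simp), hG.eventually (by simp)] with y hy hy'
    exact ⟨(hy.fderiv_right (m := 2) (by norm_num)).differentiableAt (by simp),
      hy'.differentiableAt (by simp)⟩
  filter_upwards [(tendsto_line y₀ e).eventually h1] with s hs
  have hV := hasDerivAt_affine y₀ a e A s
  have hD := (hasDerivAt_line hs.1).clm_apply hV
  have hGG := ((hasDerivAt_line hs.2).clm_apply hV).clm_apply hV
  exact (hD.const_mul 2).sub hGG

lemma hasDerivAt_testFunDeriv (hv : ContDiffAt ℝ 3 v y₀) (hG : ContDiffAt ℝ 2 G y₀) (a e : E)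
    (A : E →L[ℝ] E) (hGs : ∀ᶠ y in 𝓝 y₀, ∀ x x', G y x x' = G y x' x) :
    HasDerivAt (fun r : ℝ => testFunDeriv v G (fun y => a + A (y - y₀)) e (A e) (y₀ + r • e))
      (2 * fderiv ℝ (fderiv ℝ (fderiv ℝ v)) y₀ e e a + 4 * fderiv ℝ (fderiv ℝ v) y₀ e (A e)
        - fderiv ℝ (fderiv ℝ G) y₀ e e a a - 4 * fderiv ℝ G y₀ e (A e) a
        - 2 * G y₀ (A e) (A e)) 0 := by
  have hd1 : ContDiffAt ℝ 2 (fderiv ℝ v) y₀ := hv.fderiv_right (by norm_num)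
  have hd2 : ContDiffAt ℝ 1 (fderiv ℝ (fderiv ℝ v)) y₀ := hd1.fderiv_right (by norm_num)
  have hG1 : ContDiffAt ℝ 1 (fderiv ℝ G) y₀ := hG.fderiv_right (by norm_num)
  have hGd : DifferentiableAt ℝ G y₀ := hG.differentiableAt (by simp)
  have hV := hasDerivAt_affine y₀ a e A 0
  have e1 := hasDerivAt_line_zero (e := e) (hd1.differentiableAt (by simp))
  have e2 := hasDerivAt_line_zero (e := e) (hd2.differentiableAt (by simp))
  have e3 := hasDerivAt_line_zero (e := e) (hG1.differentiableAt (by simp))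
  have e4 := hasDerivAt_line_zero (e := e) hGd
  have k1 := ((e2.clm_apply (hasDerivAt_const (0 : ℝ) e)).clm_apply hV).add
    (e1.clm_apply (hasDerivAt_const (0 : ℝ) (A e)))
  have k2 := (((e3.clm_apply (hasDerivAt_const (0 : ℝ) e)).clm_apply hV).add
    (e4.clm_apply (hasDerivAt_const (0 : ℝ) (A e)))).clm_apply hV
  have k3 := (e4.clm_apply hV).clm_apply (hasDerivAt_const (0 : ℝ) (A e))
  have hall := (k1.const_mul 2).sub (k2.add k3)
  have hsym : fderiv ℝ G y₀ e a (A e) = fderiv ℝ G y₀ e (A e) a := by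
    have happ : ∀ x y : E, HasDerivAt (fun r : ℝ => G (y₀ + r • e) x y)
        (fderiv ℝ G y₀ e x y) 0 := fun x y => by
      have := (e4.clm_apply (hasDerivAt_const (0 : ℝ) x)).clm_apply (hasDerivAt_const (0 : ℝ) y)
      simpa using this
    refine (happ a (A e)).unique ((happ (A e) a).congr_of_eventuallyEq ?_)
    filter_upwards [(tendsto_line y₀ e).eventually hGs] with s hs
    exact hs _ _
  refine (hall.congr_deriv ?_)
  simp only [zero_smul, add_zero, sub_self, map_zero, add_apply, Pi.add_apply, hsym]
  ring

end Lines

/-! ### The choice of the weights -/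

section Weights

lemma weight_term_le {C δ b F lam g d : ℝ} (hC : 1 ≤ C) (hδ0 : 0 ≤ δ) (hδ1 : 8 * C ^ 2 * δ ≤ 1)
    (hF : 0 ≤ F) (hg : |g| ≤ C * (1 + |lam|)) (hd : |d| ≤ C) :
    F * (δ * lam ^ 2 - (4 * C ^ 2 * δ + 2 * C ^ 2 * b ^ 2)) ≤
      δ * (F * (2 * lam ^ 2 - C * |lam| - C)) - F * (δ * g + b * d) ^ 2 := by
  have hCC : C ≤ C ^ 2 := by nlinarith
  have hg2 : g ^ 2 ≤ 2 * C ^ 2 * (1 + lam ^ 2) := by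
    have h1 : g ^ 2 ≤ (C * (1 + |lam|)) ^ 2 := sq_le_sq' (by
      linarith [neg_abs_le (g), hg]) ((le_abs_self _).trans hg)
    have h2 : (1 + |lam|) ^ 2 ≤ 2 * (1 + lam ^ 2) := by
      rw [← sq_abs (lam)]; nlinarith [sq_nonneg (1 - |lam|)]
    calc g ^ 2 ≤ C ^ 2 * (1 + |lam|) ^ 2 := by rw [← mul_pow]; exact h1
      _ ≤ C ^ 2 * (2 * (1 + lam ^ 2)) := mul_le_mul_of_nonneg_left h2 (by positivity)
      _ = _ := by ring
  have hd2 : d ^ 2 ≤ C ^ 2 := sq_le_sq' (by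
      linarith [neg_abs_le (d), hd]) ((le_abs_self _).trans (hd))
  have h1 : (δ * g + b * d) ^ 2 ≤ 2 * δ ^ 2 * g ^ 2 + 2 * b ^ 2 * d ^ 2 := by
    nlinarith [sq_nonneg (δ * g - b * d)]
  have h2 : 2 * δ ^ 2 * g ^ 2 ≤ 2 * δ ^ 2 * (2 * C ^ 2 * (1 + lam ^ 2)) :=
    mul_le_mul_of_nonneg_left hg2 (by positivity)
  have h3 : 2 * b ^ 2 * d ^ 2 ≤ 2 * b ^ 2 * C ^ 2 :=
    mul_le_mul_of_nonneg_left hd2 (by positivity)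
  have h4 : 2 * δ ^ 2 * (2 * C ^ 2 * (1 + lam ^ 2)) ≤ δ / 2 * (1 + lam ^ 2) := by
    have : 2 * δ ^ 2 * (2 * C ^ 2 * (1 + lam ^ 2))
      = δ / 2 * (1 + lam ^ 2) * (8 * C ^ 2 * δ) := by ring
    rw [this]
    exact mul_le_of_le_one_right (by positivity) hδ1
  have h5 : C * |lam| ≤ lam ^ 2 / 2 + C ^ 2 / 2 := by
    rw [← sq_abs (lam)]; nlinarith [sq_nonneg (C - |lam|)]
  have h6 : δ * lam ^ 2 - (4 * C ^ 2 * δ + 2 * C ^ 2 * b ^ 2) ≤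
      δ * (2 * lam ^ 2 - C * |lam| - C) - (δ * g + b * d) ^ 2 := by
    have h7 : δ * (C * |lam|) ≤ δ * (lam ^ 2 / 2 + C ^ 2 / 2) :=
      mul_le_mul_of_nonneg_left h5 hδ0
    have h8 : δ * C ≤ δ * C ^ 2 := mul_le_mul_of_nonneg_left hCC hδ0
    have h9 : δ * 1 ≤ δ * C ^ 2 := mul_le_mul_of_nonneg_left (by linarith) hδ0
    nlinarith
  calc _ ≤ F * (δ * (2 * lam ^ 2 - C * |lam| - C) - (δ * g + b * d) ^ 2) :=
        mul_le_mul_of_nonneg_left h6 hF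
    _ = _ := by ring

/-- The weights `δ` of `|∇u|²` and `b` of `w - u` in the auxiliary function. With `b` small
compared with `ε` and `δ` small compared with `b`, the inequality at an interior maximum bounds
either `z` or the spatial eigenvalues. -/
lemma exists_weights {C ε β c₀ A : ℝ} (hC : 1 ≤ C) (hε : 0 < ε) (hβ : 0 < β) (hc₀ : 0 < c₀)
    (hA : 0 ≤ A) :
    ∃ δ b D : ℝ, 0 < δ ∧ 0 < b ∧ 1 ≤ D ∧ ∀ (n : ℕ) (F lam g d : Fin n → ℝ) (S z LN Lw : ℝ),
      (∀ i, 0 ≤ F i) → ∑ i, F i ≤ S → c₀ ≤ S →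
      ∑ i, F i * (2 * lam i ^ 2 - C * |lam i| - C) - C ≤ LN →
      (∀ i, |g i| ≤ C * (1 + |lam i|)) → (∀ i, |d i| ≤ C) → 0 < z →
      -A ≤ z * (∑ i, F i * (δ * g i + b * d i) ^ 2 - δ * LN - b * Lw) →
      (ε * (1 + S) ≤ Lw ∨ (0 ≤ Lw ∧ ∀ i, β * S ≤ F i)) →
      z ≤ D ∨ (¬ ε * (1 + S) ≤ Lw ∧ ∀ i, |lam i| ≤ D) := by
  have hC0 : 0 < C := by linarith
  obtain ⟨b, hb⟩ : ∃ b, b = ε / (4 * C ^ 2) := ⟨_, rfl⟩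
  have hb0 : 0 < b := by rw [hb]; positivity
  obtain ⟨δ, hδ⟩ : ∃ δ, δ = min (1 / (8 * C ^ 2)) (b * ε / (8 * C ^ 2)) := ⟨_, rfl⟩
  have hδ0 : 0 < δ := by rw [hδ]; positivity
  have hδ1 : 8 * C ^ 2 * δ ≤ 1 := by
    have : δ ≤ 1 / (8 * C ^ 2) := hδ ▸ min_le_left _ _
    rw [le_div_iff₀ (by positivity)] at this
    linarith
  have hδ2 : 8 * C ^ 2 * δ ≤ b * ε := by
    have : δ ≤ b * ε / (8 * C ^ 2) := hδ ▸ min_le_right _ _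
    rw [le_div_iff₀ (by positivity)] at this
    linarith
  have hb2 : 2 * C ^ 2 * b ^ 2 = b * ε / 2 := by
    rw [hb]; field_simp; norm_num
  obtain ⟨D₂, hD₂⟩ : ∃ D₂, D₂ = (A / c₀ + δ * C / c₀ + b * ε) / (δ * β) := ⟨_, rfl⟩
  have hD₂0 : 0 ≤ D₂ := by rw [hD₂]; positivity
  refine ⟨δ, b, 1 + D₂ + 2 * A / (b * ε), hδ0, hb0, ?_, ?_⟩
  · have : 0 ≤ 2 * A / (b * ε) := by positivity
    linarith
  intro n F lam g d S z LN Lw hF hFS hS hLN hg hd hz hmax hdich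
  have hterm := fun i => weight_term_le hC hδ0.le hδ1 (hF i) (hg i) (hd i) (b := b)
  have hsum := Finset.sum_le_sum fun i (_ : i ∈ Finset.univ) => hterm i
  rw [Finset.sum_sub_distrib, ← Finset.mul_sum] at hsum
  have hsplit : ∑ i, F i * (δ * lam i ^ 2 - (4 * C ^ 2 * δ + 2 * C ^ 2 * b ^ 2))
      = δ * ∑ i, F i * lam i ^ 2 - (4 * C ^ 2 * δ + 2 * C ^ 2 * b ^ 2) * ∑ i, F i := by
    rw [Finset.mul_sum, Finset.mul_sum, ← Finset.sum_sub_distrib]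
    exact Finset.sum_congr rfl fun i _ => by ring
  have hLNδ := mul_le_mul_of_nonneg_left hLN hδ0.le
  have hFS' : (4 * C ^ 2 * δ + 2 * C ^ 2 * b ^ 2) * ∑ i, F i ≤ b * ε * S := by
    have h1 : 4 * C ^ 2 * δ + 2 * C ^ 2 * b ^ 2 ≤ b * ε := by linarith
    have h2 : 0 ≤ ∑ i, F i := Finset.sum_nonneg fun i _ => hF i
    exact mul_le_mul h1 hFS h2 (by positivity)
  have hmain : δ * ∑ i, F i * lam i ^ 2 + b * Lw ≤ A / z + δ * C + b * ε * S := by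
    have h1 : -(A / z) ≤ ∑ i, F i * (δ * g i + b * d i) ^ 2 - δ * LN - b * Lw := by
      rw [← neg_div, div_le_iff₀ hz]; linarith
    linarith
  have hsq0 : 0 ≤ ∑ i, F i * lam i ^ 2 :=
    Finset.sum_nonneg fun i _ => mul_nonneg (hF i) (sq_nonneg _)
  have hS0 : 0 < S := lt_of_lt_of_le hc₀ hS
  by_cases hcase : ε * (1 + S) ≤ Lw
  · left
    have h1 : b * (ε * (1 + S)) ≤ b * Lw := mul_le_mul_of_nonneg_left hcase hb0.le
    have h2 : δ * C ≤ b * ε / 2 := by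
      have hCC : C ≤ C ^ 2 := by nlinarith
      have h21 := mul_le_mul_of_nonneg_left hCC hδ0.le
      have h22 : 0 ≤ b * ε := by positivity
      linarith
    have h3 : b * ε / 2 ≤ A / z := by
      have : 0 ≤ δ * ∑ i, F i * lam i ^ 2 := mul_nonneg hδ0.le hsq0
      have h31 : b * (ε * (1 + S)) = b * ε + b * ε * S := by ring
      linarith
    have h4 : z ≤ 2 * A / (b * ε) := by
      rw [le_div_iff₀ hz] at h3
      rw [le_div_iff₀ (by positivity)]
      linarith
    linarith
  · obtain hL | ⟨hL0, hFβ⟩ := hdich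
    · exact absurd hL hcase
    by_cases hz1 : z ≤ 1 + D₂ + 2 * A / (b * ε)
    · exact Or.inl hz1
    right
    refine ⟨hcase, fun i => ?_⟩
    have hz1' : 1 ≤ z := by
      have : 0 ≤ 2 * A / (b * ε) := by positivity
      linarith
    have h1 : A / z ≤ A := div_le_self hA hz1'
    have h2 : F i * lam i ^ 2 ≤ ∑ i, F i * lam i ^ 2 :=
      Finset.single_le_sum (f := fun i => F i * lam i ^ 2)
        (fun i _ => mul_nonneg (hF i) (sq_nonneg _)) (Finset.mem_univ i)
    have h3 : δ * (β * S * lam i ^ 2) ≤ A + δ * C + b * ε * S := by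
      have h31 : δ * (β * S * lam i ^ 2) ≤ δ * (F i * lam i ^ 2) :=
        mul_le_mul_of_nonneg_left (mul_le_mul_of_nonneg_right (hFβ i) (sq_nonneg _)) hδ0.le
      have h32 := mul_le_mul_of_nonneg_left h2 hδ0.le
      have h33 : 0 ≤ b * Lw := mul_nonneg hb0.le hL0
      linarith
    have h4 : A + δ * C + b * ε * S ≤ (A / c₀ + δ * C / c₀ + b * ε) * S := by
      have h41 : A ≤ A / c₀ * S := by
        rw [div_mul_eq_mul_div, le_div_iff₀ hc₀]; exact mul_le_mul_of_nonneg_left hS hA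
      have h42 : δ * C ≤ δ * C / c₀ * S := by
        rw [div_mul_eq_mul_div, le_div_iff₀ hc₀]
        exact mul_le_mul_of_nonneg_left hS (by positivity)
      rw [add_mul, add_mul]
      linarith
    have h5 : lam i ^ 2 ≤ D₂ := by
      rw [hD₂, le_div_iff₀ (by positivity)]
      have h51 : lam i ^ 2 * (δ * β) * S ≤ (A / c₀ + δ * C / c₀ + b * ε) * S := by
        linarith
      exact le_of_mul_le_mul_right h51 hS0
    have h6 : |lam i| ≤ 1 + D₂ := by
      have h61 : 0 ≤ (|lam i| - 1) ^ 2 := sq_nonneg _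
      rw [← sq_abs] at h5
      have h62 := abs_nonneg (lam i)
      linarith
    have : 0 ≤ 2 * A / (b * ε) := by positivity
    linarith

/-- If all `f_i` are comparable to their sum and the spatial eigenvalues are bounded, then so is
the remaining entry `τ`: from below by the condition on `∑ f_i μ_i`, from above because the
linearization is nonnegative in the direction of the subsolution. -/
lemma abs_last_le {n : ℕ} {F lam κ : Fin n → ℝ} {ft κt τ S β D R K₀ : ℝ} (hF : ∀ i, 0 ≤ F i)
    (hS : S = ∑ i, F i + ft) (hS0 : 0 < S) (hβ : 0 < β) (hβt : β * S ≤ ft)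
    (hD : ∀ i, |lam i| ≤ D) (hκ : ∀ i, |κ i| ≤ R) (hκt : |κt| ≤ R) (hK₀ : 0 ≤ K₀) (hR : 0 ≤ R)
    (hD0 : 0 ≤ D) (hlow : -K₀ * S ≤ ∑ i, F i * lam i + ft * τ)
    (hL : 0 ≤ ∑ i, F i * (κ i - lam i) + ft * (κt - τ)) :
    |τ| ≤ (K₀ + R + D) / β := by
  have hft : 0 ≤ ft := le_trans (by positivity) hβt
  have hsum_le : ∑ i, F i ≤ S := by linarith
  have hsum_nonneg : 0 ≤ ∑ i, F i := Finset.sum_nonneg fun i _ => hF i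
  have h1 : |∑ i, F i * lam i| ≤ D * ∑ i, F i := by
    refine (Finset.abs_sum_le_sum_abs _ _).trans ?_
    rw [Finset.mul_sum]
    refine Finset.sum_le_sum fun i _ => ?_
    rw [abs_mul, abs_of_nonneg (hF i), mul_comm]
    exact mul_le_mul_of_nonneg_right (hD i) (hF i)
  have h2 : |∑ i, F i * κ i| ≤ R * ∑ i, F i := by
    refine (Finset.abs_sum_le_sum_abs _ _).trans ?_
    rw [Finset.mul_sum]
    refine Finset.sum_le_sum fun i _ => ?_
    rw [abs_mul, abs_of_nonneg (hF i), mul_comm]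
    exact mul_le_mul_of_nonneg_right (hκ i) (hF i)
  have h3 : ∑ i, F i * (κ i - lam i) = ∑ i, F i * κ i - ∑ i, F i * lam i := by
    rw [← Finset.sum_sub_distrib]; exact Finset.sum_congr rfl fun i _ => by ring
  rw [h3] at hL
  have hDS : D * ∑ i, F i ≤ D * S := mul_le_mul_of_nonneg_left hsum_le hD0
  have hft1 : ft * κt ≤ R * ft := by
    rw [mul_comm]; exact mul_le_mul_of_nonneg_right ((le_abs_self _).trans hκt) hft
  have hup : ft * τ ≤ (K₀ + R + D) * S := by
    have : 0 ≤ K₀ * S := by positivity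
    have h4 := le_abs_self (∑ i, F i * κ i)
    have h5 := neg_abs_le (∑ i, F i * lam i)
    have h6 : R * S = R * ∑ i, F i + R * ft := by rw [hS]; ring
    linarith
  have hlo : -((K₀ + R + D) * S) ≤ ft * τ := by
    have : 0 ≤ R * S := by positivity
    have h4 := le_abs_self (∑ i, F i * lam i)
    linarith
  have habs : ft * |τ| ≤ (K₀ + R + D) * S := by
    rw [← abs_of_nonneg hft, ← abs_mul]
    exact abs_le.mpr ⟨hlo, hup⟩
  rw [le_div_iff₀ hβ]
  have h7 : β * S * |τ| ≤ (K₀ + R + D) * S :=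
    (mul_le_mul_of_nonneg_right hβt (abs_nonneg _)).trans habs
  have h8 : |τ| * β * S ≤ (K₀ + R + D) * S := by linarith
  exact le_of_mul_le_mul_right h8 hS0

end Weights

/-! ### The linearized operator on `|∇u|²` -/

section Gradient

open Filter Topology

variable {n : ℕ} {E : Type*} [NormedAddCommGroup E] [NormedSpace ℝ E]

lemma abs_apply₂_le (T : E →L[ℝ] E →L[ℝ] ℝ) (x y : E) : |T x y| ≤ ‖T‖ * ‖x‖ * ‖y‖ := by
  rw [← Real.norm_eq_abs]; exact T.le_opNorm₂ x y

/-- In coordinates, the tensor `∇²v + χ`: `B` is the Christoffel tensor and `X` is `χ`. -/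
def hessForm (B : E → E →L[ℝ] E →L[ℝ] E) (X : E → E →L[ℝ] E →L[ℝ] ℝ) (v : E → ℝ) (y e e' : E) : ℝ :=
  fderiv ℝ (fderiv ℝ v) y e e' - fderiv ℝ v y (B y e e') + X y e e'

/-- The matrix of a bilinear form in the frame `p`. -/
def frameMatrix (p : Fin n → E) (T : E → E → ℝ) : Matrix (Fin n) (Fin n) ℝ :=
  Matrix.of fun i j => T (p i) (p j)

/-- The gradient vector of `v` in an orthonormal frame `p`. -/
def frameGrad (v : E → ℝ) (p : Fin n → E) (y₀ : E) : E := ∑ k, fderiv ℝ v y₀ (p k) • p k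

/-- The linear map that scales each vector `p i` of a `G₀`-orthonormal frame by `lam i`. -/
def frameDiag (G₀ : E →L[ℝ] E →L[ℝ] ℝ) (p : Fin n → E) (lam : Fin n → ℝ) : E →L[ℝ] E :=
  ∑ k, lam k • (G₀ (p k)).smulRight (p k)

lemma frameDiag_apply (G₀ : E →L[ℝ] E →L[ℝ] ℝ) (p : Fin n → E) (lam : Fin n → ℝ) (x : E) :
    frameDiag G₀ p lam x = ∑ k, (lam k * G₀ (p k) x) • p k := by
  simp [frameDiag, smul_smul]

variable {G X : E → E →L[ℝ] E →L[ℝ] ℝ} {B : E → E →L[ℝ] E →L[ℝ] E} {v : E → ℝ} {y₀ : E}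
  {p : Fin n → E} {lam : Fin n → ℝ}

lemma frameDiag_frame (horth : frameMatrix p (fun e e' => G y₀ e e') = 1) (i : Fin n) :
    frameDiag (G y₀) p lam (p i) = lam i • p i := by
  rw [frameDiag_apply, Finset.sum_eq_single i]
  · have := congrFun (congrFun horth i) i
    simp only [frameMatrix, Matrix.of_apply, Matrix.one_apply_eq] at this
    rw [this, mul_one]
  · intro k _ hk
    have := congrFun (congrFun horth k) i
    simp only [frameMatrix, Matrix.of_apply, Matrix.one_apply_ne hk] at this
    rw [this, mul_zero, zero_smul]
  · simp

lemma apply_frameGrad (horth : frameMatrix p (fun e e' => G y₀ e e') = 1) (k : Fin n) :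
    G y₀ (frameGrad v p y₀) (p k) = fderiv ℝ v y₀ (p k) := by
  simp only [frameGrad, map_sum, map_smul, sum_apply, smul_apply, smul_eq_mul]
  rw [Finset.sum_eq_single k]
  · have := congrFun (congrFun horth k) k
    simp only [frameMatrix, Matrix.of_apply, Matrix.one_apply_eq] at this
    rw [this, mul_one]
  · intro j _ hj
    have := congrFun (congrFun horth j) k
    simp only [frameMatrix, Matrix.of_apply, Matrix.one_apply_ne hj] at this
    rw [this, mul_zero]
  · simp

lemma apply_frameGrad_self (horth : frameMatrix p (fun e e' => G y₀ e e') = 1) :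
    G y₀ (frameGrad v p y₀) (frameGrad v p y₀) = ∑ k, fderiv ℝ v y₀ (p k) ^ 2 := by
  conv_lhs => rw [show G y₀ (frameGrad v p y₀) (frameGrad v p y₀)
    = G y₀ (frameGrad v p y₀) (∑ k, fderiv ℝ v y₀ (p k) • p k) from rfl]
  rw [map_sum]
  refine Finset.sum_congr rfl fun k _ => ?_
  rw [map_smul, apply_frameGrad horth, smul_eq_mul, sq]

lemma fderiv_frameGrad :
    fderiv ℝ v y₀ (frameGrad v p y₀) = ∑ k, fderiv ℝ v y₀ (p k) ^ 2 := by
  simp only [frameGrad, map_sum, map_smul, smul_eq_mul, sq]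

/-- At the point where the field attains the supremum, `testFun` has the same derivative as `|∇v|²`:
the derivatives of the field cancel. -/
lemma testFunDeriv_eq (horth : frameMatrix p (fun e e' => G y₀ e e') = 1)
    (hGs : ∀ x x', G y₀ x x' = G y₀ x' x) (e : E) :
    testFunDeriv v G (fun y => frameGrad v p y₀ + frameDiag (G y₀) p lam (y - y₀)) e
      (frameDiag (G y₀) p lam e) y₀
      = 2 * fderiv ℝ (fderiv ℝ v) y₀ e (frameGrad v p y₀)
        - fderiv ℝ G y₀ e (frameGrad v p y₀) (frameGrad v p y₀) := by
  have h1 : G y₀ (frameGrad v p y₀) (frameDiag (G y₀) p lam e)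
      = fderiv ℝ v y₀ (frameDiag (G y₀) p lam e) := by
    simp only [frameDiag_apply, map_sum, map_smul, apply_frameGrad horth]
  simp only [testFunDeriv, sub_self, map_zero, add_zero, add_apply]
  rw [hGs (frameDiag (G y₀) p lam e), h1]
  ring

lemma second_fderiv_frame (hdiag : frameMatrix p (hessForm B X v y₀) = Matrix.diagonal lam)
    (i : Fin n) : fderiv ℝ (fderiv ℝ v) y₀ (p i) (p i)
      = lam i + fderiv ℝ v y₀ (B y₀ (p i) (p i)) - X y₀ (p i) (p i) := by
  have := congrFun (congrFun hdiag i) i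
  simp only [frameMatrix, hessForm, Matrix.of_apply, Matrix.diagonal_apply_eq] at this
  linarith

lemma second_fderiv_frameGrad (hdiag : frameMatrix p (hessForm B X v y₀) = Matrix.diagonal lam)
    (i : Fin n) : fderiv ℝ (fderiv ℝ v) y₀ (p i) (frameGrad v p y₀)
      = lam i * fderiv ℝ v y₀ (p i) + fderiv ℝ v y₀ (B y₀ (p i) (frameGrad v p y₀))
        - X y₀ (p i) (frameGrad v p y₀) := by
  have key : hessForm B X v y₀ (p i) (frameGrad v p y₀) = lam i * fderiv ℝ v y₀ (p i) := by
    have h1 : hessForm B X v y₀ (p i) (frameGrad v p y₀)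
        = ∑ k, fderiv ℝ v y₀ (p k) * hessForm B X v y₀ (p i) (p k) := by
      simp only [hessForm]
      simp only [frameGrad, map_sum, map_smul, smul_eq_mul]
      rw [← Finset.sum_sub_distrib, ← Finset.sum_add_distrib]
      exact Finset.sum_congr rfl fun k _ => by ring
    rw [h1, Finset.sum_eq_single i]
    · have := congrFun (congrFun hdiag i) i
      simp only [frameMatrix, Matrix.of_apply, Matrix.diagonal_apply_eq] at this
      rw [this, mul_comm]
    · intro k _ hk
      have := congrFun (congrFun hdiag i) k
      simp only [frameMatrix, Matrix.of_apply, Matrix.diagonal_apply_ne _ (Ne.symm hk)] at this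
      rw [this, mul_zero]
    · simp
  simp only [hessForm] at key
  linarith

/-- Bounds, all by the same constant `Λ`, for the coefficients of the equation, the frame and the
first derivatives at a point. -/
structure PointBounds (G X : E → E →L[ℝ] E →L[ℝ] ℝ) (B : E → E →L[ℝ] E →L[ℝ] E) (p : Fin n → E)
    (v : E → ℝ) (y₀ : E) (Λ : ℝ) : Prop where
  one_le : 1 ≤ Λ
  frame : ∀ i, ‖p i‖ ≤ Λ
  dG : ‖fderiv ℝ G y₀‖ ≤ Λ
  ddG : ‖fderiv ℝ (fderiv ℝ G) y₀‖ ≤ Λ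
  normX : ‖X y₀‖ ≤ Λ
  dX : ‖fderiv ℝ X y₀‖ ≤ Λ
  normB : ‖B y₀‖ ≤ Λ
  dB : ‖fderiv ℝ B y₀‖ ≤ Λ
  dv : ‖fderiv ℝ v y₀‖ ≤ Λ
  grad : ‖frameGrad v p y₀‖ ≤ Λ

lemma abs_apply_le_of_bounds {L : E →L[ℝ] ℝ} {x : E} {a b : ℝ} (hL : ‖L‖ ≤ a) (hx : ‖x‖ ≤ b) :
    |L x| ≤ a * b := by
  rw [← Real.norm_eq_abs]
  exact (L.le_opNorm x).trans (mul_le_mul hL hx (norm_nonneg _) ((norm_nonneg _).trans hL))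

lemma norm_apply_le_of_bounds {F F' : Type*} [NormedAddCommGroup F] [NormedSpace ℝ F]
    [NormedAddCommGroup F'] [NormedSpace ℝ F'] {L : F →L[ℝ] F'} {x : F} {a b : ℝ} (hL : ‖L‖ ≤ a)
    (hx : ‖x‖ ≤ b) : ‖L x‖ ≤ a * b :=
  (L.le_opNorm x).trans (mul_le_mul hL hx (norm_nonneg _) ((norm_nonneg _).trans hL))

variable {Λ : ℝ}

/-- The derivative of the test function in a frame direction grows at most linearly in the
corresponding eigenvalue. -/
lemma PointBounds.abs_testFunDeriv_le (h : PointBounds G X B p v y₀ Λ)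
    (horth : frameMatrix p (fun e e' => G y₀ e e') = 1) (hGs : ∀ x x', G y₀ x x' = G y₀ x' x)
    (hdiag : frameMatrix p (hessForm B X v y₀) = Matrix.diagonal lam) (i : Fin n) :
    |testFunDeriv v G (fun y => frameGrad v p y₀ + frameDiag (G y₀) p lam (y - y₀)) (p i)
      (frameDiag (G y₀) p lam (p i)) y₀| ≤ 20 * Λ ^ 6 * (1 + |lam i|) := by
  have h1 := h.one_le
  rw [testFunDeriv_eq horth hGs, second_fderiv_frameGrad hdiag]
  have e1 : |fderiv ℝ v y₀ (p i)| ≤ Λ * Λ := abs_apply_le_of_bounds h.dv (h.frame i)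
  have e2 : |fderiv ℝ v y₀ (B y₀ (p i) (frameGrad v p y₀))| ≤ Λ * (Λ * Λ * Λ) :=
    abs_apply_le_of_bounds h.dv
      (norm_apply_le_of_bounds (norm_apply_le_of_bounds h.normB (h.frame i)) h.grad)
  have e3 : |X y₀ (p i) (frameGrad v p y₀)| ≤ Λ * Λ * Λ :=
    abs_apply_le_of_bounds (norm_apply_le_of_bounds h.normX (h.frame i)) h.grad
  have e4 : |fderiv ℝ G y₀ (p i) (frameGrad v p y₀) (frameGrad v p y₀)| ≤ Λ * Λ * Λ * Λ :=
    abs_apply_le_of_bounds (norm_apply_le_of_bounds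
      (norm_apply_le_of_bounds h.dG (h.frame i)) h.grad) h.grad
  have e5 : |lam i * fderiv ℝ v y₀ (p i)| ≤ |lam i| * (Λ * Λ) := by
    rw [abs_mul]; exact mul_le_mul_of_nonneg_left e1 (abs_nonneg _)
  have p2 : Λ ^ 2 ≤ Λ ^ 6 := pow_le_pow_right₀ h1 (by norm_num)
  have p3 : Λ ^ 3 ≤ Λ ^ 6 := pow_le_pow_right₀ h1 (by norm_num)
  have p4 : Λ ^ 4 ≤ Λ ^ 6 := pow_le_pow_right₀ h1 (by norm_num)
  have p6 : |lam i| * Λ ^ 2 ≤ |lam i| * Λ ^ 6 := mul_le_mul_of_nonneg_left p2 (abs_nonneg _)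
  have p7 : 0 ≤ |lam i| * Λ ^ 6 := by positivity
  have p8 : 0 ≤ Λ ^ 6 := by positivity
  rw [show Λ * Λ * Λ = Λ ^ 3 by ring] at *
  rw [show Λ * Λ ^ 3 = Λ ^ 4 by ring] at *
  rw [show Λ ^ 3 * Λ = Λ ^ 4 by ring] at *
  rw [show Λ * Λ = Λ ^ 2 by ring] at *
  rw [abs_le] at *
  constructor <;> linarith [e2.1, e2.2, e3.1, e3.2, e4.1, e4.2, e5.1, e5.2]

/-- The linearized operator applied to the test function, after the third derivatives of `u` have
been eliminated with the differentiated equation `hdiff`: the good term `∑ f_i λ_i²` dominates up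
to lower order terms. -/
lemma PointBounds.linearized_testFun_ge (h : PointBounds G X B p v y₀ Λ)
    (horth : frameMatrix p (fun e e' => G y₀ e e') = 1) (hGs : ∀ x x', G y₀ x x' = G y₀ x' x)
    (hdiag : frameMatrix p (hessForm B X v y₀) = Matrix.diagonal lam)
    (hv : ContDiffAt ℝ 3 v y₀) {F : Fin n → ℝ} (hF : ∀ i, 0 ≤ F i) {ft : ℝ} {q' ψ' : E →L[ℝ] ℝ}
    (hψ' : ‖ψ'‖ ≤ Λ)
    (hdiff : ∑ i, F i * (fderiv ℝ (fderiv ℝ (fderiv ℝ v)) y₀ (frameGrad v p y₀) (p i) (p i)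
        - fderiv ℝ (fderiv ℝ v) y₀ (frameGrad v p y₀) (B y₀ (p i) (p i))
        - fderiv ℝ v y₀ (fderiv ℝ B y₀ (frameGrad v p y₀) (p i) (p i))
        + fderiv ℝ X y₀ (frameGrad v p y₀) (p i) (p i)
        - lam i * fderiv ℝ G y₀ (frameGrad v p y₀) (p i) (p i)) - ft * q' (frameGrad v p y₀)
      = ψ' (frameGrad v p y₀)) :
    ∑ i, F i * (2 * lam i ^ 2 - 20 * Λ ^ 6 * |lam i| - 20 * Λ ^ 6) - 20 * Λ ^ 6 ≤
      ∑ i, F i * (2 * fderiv ℝ (fderiv ℝ (fderiv ℝ v)) y₀ (p i) (p i) (frameGrad v p y₀)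
          + 4 * fderiv ℝ (fderiv ℝ v) y₀ (p i) (frameDiag (G y₀) p lam (p i))
          - fderiv ℝ (fderiv ℝ G) y₀ (p i) (p i) (frameGrad v p y₀) (frameGrad v p y₀)
          - 4 * fderiv ℝ G y₀ (p i) (frameDiag (G y₀) p lam (p i)) (frameGrad v p y₀)
          - 2 * G y₀ (frameDiag (G y₀) p lam (p i)) (frameDiag (G y₀) p lam (p i))
          - testFunDeriv v G (fun y => frameGrad v p y₀ + frameDiag (G y₀) p lam (y - y₀))
              (B y₀ (p i) (p i)) (frameDiag (G y₀) p lam (B y₀ (p i) (p i))) y₀)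
        - ft * (2 * q' (frameGrad v p y₀)) := by
  have h1 := h.one_le
  set a := frameGrad v p y₀ with ha
  have hsym : ∀ x x', fderiv ℝ (fderiv ℝ v) y₀ x x' = fderiv ℝ (fderiv ℝ v) y₀ x' x :=
    (hv.of_le (m := 2) (by norm_num)).isSymmSndFDerivAt (by simp)
  have p2 : Λ ^ 2 ≤ Λ ^ 6 := pow_le_pow_right₀ h1 (by norm_num)
  have p3 : Λ ^ 3 ≤ Λ ^ 6 := pow_le_pow_right₀ h1 (by norm_num)
  have p4 : Λ ^ 4 ≤ Λ ^ 6 := pow_le_pow_right₀ h1 (by norm_num)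
  have p5 : Λ ^ 5 ≤ Λ ^ 6 := pow_le_pow_right₀ h1 (by norm_num)
  have p8 : 0 ≤ Λ ^ 6 := by positivity
  have hψa : |ψ' a| ≤ Λ * Λ := abs_apply_le_of_bounds hψ' h.grad
  have hterm : ∀ i, F i * (2 * lam i ^ 2 - 20 * Λ ^ 6 * |lam i| - 20 * Λ ^ 6) ≤
      F i * (2 * fderiv ℝ (fderiv ℝ (fderiv ℝ v)) y₀ (p i) (p i) a
          + 4 * fderiv ℝ (fderiv ℝ v) y₀ (p i) (frameDiag (G y₀) p lam (p i))
          - fderiv ℝ (fderiv ℝ G) y₀ (p i) (p i) a a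
          - 4 * fderiv ℝ G y₀ (p i) (frameDiag (G y₀) p lam (p i)) a
          - 2 * G y₀ (frameDiag (G y₀) p lam (p i)) (frameDiag (G y₀) p lam (p i))
          - testFunDeriv v G (fun y => a + frameDiag (G y₀) p lam (y - y₀))
              (B y₀ (p i) (p i)) (frameDiag (G y₀) p lam (B y₀ (p i) (p i))) y₀)
      - 2 * (F i * (fderiv ℝ (fderiv ℝ (fderiv ℝ v)) y₀ a (p i) (p i)
        - fderiv ℝ (fderiv ℝ v) y₀ a (B y₀ (p i) (p i))
        - fderiv ℝ v y₀ (fderiv ℝ B y₀ a (p i) (p i)) + fderiv ℝ X y₀ a (p i) (p i)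
        - lam i * fderiv ℝ G y₀ a (p i) (p i))) := by
    intro i
    rw [ha, testFunDeriv_eq horth hGs, ← ha, frameDiag_frame horth, third_fderiv_rotate hv,
      hsym a]
    simp only [map_smul, smul_apply, smul_eq_mul]
    rw [second_fderiv_frame hdiag]
    have hGii : G y₀ (p i) (p i) = 1 := by
      have := congrFun (congrFun horth i) i
      simpa only [frameMatrix, Matrix.of_apply, Matrix.one_apply_eq] using this
    rw [hGii]
    have hb : ‖B y₀ (p i) (p i)‖ ≤ Λ * Λ * Λ :=
      norm_apply_le_of_bounds (norm_apply_le_of_bounds h.normB (h.frame i)) (h.frame i)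
    have e1 : |fderiv ℝ v y₀ (B y₀ (p i) (p i))| ≤ Λ * (Λ * Λ * Λ) :=
      abs_apply_le_of_bounds h.dv hb
    have e2 : |X y₀ (p i) (p i)| ≤ Λ * Λ * Λ :=
      abs_apply_le_of_bounds (norm_apply_le_of_bounds h.normX (h.frame i)) (h.frame i)
    have e3 : |fderiv ℝ (fderiv ℝ G) y₀ (p i) (p i) a a| ≤ Λ * Λ * Λ * Λ * Λ :=
      abs_apply_le_of_bounds (norm_apply_le_of_bounds (norm_apply_le_of_bounds
        (norm_apply_le_of_bounds h.ddG (h.frame i)) (h.frame i)) h.grad) h.grad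
    have e4 : |fderiv ℝ G y₀ (p i) (p i) a| ≤ Λ * Λ * Λ * Λ :=
      abs_apply_le_of_bounds (norm_apply_le_of_bounds
        (norm_apply_le_of_bounds h.dG (h.frame i)) (h.frame i)) h.grad
    have e5 : |fderiv ℝ G y₀ (B y₀ (p i) (p i)) a a| ≤ Λ * (Λ * Λ * Λ) * Λ * Λ :=
      abs_apply_le_of_bounds (norm_apply_le_of_bounds
        (norm_apply_le_of_bounds h.dG hb) h.grad) h.grad
    have e6 : |fderiv ℝ v y₀ (fderiv ℝ B y₀ a (p i) (p i))| ≤ Λ * (Λ * Λ * Λ * Λ) :=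
      abs_apply_le_of_bounds h.dv (norm_apply_le_of_bounds (norm_apply_le_of_bounds
        (norm_apply_le_of_bounds h.dB h.grad) (h.frame i)) (h.frame i))
    have e7 : |fderiv ℝ X y₀ a (p i) (p i)| ≤ Λ * Λ * Λ * Λ :=
      abs_apply_le_of_bounds (norm_apply_le_of_bounds
        (norm_apply_le_of_bounds h.dX h.grad) (h.frame i)) (h.frame i)
    have e8 : |fderiv ℝ G y₀ a (p i) (p i)| ≤ Λ * Λ * Λ * Λ :=
      abs_apply_le_of_bounds (norm_apply_le_of_bounds
        (norm_apply_le_of_bounds h.dG h.grad) (h.frame i)) (h.frame i)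
    -- the terms that are linear in the eigenvalue; the others are bounded by `hconst`
    have hlin : |lam i * (4 * fderiv ℝ v y₀ (B y₀ (p i) (p i)) - 4 * X y₀ (p i) (p i)
        - 4 * fderiv ℝ G y₀ (p i) (p i) a + 2 * fderiv ℝ G y₀ a (p i) (p i))|
        ≤ |lam i| * (20 * Λ ^ 6) := by
      rw [abs_mul]
      refine mul_le_mul_of_nonneg_left ?_ (abs_nonneg _)
      rw [abs_le] at *
      constructor <;> linarith [e1.1, e1.2, e2.1, e2.2, e4.1, e4.2, e8.1, e8.2]
    have hconst : |-fderiv ℝ (fderiv ℝ G) y₀ (p i) (p i) a a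
        + fderiv ℝ G y₀ (B y₀ (p i) (p i)) a a
        + 2 * fderiv ℝ v y₀ (fderiv ℝ B y₀ a (p i) (p i)) - 2 * fderiv ℝ X y₀ a (p i) (p i)|
        ≤ 20 * Λ ^ 6 := by
      rw [abs_le] at *
      constructor <;> linarith [e3.1, e3.2, e5.1, e5.2, e6.1, e6.2, e7.1, e7.2]
    rw [mul_left_comm 2 (F i), ← mul_sub]
    refine mul_le_mul_of_nonneg_left ?_ (hF i)
    have l1 := (abs_le.mp hlin).1
    have l2 := (abs_le.mp hconst).1
    linarith
  have hsum := Finset.sum_le_sum fun i (_ : i ∈ Finset.univ) => hterm i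
  rw [Finset.sum_sub_distrib, ← Finset.mul_sum] at hsum
  have l3 := (abs_le.mp hψa).1
  have l4 : Λ * Λ = Λ ^ 2 := by ring
  linarith

end Gradient

/-! ### The estimate at an interior maximum -/

section InteriorEstimate

open Filter Topology

variable {n : ℕ} {E : Type*} [NormedAddCommGroup E] [NormedSpace ℝ E]

lemma hasDerivAt_hessForm_line {B : E → E →L[ℝ] E →L[ℝ] E} {X : E → E →L[ℝ] E →L[ℝ] ℝ}
    {v : E → ℝ} {y₀ : E} (hv : ContDiffAt ℝ 3 v y₀) (hX : DifferentiableAt ℝ X y₀)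
    (hB : DifferentiableAt ℝ B y₀) (a e e' : E) :
    HasDerivAt (fun s : ℝ => hessForm B X v (y₀ + s • a) e e')
      (fderiv ℝ (fderiv ℝ (fderiv ℝ v)) y₀ a e e' - fderiv ℝ (fderiv ℝ v) y₀ a (B y₀ e e')
        - fderiv ℝ v y₀ (fderiv ℝ B y₀ a e e') + fderiv ℝ X y₀ a e e') 0 := by
  have hd1 : ContDiffAt ℝ 2 (fderiv ℝ v) y₀ := hv.fderiv_right (by norm_num)
  have hd2 : ContDiffAt ℝ 1 (fderiv ℝ (fderiv ℝ v)) y₀ := hd1.fderiv_right (by norm_num)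
  have e1 := hasDerivAt_line_zero (e := a) (hd1.differentiableAt (by simp))
  have e2 := hasDerivAt_line_zero (e := a) (hd2.differentiableAt (by simp))
  have eB := hasDerivAt_line_zero (e := a) hB
  have eX := hasDerivAt_line_zero (e := a) hX
  have k1 := (e2.clm_apply (hasDerivAt_const (0 : ℝ) e)).clm_apply (hasDerivAt_const (0 : ℝ) e')
  have kB := (eB.clm_apply (hasDerivAt_const (0 : ℝ) e)).clm_apply (hasDerivAt_const (0 : ℝ) e')
  have kX := (eX.clm_apply (hasDerivAt_const (0 : ℝ) e)).clm_apply (hasDerivAt_const (0 : ℝ) e')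
  have k2 := e1.clm_apply kB
  refine ((k1.sub k2).add kX).congr_deriv ?_
  simp only [zero_smul, add_zero, map_zero]
  ring

lemma hasDerivAt_line_of_contDiffAt_two {v : E → ℝ} {y₀ : E} (hv : ContDiffAt ℝ 2 v y₀) (e : E) :
    (∀ᶠ s : ℝ in 𝓝 0, HasDerivAt (fun r : ℝ => v (y₀ + r • e)) (fderiv ℝ v (y₀ + s • e) e) s) ∧
      HasDerivAt (fun r : ℝ => fderiv ℝ v (y₀ + r • e) e) (fderiv ℝ (fderiv ℝ v) y₀ e e) 0 := by
  constructor
  · have h1 : ∀ᶠ y in 𝓝 y₀, DifferentiableAt ℝ v y := by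
      filter_upwards [hv.eventually (by simp)] with y hy using hy.differentiableAt (by simp)
    filter_upwards [(tendsto_line y₀ e).eventually h1] with s hs using hasDerivAt_line hs
  · have h1 : DifferentiableAt ℝ (fderiv ℝ v) y₀ :=
      (hv.fderiv_right (m := 1) (by norm_num)).differentiableAt (by simp)
    have := (hasDerivAt_line_zero (e := e) h1).clm_apply (hasDerivAt_const (0 : ℝ) e)
    simpa using this

/-- First and second order conditions at a spatial maximum of
`c (v⁺ - v) exp (δ (2 Dv(V) - G(V, V)) + b (w - v))`. -/
lemma max_point_conditions {v v' w : E → ℝ} {G : E → E →L[ℝ] E →L[ℝ] ℝ} {y₀ : E}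
    (hv : ContDiffAt ℝ 3 v y₀) (hv' : ContDiffAt ℝ 2 v' y₀) (hw : ContDiffAt ℝ 2 w y₀)
    (hG : ContDiffAt ℝ 2 G y₀) (hGs : ∀ᶠ y in 𝓝 y₀, ∀ x x', G y x x' = G y x' x) (a : E)
    (A : E →L[ℝ] E) {δ b c : ℝ}
    (hmax : IsLocalMax (fun y => c * (v' y - v y)
      * Real.exp (δ * testFun v G (fun y => a + A (y - y₀)) y + b * (w y - v y))) y₀) (e : E) :
    c * (fderiv ℝ v' y₀ e - fderiv ℝ v y₀ e) = -(c * (v' y₀ - v y₀) *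
        (δ * testFunDeriv v G (fun y => a + A (y - y₀)) e (A e) y₀
          + b * (fderiv ℝ w y₀ e - fderiv ℝ v y₀ e))) ∧
      c * (fderiv ℝ (fderiv ℝ v') y₀ e e - fderiv ℝ (fderiv ℝ v) y₀ e e) ≤ c * (v' y₀ - v y₀) *
        ((δ * testFunDeriv v G (fun y => a + A (y - y₀)) e (A e) y₀
            + b * (fderiv ℝ w y₀ e - fderiv ℝ v y₀ e)) ^ 2
          - (δ * (2 * fderiv ℝ (fderiv ℝ (fderiv ℝ v)) y₀ e e a
              + 4 * fderiv ℝ (fderiv ℝ v) y₀ e (A e)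
              - fderiv ℝ (fderiv ℝ G) y₀ e e a a - 4 * fderiv ℝ G y₀ e (A e) a
              - 2 * G y₀ (A e) (A e))
            + b * (fderiv ℝ (fderiv ℝ w) y₀ e e - fderiv ℝ (fderiv ℝ v) y₀ e e))) := by
  obtain ⟨v1, v2⟩ := hasDerivAt_line_of_contDiffAt_two (hv.of_le (m := 2) (by norm_num)) e
  obtain ⟨v1', v2'⟩ := hasDerivAt_line_of_contDiffAt_two hv' e
  obtain ⟨w1, w2⟩ := hasDerivAt_line_of_contDiffAt_two hw e
  have t1 := hasDerivAt_testFun hv hG a e A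
  have t2 := hasDerivAt_testFunDeriv hv hG a e A hGs
  have hz : ∀ᶠ s : ℝ in 𝓝 0, HasDerivAt (fun r : ℝ => c * (v' (y₀ + r • e) - v (y₀ + r • e)))
      (c * (fderiv ℝ v' (y₀ + s • e) e - fderiv ℝ v (y₀ + s • e) e)) s := by
    filter_upwards [v1, v1'] with s h1 h2 using (h2.sub h1).const_mul c
  have hφ : ∀ᶠ s : ℝ in 𝓝 0, HasDerivAt (fun r : ℝ =>
      δ * testFun v G (fun y => a + A (y - y₀)) (y₀ + r • e)
        + b * (w (y₀ + r • e) - v (y₀ + r • e)))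
      (δ * testFunDeriv v G (fun y => a + A (y - y₀)) e (A e) (y₀ + s • e)
        + b * (fderiv ℝ w (y₀ + s • e) e - fderiv ℝ v (y₀ + s • e) e)) s := by
    filter_upwards [v1, w1, t1] with s h1 h2 h3
      using (h3.const_mul δ).add ((h2.sub h1).const_mul b)
  have hline : ContinuousAt (fun s : ℝ => y₀ + s • e) 0 := by fun_prop
  have hmax' : IsLocalMax (fun s : ℝ => c * (v' (y₀ + s • e) - v (y₀ + s • e))
      * Real.exp (δ * testFun v G (fun y => a + A (y - y₀)) (y₀ + s • e)
        + b * (w (y₀ + s • e) - v (y₀ + s • e)))) 0 := by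
    have := (tendsto_line y₀ e).eventually hmax
    simpa [IsLocalMax, IsMaxFilter] using this
  have key := second_deriv_le_of_isLocalMax_mul_exp hz ((v2'.sub v2).const_mul c) hφ
    ((t2.const_mul δ).add ((w2.sub v2).const_mul b)) hmax'
  simp only [zero_smul, add_zero] at key
  exact key

variable {Γ K : Set (Fin (n + 1) → ℝ)} {f : (Fin (n + 1) → ℝ) → ℝ}

/-- The differentiated equation in coordinates. -/
lemma IsStructural.differentiated_equation_frame (hΓ : IsSymmetricCone Γ) (hf : IsStructural Γ f)
    {G X : E → E →L[ℝ] E →L[ℝ] ℝ} {B : E → E →L[ℝ] E →L[ℝ] E} {v q ψ : E → ℝ} {y₀ : E}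
    {p : Fin n → E} {lam : Fin n → ℝ} (hv : ContDiffAt ℝ 3 v y₀) (hG : DifferentiableAt ℝ G y₀)
    (hX : DifferentiableAt ℝ X y₀) (hB : DifferentiableAt ℝ B y₀) (hq : DifferentiableAt ℝ q y₀)
    (hψ : DifferentiableAt ℝ ψ y₀) (hGs : ∀ᶠ y in 𝓝 y₀, ∀ x x', G y x x' = G y x' x)
    (horth : frameMatrix p (fun e e' => G y₀ e e') = 1)
    (hdiag : frameMatrix p (hessForm B X v y₀) = Matrix.diagonal lam)
    (hmem : append lam (-q y₀) ∈ Γ) (h0 : f (append lam (-q y₀)) = ψ y₀)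
    (heq : ∀ᶠ y in 𝓝 y₀, ∃ l, IsEigenvalueList (frameMatrix p (fun e e' => G y e e'))
      (frameMatrix p (hessForm B X v y)) l ∧ append l (-q y) ∈ Γ ∧ f (append l (-q y)) = ψ y)
    (a : E) :
    ∑ i, partialD f i.castSucc (append lam (-q y₀)) *
        (fderiv ℝ (fderiv ℝ (fderiv ℝ v)) y₀ a (p i) (p i)
        - fderiv ℝ (fderiv ℝ v) y₀ a (B y₀ (p i) (p i))
        - fderiv ℝ v y₀ (fderiv ℝ B y₀ a (p i) (p i)) + fderiv ℝ X y₀ a (p i) (p i)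
        - lam i * fderiv ℝ G y₀ a (p i) (p i))
      - partialD f (Fin.last n) (append lam (-q y₀)) * fderiv ℝ q y₀ a = fderiv ℝ ψ y₀ a := by
  have eG : ∀ i j, HasDerivAt (fun s : ℝ => G (y₀ + s • a) (p i) (p j))
      (fderiv ℝ G y₀ a (p i) (p j)) 0 := fun i j => by
    have := ((hasDerivAt_line_zero (e := a) hG).clm_apply
      (hasDerivAt_const (0 : ℝ) (p i))).clm_apply (hasDerivAt_const (0 : ℝ) (p j))
    simpa using this
  have key := hf.differentiated_equation (n := n) hΓ
    (H := fun s : ℝ => frameMatrix p (fun e e' => G (y₀ + s • a) e e'))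
    (V := fun s : ℝ => frameMatrix p (hessForm B X v (y₀ + s • a)))
    (H' := frameMatrix p (fun e e' => fderiv ℝ G y₀ a e e'))
    (V' := frameMatrix p fun e e' => fderiv ℝ (fderiv ℝ (fderiv ℝ v)) y₀ a e e'
        - fderiv ℝ (fderiv ℝ v) y₀ a (B y₀ e e')
        - fderiv ℝ v y₀ (fderiv ℝ B y₀ a e e') + fderiv ℝ X y₀ a e e')
    (τ := fun s : ℝ => -q (y₀ + s • a)) (ψ := fun s : ℝ => ψ (y₀ + s • a)) (lam := lam)
    (by simpa using horth) (by simpa using hdiag) (fun i j => eG i j)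
    (fun i j => hasDerivAt_hessForm_line hv hX hB a (p i) (p j))
    (hasDerivAt_line_zero hq).neg (hasDerivAt_line_zero hψ)
    (((tendsto_line y₀ a).eventually hGs).mono fun s hs => by
      ext i j; simp [frameMatrix, hs (p j) (p i)])
    (by simpa using hmem) (by simpa using h0) ((tendsto_line y₀ a).eventually heq)
  simp only [zero_smul, add_zero, frameMatrix, Matrix.of_apply] at key
  linarith

/-- The situation at an interior maximum `(y₀, t₀)` of
`z exp (δ N + b (w - u))`, where `z = (u(t + k) - u(t)) / |k|` and `N` is `|∇u|²`. Everything is read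
in a chart: `G` is the metric, `X` the tensor `χ`, `B` the Christoffel tensor, `ut` and `wt` are the
time derivatives, and `p` is an orthonormal frame that diagonalizes `∇²u + χ` at the point. Time
derivatives are taken from below, so that `t₀` may be the final time. Of `N` one needs only its value
at the point and that it dominates `2 Du(V) - G(V, V)` nearby. -/
structure InteriorMaximum (Γ K : Set (Fin (n + 1) → ℝ)) (f : (Fin (n + 1) → ℝ) → ℝ)
    (Λ A δ b : ℝ) (G X : E → E →L[ℝ] E →L[ℝ] ℝ) (B : E → E →L[ℝ] E →L[ℝ] E)
    (u w ψ ut wt N : E → ℝ → ℝ) (y₀ : E) (t₀ k : ℝ) (p : Fin n → E) (lam : Fin n → ℝ) : Prop where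
  step : k ≠ 0
  bounds : PointBounds G X B p (fun y => u y t₀) y₀ Λ
  dw : ‖fderiv ℝ (fun y => w y t₀) y₀‖ ≤ Λ
  dψ : ‖fderiv ℝ (fun y => ψ y t₀) y₀‖ ≤ Λ
  ψt : |ψ y₀ (t₀ + k) - ψ y₀ t₀| ≤ A * |k|
  symm : ∀ᶠ y in 𝓝 y₀, ∀ x x', G y x x' = G y x' x
  smoothG : ContDiffAt ℝ 2 G y₀
  smoothX : DifferentiableAt ℝ X y₀
  smoothB : DifferentiableAt ℝ B y₀
  smoothu : ContDiffAt ℝ 3 (fun y => u y t₀) y₀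
  smoothu' : ContDiffAt ℝ 2 (fun y => u y (t₀ + k)) y₀
  smoothw : ContDiffAt ℝ 2 (fun y => w y t₀) y₀
  smoothut : DifferentiableAt ℝ (fun y => ut y t₀) y₀
  smoothψ : DifferentiableAt ℝ (fun y => ψ y t₀) y₀
  timeu : HasDerivWithinAt (fun t => u y₀ t) (ut y₀ t₀) (Set.Iic t₀) t₀
  timeu' : HasDerivWithinAt (fun t => u y₀ (t + k)) (ut y₀ (t₀ + k)) (Set.Iic t₀) t₀
  timew : HasDerivWithinAt (fun t => w y₀ t) (wt y₀ t₀) (Set.Iic t₀) t₀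
  timeDu : ∀ a, HasDerivWithinAt (fun t => fderiv ℝ (fun y => u y t) y₀ a)
    (fderiv ℝ (fun y => ut y t₀) y₀ a) (Set.Iic t₀) t₀
  orth : frameMatrix p (fun e e' => G y₀ e e') = 1
  diag : frameMatrix p (hessForm B X (fun y => u y t₀) y₀) = Matrix.diagonal lam
  mem : append lam (-ut y₀ t₀) ∈ Γ
  eq : f (append lam (-ut y₀ t₀)) = ψ y₀ t₀
  eq_near : ∀ᶠ y in 𝓝 y₀, ∃ l, IsEigenvalueList (frameMatrix p (fun e e' => G y e e'))
    (frameMatrix p (hessForm B X (fun y => u y t₀) y)) l ∧ append l (-ut y t₀) ∈ Γ ∧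
      f (append l (-ut y t₀)) = ψ y t₀
  eq_step : ∃ l, IsEigenvalueList 1 (frameMatrix p (hessForm B X (fun y => u y (t₀ + k)) y₀)) l ∧
    append l (-ut y₀ (t₀ + k)) ∈ Γ ∧ f (append l (-ut y₀ (t₀ + k))) = ψ y₀ (t₀ + k)
  sub : ∃ l, IsEigenvalueList 1 (frameMatrix p (hessForm B X (fun y => w y t₀) y₀)) l ∧
    append l (-wt y₀ t₀) ∈ K ∧ ψ y₀ t₀ ≤ f (append l (-wt y₀ t₀))
  N_ge_space : ∀ᶠ y in 𝓝 y₀, ∀ V, 2 * fderiv ℝ (fun y => u y t₀) y V - G y V V ≤ N y t₀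
  N_ge_time : ∀ᶠ t in 𝓝[Set.Iio t₀] t₀, ∀ V,
    2 * fderiv ℝ (fun y => u y t) y₀ V - G y₀ V V ≤ N y₀ t
  N_eq : N y₀ t₀ = ∑ i, fderiv ℝ (fun y => u y t₀) y₀ (p i) ^ 2
  pos : 0 < |k|⁻¹ * (u y₀ (t₀ + k) - u y₀ t₀)
  max_space : ∀ᶠ y in 𝓝 y₀, |k|⁻¹ * (u y (t₀ + k) - u y t₀) *
      Real.exp (δ * N y t₀ + b * (w y t₀ - u y t₀)) ≤ |k|⁻¹ * (u y₀ (t₀ + k) - u y₀ t₀) *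
      Real.exp (δ * N y₀ t₀ + b * (w y₀ t₀ - u y₀ t₀))
  max_time : ∀ᶠ t in 𝓝[Set.Iio t₀] t₀, |k|⁻¹ * (u y₀ (t + k) - u y₀ t) *
      Real.exp (δ * N y₀ t + b * (w y₀ t - u y₀ t)) ≤ |k|⁻¹ * (u y₀ (t₀ + k) - u y₀ t₀) *
      Real.exp (δ * N y₀ t₀ + b * (w y₀ t₀ - u y₀ t₀))

lemma mul_exp_le_of_le {z φ φ' m : ℝ} (hm : 0 < m) (h : z * Real.exp φ ≤ m) (hφ : φ' ≤ φ) :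
    z * Real.exp φ' ≤ m := by
  rcases le_or_gt z 0 with hz | hz
  · exact (mul_nonpos_of_nonpos_of_nonneg hz (Real.exp_pos _).le).trans hm.le
  · exact (mul_le_mul_of_nonneg_left (Real.exp_le_exp.mpr hφ) hz.le).trans h

variable {Λ A δ b : ℝ} {G X : E → E →L[ℝ] E →L[ℝ] ℝ} {B : E → E →L[ℝ] E →L[ℝ] E}
  {u w ψ ut wt N : E → ℝ → ℝ} {y₀ : E} {t₀ k : ℝ} {p : Fin n → E} {lam : Fin n → ℝ}

/-- The maximum principle at an interior maximum: concavity of `f` makes the difference quotient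
a subsolution of the equation linearized at `(y₀, t₀)`, up to the bound `A` for `ψ_t`. -/
lemma InteriorMaximum.maximum_principle (hΓ : IsSymmetricCone Γ) (hf : IsStructural Γ f)
    (hδ : 0 < δ) (h : InteriorMaximum Γ K f Λ A δ b G X B u w ψ ut wt N y₀ t₀ k p lam) :
    -A ≤ |k|⁻¹ * (u y₀ (t₀ + k) - u y₀ t₀) *
      (∑ i, partialD f i.castSucc (append lam (-ut y₀ t₀)) *
        (δ * testFunDeriv (fun y => u y t₀) G
            (fun y => frameGrad (fun y => u y t₀) p y₀ + frameDiag (G y₀) p lam (y - y₀)) (p i)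
            (frameDiag (G y₀) p lam (p i)) y₀
          + b * (fderiv ℝ (fun y => w y t₀) y₀ (p i) - fderiv ℝ (fun y => u y t₀) y₀ (p i))) ^ 2
      - δ * (∑ i, partialD f i.castSucc (append lam (-ut y₀ t₀)) *
          (2 * fderiv ℝ (fderiv ℝ (fderiv ℝ (fun y => u y t₀))) y₀ (p i) (p i)
              (frameGrad (fun y => u y t₀) p y₀)
            + 4 * fderiv ℝ (fderiv ℝ (fun y => u y t₀)) y₀ (p i) (frameDiag (G y₀) p lam (p i))
            - fderiv ℝ (fderiv ℝ G) y₀ (p i) (p i) (frameGrad (fun y => u y t₀) p y₀)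
              (frameGrad (fun y => u y t₀) p y₀)
            - 4 * fderiv ℝ G y₀ (p i) (frameDiag (G y₀) p lam (p i))
              (frameGrad (fun y => u y t₀) p y₀)
            - 2 * G y₀ (frameDiag (G y₀) p lam (p i)) (frameDiag (G y₀) p lam (p i))
            - testFunDeriv (fun y => u y t₀) G (fun y => frameGrad (fun y => u y t₀) p y₀
                + frameDiag (G y₀) p lam (y - y₀)) (B y₀ (p i) (p i))
                (frameDiag (G y₀) p lam (B y₀ (p i) (p i))) y₀)
          - partialD f (Fin.last n) (append lam (-ut y₀ t₀)) *
            (2 * fderiv ℝ (fun y => ut y t₀) y₀ (frameGrad (fun y => u y t₀) p y₀)))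
      - b * (∑ i, partialD f i.castSucc (append lam (-ut y₀ t₀)) *
            (hessForm B X (fun y => w y t₀) y₀ (p i) (p i) - lam i)
          + partialD f (Fin.last n) (append lam (-ut y₀ t₀)) * (-wt y₀ t₀ - -ut y₀ t₀))) := by
  set v : E → ℝ := fun y => u y t₀ with hv
  set v' : E → ℝ := fun y => u y (t₀ + k) with hv'
  set μ := append lam (-ut y₀ t₀) with hμ
  set a := frameGrad v p y₀ with ha
  set D := frameDiag (G y₀) p lam with hD
  set z := |k|⁻¹ * (u y₀ (t₀ + k) - u y₀ t₀) with hz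
  set ft := partialD f (Fin.last n) μ with hft
  have hk : 0 < |k| := abs_pos.mpr h.step
  have hF : ∀ j, 0 < partialD f j μ := hf.increasing μ h.mem
  have hm : 0 < z * Real.exp (δ * N y₀ t₀ + b * (w y₀ t₀ - u y₀ t₀)) :=
    mul_pos h.pos (Real.exp_pos _)
  have hN0 : N y₀ t₀ = 2 * fderiv ℝ v y₀ a - G y₀ a a := by
    rw [h.N_eq, ha, apply_frameGrad_self h.orth, fderiv_frameGrad]; ring
  -- The maximum persists when `N` is replaced by the smaller test function, which agrees with `N`
  -- at the point; unlike `N` it involves no derivative of `G⁻¹`.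
  have hmaxs : IsLocalMax (fun y => |k|⁻¹ * (v' y - v y)
      * Real.exp (δ * testFun v G (fun y => a + D (y - y₀)) y + b * (w y t₀ - v y))) y₀ := by
    filter_upwards [h.max_space, h.N_ge_space] with y h1 h2
    have h3 : testFun v G (fun y => a + D (y - y₀)) y₀ = N y₀ t₀ := by
      simp [testFun, hN0]
    simp only [h3]
    refine mul_exp_le_of_le hm h1 ?_
    have h4 : testFun v G (fun y => a + D (y - y₀)) y ≤ N y t₀ := h2 _
    have := mul_le_mul_of_nonneg_left h4 hδ.le
    exact add_le_add_left this _
  have hcond := max_point_conditions h.smoothu h.smoothu' h.smoothw h.smoothG h.symm a D hmaxs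
  -- in time, the test function is the one with the constant vector `a`
  have htime : 0 ≤ |k|⁻¹ * (ut y₀ (t₀ + k) - ut y₀ t₀)
      + z * (δ * (2 * fderiv ℝ (fun y => ut y t₀) y₀ a) + b * (wt y₀ t₀ - ut y₀ t₀)) := by
    refine deriv_nonneg_of_max_mul_exp (z := fun t => |k|⁻¹ * (u y₀ (t + k) - u y₀ t))
      (φ := fun t => δ * (2 * fderiv ℝ (fun y => u y t) y₀ a - G y₀ a a)
        + b * (w y₀ t - u y₀ t)) ((h.timeu'.sub h.timeu).const_mul _)
      (((((h.timeDu a).const_mul 2).sub_const _).const_mul δ).add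
        ((h.timew.sub h.timeu).const_mul b)) ?_
    filter_upwards [h.max_time, h.N_ge_time] with t h1 h2
    rw [show 2 * fderiv ℝ (fun y => u y t₀) y₀ a - G y₀ a a = N y₀ t₀ from hN0.symm]
    refine mul_exp_le_of_le hm h1 ?_
    have := mul_le_mul_of_nonneg_left (h2 a) hδ.le
    exact add_le_add_left this _
  -- concavity of `f` between the vectors at the times `t₀` and `t₀ + k`, in the same frame
  obtain ⟨l, hl, hlΓ, hlf⟩ := h.eq_step
  have hconc : -A ≤ |k|⁻¹ * (∑ i, partialD f i.castSucc μ *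
      (hessForm B X v' y₀ (p i) (p i) - lam i) + ft * (-ut y₀ (t₀ + k) - -ut y₀ t₀)) := by
    have h1 := hl.append_diag_mem (K := {append l (-ut y₀ (t₀ + k))}) rfl
    have h2 := le_of_mem_symmHull (a := ψ y₀ (t₀ + k)) hΓ hf (Set.singleton_subset_iff.mpr hlΓ)
      (by rintro _ rfl; exact hlf.ge) h1
    have h3 := symmHull_subset hΓ (Set.singleton_subset_iff.mpr hlΓ) h1
    have h4 := hf.sub_le_sum hΓ h.mem h3
    rw [Fin.sum_univ_castSucc] at h4
    simp only [append_castSucc, append_last, frameMatrix, Matrix.of_apply] at h4 h2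
    rw [h.eq] at h4
    have h5 := (abs_le.mp h.ψt).1
    have h6 : -(A * |k|) ≤ ∑ i, partialD f i.castSucc μ *
      (hessForm B X v' y₀ (p i) (p i) - lam i) + ft * (-ut y₀ (t₀ + k) - -ut y₀ t₀) := by
      linarith
    have h7 := mul_le_mul_of_nonneg_left h6 (inv_nonneg.mpr hk.le)
    have h8 : |k|⁻¹ * -(A * |k|) = -A := by field_simp
    rw [h8] at h7
    exact h7
  have hlam : ∀ i, lam i = fderiv ℝ (fderiv ℝ v) y₀ (p i) (p i)
      - fderiv ℝ v y₀ (B y₀ (p i) (p i)) + X y₀ (p i) (p i) := fun i => by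
    rw [second_fderiv_frame h.diag]; ring
  have hterm : ∀ i, partialD f i.castSucc μ *
      (|k|⁻¹ * (hessForm B X v' y₀ (p i) (p i) - lam i)) ≤ z * (partialD f i.castSucc μ *
        (δ * testFunDeriv v G (fun y => a + D (y - y₀)) (p i) (D (p i)) y₀
          + b * (fderiv ℝ (fun y => w y t₀) y₀ (p i) - fderiv ℝ v y₀ (p i))) ^ 2
      - δ * (partialD f i.castSucc μ *
          (2 * fderiv ℝ (fderiv ℝ (fderiv ℝ v)) y₀ (p i) (p i) a
            + 4 * fderiv ℝ (fderiv ℝ v) y₀ (p i) (D (p i))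
            - fderiv ℝ (fderiv ℝ G) y₀ (p i) (p i) a a - 4 * fderiv ℝ G y₀ (p i) (D (p i)) a
            - 2 * G y₀ (D (p i)) (D (p i))
            - testFunDeriv v G (fun y => a + D (y - y₀)) (B y₀ (p i) (p i))
                (D (B y₀ (p i) (p i))) y₀))
      - b * (partialD f i.castSucc μ *
            (hessForm B X (fun y => w y t₀) y₀ (p i) (p i) - lam i))) := by
    intro i
    have c1 := (hcond (p i)).2
    have c2 := (hcond (B y₀ (p i) (p i))).1
    have c3 := mul_le_mul_of_nonneg_left c1 (hF i.castSucc).le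
    have e1 : |k|⁻¹ * (hessForm B X v' y₀ (p i) (p i) - lam i)
        = |k|⁻¹ * (fderiv ℝ (fderiv ℝ v') y₀ (p i) (p i) - fderiv ℝ (fderiv ℝ v) y₀ (p i) (p i))
          - |k|⁻¹ * (fderiv ℝ v' y₀ (B y₀ (p i) (p i)) - fderiv ℝ v y₀ (B y₀ (p i) (p i))) := by
      rw [hlam i, hessForm]; ring
    rw [e1, c2, mul_sub, hlam i, hessForm]
    refine (sub_le_sub_right c3 _).trans (le_of_eq ?_)
    simp only [hv, hz]
    ring
  have hsum := Finset.sum_le_sum fun i (_ : i ∈ Finset.univ) => hterm i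
  rw [← Finset.mul_sum, Finset.sum_sub_distrib, Finset.sum_sub_distrib, ← Finset.mul_sum,
    ← Finset.mul_sum] at hsum
  have hpull : ∑ i, partialD f i.castSucc μ * (|k|⁻¹ * (hessForm B X v' y₀ (p i) (p i) - lam i))
      = |k|⁻¹ * ∑ i, partialD f i.castSucc μ * (hessForm B X v' y₀ (p i) (p i) - lam i) := by
    rw [Finset.mul_sum]; exact Finset.sum_congr rfl fun i _ => by ring
  rw [hpull] at hsum
  have htime' := mul_nonneg (hF (Fin.last n)).le htime
  rw [mul_add] at hconc
  refine hconc.trans ?_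
  have e2 : |k|⁻¹ * (ft * (-ut y₀ (t₀ + k) - -ut y₀ t₀))
      = -(ft * (|k|⁻¹ * (ut y₀ (t₀ + k) - ut y₀ t₀))) := by ring
  rw [e2]
  refine (add_le_add hsum (neg_le.mp (show -(ft * (z * (δ * (2 * fderiv ℝ (fun y => ut y t₀) y₀ a)
    + b * (wt y₀ t₀ - ut y₀ t₀)))) ≤ ft * (|k|⁻¹ * (ut y₀ (t₀ + k) - ut y₀ t₀)) by
      linarith))).trans (le_of_eq ?_)
  ring

end InteriorEstimate

section InteriorBound

open Filter Topology

variable {n : ℕ} {Γ K : Set (Fin (n + 1) → ℝ)} {f : (Fin (n + 1) → ℝ) → ℝ}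

/-- For suitable weights `δ` and `b`, an interior maximum of the auxiliary function can occur only
where the difference quotient or the time derivative is bounded. -/
theorem exists_interior_estimate (hΓ : IsSymmetricCone Γ) (hf : IsStructural Γ f) {K₀ : ℝ}
    (hK₀ : 0 ≤ K₀)
    (hfK₀ : ∀ lam ∈ Γ, -K₀ * ∑ i, partialD f i lam ≤ ∑ i, partialD f i lam * lam i)
    (hK : IsCompact K) (hKΓ : K ⊆ Γ) {Λ A : ℝ} (hΛ : 1 ≤ Λ) (hA : 0 ≤ A)
    (E : Type*) [NormedAddCommGroup E] [NormedSpace ℝ E] :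
    ∃ δ b D : ℝ, 0 < δ ∧ 0 < b ∧ 0 ≤ D ∧
      ∀ (G X : E → E →L[ℝ] E →L[ℝ] ℝ) (B : E → E →L[ℝ] E →L[ℝ] E)
        (u w ψ ut wt N : E → ℝ → ℝ) (y₀ : E) (t₀ k : ℝ) (p : Fin n → E) (lam : Fin n → ℝ),
        InteriorMaximum Γ K f Λ A δ b G X B u w ψ ut wt N y₀ t₀ k p lam →
        |k|⁻¹ * (u y₀ (t₀ + k) - u y₀ t₀) ≤ D ∨ |ut y₀ t₀| ≤ D := by
  obtain ⟨s, hs, hraise⟩ := hf.exists_raise hΓ hK hKΓ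
  obtain ⟨R, hR0, hR⟩ : ∃ R : ℝ, 0 ≤ R ∧ ∀ κ ∈ K, ∀ i, |κ i| ≤ R := by
    obtain ⟨R, hR⟩ := hK.isBounded.exists_norm_le
    exact ⟨max R 0, le_max_right _ _, fun κ hκ i =>
      ((norm_le_pi_norm κ i).trans (hR κ hκ)).trans (le_max_left _ _)⟩
  have hC : (1 : ℝ) ≤ 20 * Λ ^ 6 := by
    have : 1 ≤ Λ ^ 6 := one_le_pow₀ hΛ
    linarith
  have hc₀ : 0 < s / (R + K₀ + 1) := by positivity
  obtain ⟨δ, b, D, hδ, hb, hD, key⟩ := exists_weights hC (half_pos hs) (half_pos hs) hc₀ hA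
  refine ⟨δ, b, max D ((K₀ + R + D) / (s / 2)), hδ, hb,
    le_trans (by linarith) (le_max_left _ _), ?_⟩
  intro G X B u w ψ ut wt N y₀ t₀ k p lam h
  set μ := append lam (-ut y₀ t₀) with hμ
  have hF : ∀ j, 0 < partialD f j μ := hf.increasing μ h.mem
  -- The eigenframe of `u` need not diagonalize the tensor of `w`; by Schur's inequality the diagonal
  -- entries `κ` still lie in the convex hull of the permutations of the eigenvalues.
  obtain ⟨l, hl, hlK, hlf⟩ := h.sub
  set κ : Fin (n + 1) → ℝ := append (fun i => hessForm B X (fun y => w y t₀) y₀ (p i) (p i))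
    (-wt y₀ t₀) with hκdef
  have hκ : κ ∈ symmHull {append l (-wt y₀ t₀)} :=
    hl.append_diag_mem (K := {append l (-wt y₀ t₀)}) rfl
  have hκΓ : κ ∈ Γ := symmHull_subset hΓ (Set.singleton_subset_iff.mpr (hKΓ hlK)) hκ
  have hμκ : f μ ≤ f κ := le_of_mem_symmHull hΓ hf (Set.singleton_subset_iff.mpr (hKΓ hlK))
    (by rintro _ rfl; rw [h.eq]; exact hlf) hκ
  have hκR : ∀ i, |κ i| ≤ R := abs_le_of_mem_symmHull (hR _ hlK) hκ
  have hr : ∀ j, (κ + Pi.single j 1 - fun _ => s) ∈ Γ ∧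
      f μ + s ≤ f (κ + Pi.single j 1 - fun _ => s) :=
    fun j => hf.raise_of_mem_symmHull hΓ (by rw [h.eq]; exact hlf) (hraise _ hlK) hκ j
  set S := ∑ j, partialD f j μ with hS
  have hS' : S = ∑ i : Fin n, partialD f i.castSucc μ + partialD f (Fin.last n) μ :=
    Fin.sum_univ_castSucc _
  have hSlow : s / (R + K₀ + 1) ≤ S := by
    rw [div_le_iff₀ (by positivity), mul_comm]
    exact hf.sum_partialD_lower_bound hΓ h.mem hs (hfK₀ μ h.mem) hκR (Fin.last n) (hr _)
  have hS0 : 0 < S := lt_of_lt_of_le hc₀ hSlow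
  have hLw : ∑ j, partialD f j μ * (κ j - μ j) = ∑ i, partialD f i.castSucc μ *
      (hessForm B X (fun y => w y t₀) y₀ (p i) (p i) - lam i)
        + partialD f (Fin.last n) μ * (-wt y₀ t₀ - -ut y₀ t₀) := by
    rw [Fin.sum_univ_castSucc]; simp [hκdef, hμ]
  have hLw0 : 0 ≤ ∑ j, partialD f j μ * (κ j - μ j) :=
    (sub_nonneg.mpr hμκ).trans (hf.sub_le_sum hΓ h.mem hκΓ)
  have hdich := hf.dichotomy hΓ h.mem hs hr
  have hGs := h.symm.self_of_nhds
  have hdiff := hf.differentiated_equation_frame hΓ h.smoothu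
    (h.smoothG.differentiableAt (by simp)) h.smoothX h.smoothB h.smoothut h.smoothψ h.symm
    h.orth h.diag h.mem h.eq h.eq_near (frameGrad (fun y => u y t₀) p y₀)
  have hLN := h.bounds.linearized_testFun_ge h.orth hGs h.diag h.smoothu
    (fun i => (hF i.castSucc).le) h.dψ hdiff
  have hmax := h.maximum_principle hΓ hf hδ
  rw [← hLw] at hmax
  have hd : ∀ i, |fderiv ℝ (fun y => w y t₀) y₀ (p i) - fderiv ℝ (fun y => u y t₀) y₀ (p i)|
      ≤ 20 * Λ ^ 6 := by
    intro i
    have e1 := abs_apply_le_of_bounds h.dw (h.bounds.frame i)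
    have e2 := abs_apply_le_of_bounds h.bounds.dv (h.bounds.frame i)
    have e3 : Λ ^ 2 ≤ Λ ^ 6 := pow_le_pow_right₀ hΛ (by norm_num)
    have e4 : 0 ≤ Λ ^ 6 := by positivity
    refine (abs_sub _ _).trans ?_
    nlinarith
  have hconcl := key n _ lam _ _ S _ _ _ (fun i => (hF i.castSucc).le)
    (by rw [hS']; linarith [hF (Fin.last n)]) hSlow hLN
    (fun i => h.bounds.abs_testFunDeriv_le h.orth hGs h.diag i) hd h.pos hmax
    (hdich.imp id fun hc => ⟨hLw0, fun i => hc i.castSucc⟩)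
  rcases hconcl with hz | ⟨hnot, hlam⟩
  · exact Or.inl (hz.trans (le_max_left _ _))
  · right
    obtain hc | hc := hdich
    · exact absurd hc hnot
    have hlow := hfK₀ μ h.mem
    rw [Fin.sum_univ_castSucc (f := fun i => partialD f i μ * μ i)] at hlow
    simp only [hμ, append_castSucc, append_last] at hlow
    rw [hLw] at hLw0
    have := abs_last_le (κ := fun i => hessForm B X (fun y => w y t₀) y₀ (p i) (p i))
      (fun i => (hF (Fin.castSucc i)).le) hS' hS0 (half_pos hs) (hc (Fin.last n)) hlam
      (fun i => by simpa [hκdef] using hκR i.castSucc)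
      (by simpa [hκdef] using hκR (Fin.last n)) hK₀ hR0 (by linarith) hlow hLw0
    rw [abs_neg] at this
    exact this.trans (le_max_right _ _)

end InteriorBound

/-! ### Tensors in charts -/

section Charts

open Filter Topology Bundle

variable {n : ℕ} [NeZero n] {M : Type*} [TopologicalSpace M]
  [ChartedSpace (EuclideanHalfSpace n) M]

lemma mem_source_of_mem_target {c : M} {y : EuclideanSpace ℝ (Fin n)}
    (hy : y ∈ (extChartAt (𝓡∂ n) c).target) :
    (extChartAt (𝓡∂ n) c).symm y ∈ (chartAt (EuclideanHalfSpace n) c).source := by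
  have := (extChartAt (𝓡∂ n) c).map_target hy
  rwa [extChartAt_source] at this

lemma coordDeriv_eq_target (c : M) (i : Fin n) (h : EuclideanSpace ℝ (Fin n) → ℝ)
    {y : EuclideanSpace ℝ (Fin n)} (hy : y ∈ (extChartAt (𝓡∂ n) c).target) :
    coordDeriv i h y = fderivWithin ℝ h (extChartAt (𝓡∂ n) c).target y
      (EuclideanSpace.single i 1) := by
  have hs : (extChartAt (𝓡∂ n) c).target =ᶠ[𝓝 y] Set.range (𝓡∂ n) :=
    extChartAt_target_eventuallyEq_of_mem hy
  rw [coordDeriv, fderivWithin_congr_set hs]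

lemma contDiffOn_coordDeriv (c : M) (i : Fin n) {h : EuclideanSpace ℝ (Fin n) → ℝ} {k : ℕ∞ω}
    {m : ℕ∞ω} (hh : ContDiffOn ℝ k h (extChartAt (𝓡∂ n) c).target) (hm : m + 1 ≤ k) :
    ContDiffOn ℝ m (coordDeriv i h) (extChartAt (𝓡∂ n) c).target :=
  ((hh.fderivWithin (uniqueDiffOn_extChartAt_target c) hm).clm_apply contDiffOn_const).congr
    fun _ hy => coordDeriv_eq_target c i h hy

/-- The tangent vector with components `a` in the chart. -/
def coordCombo (c : M) (y : EuclideanSpace ℝ (Fin n)) (a : Fin n → ℝ) :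
    TangentSpace (𝓡∂ n) ((extChartAt (𝓡∂ n) c).symm y) :=
  mfderivWithin 𝓘(ℝ, EuclideanSpace ℝ (Fin n)) (𝓡∂ n) (extChartAt (𝓡∂ n) c).symm
    (Set.range (𝓡∂ n)) y (WithLp.toLp 2 a : EuclideanSpace ℝ (Fin n))

lemma coordCombo_eq (c : M) (y : EuclideanSpace ℝ (Fin n)) (a : Fin n → ℝ) :
    coordCombo c y a = ∑ i, a i • coordVector c i y := by
  have h : (WithLp.toLp 2 a : EuclideanSpace ℝ (Fin n))
      = ∑ i, a i • EuclideanSpace.single i (1 : ℝ) := by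
    ext j
    simp [Pi.single_apply]
  simp only [coordCombo, coordVector]
  rw [h]
  erw [map_sum]
  refine Finset.sum_congr rfl fun i _ => ?_
  erw [map_smul]

variable [IsManifold (𝓡∂ n) ∞ M]

lemma contMDiffOn_symmL (c : M) (v : EuclideanSpace ℝ (Fin n)) :
    ContMDiffOn (𝓡∂ n) (𝓡∂ n).tangent ∞
      (fun x : M => TotalSpace.mk' (EuclideanSpace ℝ (Fin n)) x
        ((trivializationAt (EuclideanSpace ℝ (Fin n)) (TangentSpace (𝓡∂ n)) c).symmL ℝ x v))
      (chartAt (EuclideanHalfSpace n) c).source := by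
  have hb : (trivializationAt (EuclideanSpace ℝ (Fin n))
      (TangentSpace (𝓡∂ n) : M → Type _) c).baseSet
      = (chartAt (EuclideanHalfSpace n) c).source := rfl
  rw [← hb, Trivialization.contMDiffOn_section_baseSet_iff]
  refine (contMDiffOn_const (c := v)).congr fun x hx => ?_
  have := Trivialization.apply_mk_symm
    (trivializationAt (EuclideanSpace ℝ (Fin n)) (TangentSpace (𝓡∂ n) : M → Type _) c) hx v
  rw [Trivialization.symmL_apply]
  exacts [congrArg Prod.snd this, hx]

lemma coordVector_eq (c : M) (i : Fin n) {y : EuclideanSpace ℝ (Fin n)}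
    (hy : y ∈ (extChartAt (𝓡∂ n) c).target) :
    coordVector c i y = (trivializationAt (EuclideanSpace ℝ (Fin n)) (TangentSpace (𝓡∂ n)) c).symmL
      ℝ ((extChartAt (𝓡∂ n) c).symm y) (EuclideanSpace.single i 1) := by
  have h := TangentBundle.symmL_trivializationAt (I := 𝓡∂ n) (mem_source_of_mem_target hy)
  rw [h, (extChartAt (𝓡∂ n) c).right_inv hy]
  rfl

/-- The components of a smooth `(0,2)` tensor are smooth up to the boundary. -/
lemma contDiffOn_coordTensor
    {T : (x : M) → TangentSpace (𝓡∂ n) x →L[ℝ] TangentSpace (𝓡∂ n) x →L[ℝ] ℝ}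
    (hT : ContMDiff (𝓡∂ n)
      ((𝓡∂ n).prod 𝓘(ℝ, EuclideanSpace ℝ (Fin n) →L[ℝ] EuclideanSpace ℝ (Fin n) →L[ℝ] ℝ)) ∞
      (fun x : M => Bundle.TotalSpace.mk'
        (EuclideanSpace ℝ (Fin n) →L[ℝ] EuclideanSpace ℝ (Fin n) →L[ℝ] ℝ) x (T x)))
    (c : M) (i j : Fin n) :
    ContDiffOn ℝ ∞ (fun y => coordTensor T c y i j) (extChartAt (𝓡∂ n) c).target := by
  have h1 : ContMDiffOn (𝓡∂ n) ((𝓡∂ n).prod 𝓘(ℝ, ℝ)) ∞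
      (fun x : M => TotalSpace.mk' ℝ (E := Bundle.Trivial M ℝ) x (T x
        ((trivializationAt (EuclideanSpace ℝ (Fin n)) (TangentSpace (𝓡∂ n)) c).symmL ℝ x
          (EuclideanSpace.single i 1))
        ((trivializationAt (EuclideanSpace ℝ (Fin n)) (TangentSpace (𝓡∂ n)) c).symmL ℝ x
          (EuclideanSpace.single j 1))))
      (chartAt (EuclideanHalfSpace n) c).source := by
    apply ContMDiffOn.clm_bundle_apply₂ (F₁ := EuclideanSpace ℝ (Fin n))
      (F₂ := EuclideanSpace ℝ (Fin n))
    · exact hT.contMDiffOn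
    · exact contMDiffOn_symmL c _
    · exact contMDiffOn_symmL c _
  have h2 : ContMDiffOn (𝓡∂ n) 𝓘(ℝ, ℝ) ∞ (fun x : M => T x
        ((trivializationAt (EuclideanSpace ℝ (Fin n)) (TangentSpace (𝓡∂ n)) c).symmL ℝ x
          (EuclideanSpace.single i 1))
        ((trivializationAt (EuclideanSpace ℝ (Fin n)) (TangentSpace (𝓡∂ n)) c).symmL ℝ x
          (EuclideanSpace.single j 1)))
      (chartAt (EuclideanHalfSpace n) c).source := fun x hx => by
    have := h1 x hx
    rw [contMDiffWithinAt_totalSpace] at this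
    exact this.2
  have h3 := h2.comp (contMDiffOn_extChartAt_symm (I := 𝓡∂ n) (n := ∞) c)
    fun y hy => mem_source_of_mem_target hy
  refine (contMDiffOn_iff_contDiffOn.mp h3).congr fun y hy => ?_
  simp only [coordTensor, Matrix.of_apply, coordVector_eq c _ hy, Function.comp_apply]

variable (g : Metric n M)

lemma contDiffOn_metricCoord (c : M) (i j : Fin n) :
    ContDiffOn ℝ ∞ (fun y => metricCoord g c y i j) (extChartAt (𝓡∂ n) c).target :=
  contDiffOn_coordTensor g.contMDiff c i j

lemma metricCoord_symm (c : M) (y : EuclideanSpace ℝ (Fin n)) (i j : Fin n) :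
    metricCoord g c y i j = metricCoord g c y j i := g.symm _ _ _

lemma coordCombo_surjective (c : M) {y : EuclideanSpace ℝ (Fin n)}
    (hy : y ∈ (extChartAt (𝓡∂ n) c).target)
    (V : TangentSpace (𝓡∂ n) ((extChartAt (𝓡∂ n) c).symm y)) : ∃ a, coordCombo c y a = V := by
  obtain ⟨e, he⟩ := (isInvertible_mfderivWithin_extChartAt_symm (I := 𝓡∂ n) hy).surjective V
  exact ⟨WithLp.ofLp e, he⟩

lemma coordCombo_ne_zero (c : M) {y : EuclideanSpace ℝ (Fin n)}
    (hy : y ∈ (extChartAt (𝓡∂ n) c).target) {a : Fin n → ℝ} (ha : a ≠ 0) :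
    coordCombo c y a ≠ 0 := by
  intro h
  apply ha
  have hinj := (isInvertible_mfderivWithin_extChartAt_symm (I := 𝓡∂ n) hy).injective
  have h0 : (WithLp.toLp 2 a : EuclideanSpace ℝ (Fin n)) = 0 := hinj (h.trans (map_zero _).symm)
  ext i
  exact congrArg (fun e : EuclideanSpace ℝ (Fin n) => e i) h0

lemma inner_coordCombo (c : M) (y : EuclideanSpace ℝ (Fin n)) (a b : Fin n → ℝ) :
    g.inner ((extChartAt (𝓡∂ n) c).symm y) (coordCombo c y a) (coordCombo c y b)
      = a ⬝ᵥ (metricCoord g c y *ᵥ b) := by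
  rw [coordCombo_eq, coordCombo_eq]
  simp only [map_sum, map_smul, sum_apply, smul_apply, smul_eq_mul, dotProduct, Matrix.mulVec,
    metricCoord, coordTensor, Matrix.of_apply, Finset.mul_sum]
  rw [Finset.sum_comm]
  refine Finset.sum_congr rfl fun i _ => Finset.sum_congr rfl fun j _ => by ring

lemma metricCoord_posDef (c : M) {y : EuclideanSpace ℝ (Fin n)}
    (hy : y ∈ (extChartAt (𝓡∂ n) c).target) : (metricCoord g c y).PosDef := by
  refine Matrix.PosDef.of_dotProduct_mulVec_pos ?_ fun a ha => ?_
  · ext i j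
    exact metricCoord_symm g c y j i
  · have := g.pos _ _ (coordCombo_ne_zero c hy ha)
    rw [inner_coordCombo] at this
    simpa using this

lemma contDiffOn_metricCoord_inv (c : M) (i j : Fin n) :
    ContDiffOn ℝ ∞ (fun y => (metricCoord g c y)⁻¹ i j) (extChartAt (𝓡∂ n) c).target := by
  have hdet : ∀ (A : EuclideanSpace ℝ (Fin n) → Matrix (Fin n) (Fin n) ℝ),
      (∀ i j, ContDiffOn ℝ ∞ (fun y => A y i j) (extChartAt (𝓡∂ n) c).target) →
      ContDiffOn ℝ ∞ (fun y => (A y).det) (extChartAt (𝓡∂ n) c).target := by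
    intro A hA
    simp only [Matrix.det_apply]
    exact ContDiffOn.sum fun σ _ => (contDiffOn_prod fun k _ => hA _ _).const_smul _
  have hadj : ContDiffOn ℝ ∞ (fun y => (metricCoord g c y).adjugate i j)
      (extChartAt (𝓡∂ n) c).target := by
    simp only [Matrix.adjugate_apply]
    refine hdet _ fun k l => ?_
    by_cases hk : k = j
    · subst hk
      simp only [Matrix.updateRow_self]
      exact contDiffOn_const
    · simp only [Matrix.updateRow_ne hk]
      exact contDiffOn_metricCoord g c k l
  have h0 : ∀ y ∈ (extChartAt (𝓡∂ n) c).target, (metricCoord g c y).det ≠ 0 :=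
    fun y hy => (metricCoord_posDef g c hy).det_pos.ne'
  refine (((hdet _ (contDiffOn_metricCoord g c)).inv h0).mul hadj).congr fun y hy => ?_
  rw [Matrix.inv_def, Ring.inverse_eq_inv']
  simp

lemma contDiffOn_christoffel (c : M) (k i j : Fin n) :
    ContDiffOn ℝ ∞ (christoffel g c k i j) (extChartAt (𝓡∂ n) c).target := by
  have hd : ∀ a b d : Fin n, ContDiffOn ℝ ∞ (coordDeriv a (fun z => metricCoord g c z b d))
      (extChartAt (𝓡∂ n) c).target := fun a b d =>
    contDiffOn_coordDeriv c a (contDiffOn_metricCoord g c b d) (by simp)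
  have : ContDiffOn ℝ ∞ (fun y => (1 / 2 : ℝ) * ∑ l, (metricCoord g c y)⁻¹ k l *
    (coordDeriv i (fun z => metricCoord g c z j l) y
      + coordDeriv j (fun z => metricCoord g c z i l) y
      - coordDeriv l (fun z => metricCoord g c z i j) y)) (extChartAt (𝓡∂ n) c).target :=
    contDiffOn_const.mul (ContDiffOn.sum fun l _ => (contDiffOn_metricCoord_inv g c k l).mul
      (((hd i j l).add (hd j i l)).sub (hd l i j)))
  exact this

end Charts

/-! ### Frames and bilinear forms in coordinates -/

section Forms

open Filter Topology

variable {n : ℕ}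

/-- The bilinear form on `ℝⁿ` with matrix `m`. -/
def matrixForm (m : Matrix (Fin n) (Fin n) ℝ) :
    EuclideanSpace ℝ (Fin n) →L[ℝ] EuclideanSpace ℝ (Fin n) →L[ℝ] ℝ :=
  ∑ i, ∑ j, m i j • (EuclideanSpace.proj i : EuclideanSpace ℝ (Fin n) →L[ℝ] ℝ).smulRight
    (EuclideanSpace.proj j : EuclideanSpace ℝ (Fin n) →L[ℝ] ℝ)

lemma matrixForm_apply (m : Matrix (Fin n) (Fin n) ℝ) (v w : EuclideanSpace ℝ (Fin n)) :
    matrixForm m v w = ∑ i, ∑ j, m i j * v i * w j := by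
  simp only [matrixForm, sum_apply, smul_apply, ContinuousLinearMap.smulRight_apply, smul_eq_mul]
  exact Finset.sum_congr rfl fun i _ => Finset.sum_congr rfl fun j _ => by
    simp [mul_assoc]

lemma matrixForm_single (m : Matrix (Fin n) (Fin n) ℝ) (i j : Fin n) :
    matrixForm m (EuclideanSpace.single i 1) (EuclideanSpace.single j 1) = m i j := by
  simp [matrixForm_apply]

lemma matrixForm_symm {m : Matrix (Fin n) (Fin n) ℝ} (hm : ∀ i j, m i j = m j i)
    (v w : EuclideanSpace ℝ (Fin n)) : matrixForm m v w = matrixForm m w v := by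
  rw [matrixForm_apply, matrixForm_apply, Finset.sum_comm]
  exact Finset.sum_congr rfl fun i _ => Finset.sum_congr rfl fun j _ => by rw [hm j i]; ring

lemma contDiffOn_matrixForm {m : EuclideanSpace ℝ (Fin n) → Matrix (Fin n) (Fin n) ℝ}
    {s : Set (EuclideanSpace ℝ (Fin n))} (hm : ∀ i j, ContDiffOn ℝ ∞ (fun y => m y i j) s) :
    ContDiffOn ℝ ∞ (fun y => matrixForm (m y)) s := by
  simp only [matrixForm]
  exact ContDiffOn.sum fun i _ => ContDiffOn.sum fun j _ =>
    (hm i j).smul contDiffOn_const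

/-- The bilinear map `ℝⁿ × ℝⁿ → ℝⁿ` with components `Γ k i j`. -/
def tensorForm (Γ : Fin n → Fin n → Fin n → ℝ) :
    EuclideanSpace ℝ (Fin n) →L[ℝ] EuclideanSpace ℝ (Fin n) →L[ℝ] EuclideanSpace ℝ (Fin n) :=
  ∑ i, ∑ j, ∑ k, Γ k i j • (EuclideanSpace.proj i : EuclideanSpace ℝ (Fin n) →L[ℝ] ℝ).smulRight
    ((EuclideanSpace.proj j : EuclideanSpace ℝ (Fin n) →L[ℝ] ℝ).smulRight
      (EuclideanSpace.single k (1 : ℝ)))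

lemma tensorForm_single (Γ : Fin n → Fin n → Fin n → ℝ) (i j : Fin n) :
    tensorForm Γ (EuclideanSpace.single i 1) (EuclideanSpace.single j 1)
      = ∑ k, Γ k i j • EuclideanSpace.single k (1 : ℝ) := by
  simp only [tensorForm, sum_apply, smul_apply, ContinuousLinearMap.smulRight_apply]
  rw [Finset.sum_eq_single i, Finset.sum_eq_single j]
  · simp
  · intro b _ hb; simp [hb]
  · simp
  · intro b _ hb; simp [hb]
  · simp

/-- The columns of a matrix, as vectors. -/
def columns (P : Matrix (Fin n) (Fin n) ℝ) (i : Fin n) : EuclideanSpace ℝ (Fin n) :=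
  WithLp.toLp 2 fun a => P a i

lemma columns_eq_sum (P : Matrix (Fin n) (Fin n) ℝ) (i : Fin n) :
    columns P i = ∑ a, P a i • EuclideanSpace.single a (1 : ℝ) := by
  ext j
  simp [columns, Pi.single_apply]

lemma frameMatrix_columns (P : Matrix (Fin n) (Fin n) ℝ)
    (T : EuclideanSpace ℝ (Fin n) →L[ℝ] EuclideanSpace ℝ (Fin n) →L[ℝ] ℝ) :
    frameMatrix (columns P) (fun e e' => T e e') = Pᵀ * (Matrix.of fun i j =>
      T (EuclideanSpace.single i 1) (EuclideanSpace.single j 1)) * P := by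
  ext i j
  simp only [frameMatrix, Matrix.of_apply, columns_eq_sum, map_sum, map_smul, sum_apply,
    smul_apply, smul_eq_mul, Matrix.mul_apply, Matrix.transpose_apply, Finset.sum_mul,
    Finset.mul_sum]
  refine Finset.sum_congr rfl fun a _ => ?_
  refine Finset.sum_congr rfl fun b _ => by ring

lemma frameMatrix_matrixForm (P m : Matrix (Fin n) (Fin n) ℝ) :
    frameMatrix (columns P) (fun e e' => matrixForm m e e') = Pᵀ * m * P := by
  rw [frameMatrix_columns]
  congr 2
  ext i j
  exact matrixForm_single m i j

section Inverse

variable {P G : Matrix (Fin n) (Fin n) ℝ}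

lemma inv_eq_of_orthonormal (h : Pᵀ * G * P = 1) : G⁻¹ = P * Pᵀ := by
  have h1 : P * (Pᵀ * G) = 1 := mul_eq_one_comm.mp h
  exact Matrix.inv_eq_left_inv (by rw [Matrix.mul_assoc]; exact h1)

lemma isUnit_det_of_orthonormal (h : Pᵀ * G * P = 1) : IsUnit P.det :=
  Matrix.isUnit_det_of_left_inverse h

lemma norm_columns_sq_le (h : Pᵀ * G * P = 1) (i : Fin n) :
    ‖columns P i‖ ^ 2 ≤ ∑ a, G⁻¹ a a := by
  rw [EuclideanSpace.norm_sq_eq, inv_eq_of_orthonormal h]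
  refine Finset.sum_le_sum fun a _ => ?_
  simp only [columns, Matrix.mul_apply, Matrix.transpose_apply, Real.norm_eq_abs, sq_abs]
  rw [sq]
  exact Finset.single_le_sum (f := fun k => P a k * P a k) (fun k _ => mul_self_nonneg _)
    (Finset.mem_univ i)

lemma sum_inv_mul_eq_sum_sq (h : Pᵀ * G * P = 1) (L : EuclideanSpace ℝ (Fin n) →L[ℝ] ℝ) :
    ∑ i, ∑ j, G⁻¹ i j * L (EuclideanSpace.single i 1) * L (EuclideanSpace.single j 1)
      = ∑ k, L (columns P k) ^ 2 := by
  simp only [inv_eq_of_orthonormal h, columns_eq_sum, map_sum, map_smul, smul_eq_mul, sq,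
    Matrix.mul_apply, Matrix.transpose_apply, Finset.sum_mul, Finset.mul_sum]
  rw [Finset.sum_comm]
  conv_rhs => rw [Finset.sum_comm]; enter [2, b]; rw [Finset.sum_comm]
  exact Finset.sum_congr rfl fun i _ => Finset.sum_congr rfl fun j _ =>
    Finset.sum_congr rfl fun k _ => by ring

end Inverse

/-- Legendre duality for a positive definite quadratic form; the second part says that the bound is
attained at `a = G⁻¹ p`. -/
lemma two_mul_dotProduct_sub_le {G : Matrix (Fin n) (Fin n) ℝ} (hG : G.PosDef) (p a : Fin n → ℝ) :
    2 * (p ⬝ᵥ a) - a ⬝ᵥ (G *ᵥ a) ≤ p ⬝ᵥ (G⁻¹ *ᵥ p) ∧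
      2 * (p ⬝ᵥ (G⁻¹ *ᵥ p)) - (G⁻¹ *ᵥ p) ⬝ᵥ (G *ᵥ (G⁻¹ *ᵥ p)) = p ⬝ᵥ (G⁻¹ *ᵥ p) := by
  have hu : IsUnit G.det := hG.det_pos.ne'.isUnit
  have hb : G *ᵥ (G⁻¹ *ᵥ p) = p := by
    rw [Matrix.mulVec_mulVec, Matrix.mul_nonsing_inv G hu, Matrix.one_mulVec]
  have hsym : Gᵀ = G := by
    have := hG.isHermitian
    rwa [Matrix.IsHermitian, Matrix.conjTranspose_eq_transpose_of_trivial] at this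
  set b := G⁻¹ *ᵥ p with hbdef
  have h1 : b ⬝ᵥ (G *ᵥ a) = p ⬝ᵥ a := by
    rw [Matrix.dotProduct_mulVec, ← Matrix.mulVec_transpose, hsym, hb]
  constructor
  · have h0 := hG.posSemidef.dotProduct_mulVec_nonneg (a - b)
    simp only [star_trivial, Matrix.mulVec_sub, sub_dotProduct, dotProduct_sub, hb, h1] at h0
    rw [dotProduct_comm a p, dotProduct_comm b p] at h0
    linarith
  · rw [hb, dotProduct_comm b p]; ring

end Forms

section Bounds

open Filter Topology

variable {E F : Type*} [NormedAddCommGroup E] [NormedSpace ℝ E] [NormedAddCommGroup F]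
  [NormedSpace ℝ F]

/-- A function that is smooth up to the boundary is bounded on compact sets together with its
first two derivatives. -/
lemma exists_bound_fderiv {h : E → F} {s L : Set E} (hs : UniqueDiffOn ℝ s)
    (hh : ContDiffOn ℝ ∞ h s) (hL : IsCompact L) (hLs : L ⊆ s) :
    ∃ C : ℝ, ∀ y ∈ L, ‖h y‖ ≤ C ∧
      (s ∈ 𝓝 y → ‖fderiv ℝ h y‖ ≤ C ∧ ‖fderiv ℝ (fderiv ℝ h) y‖ ≤ C) := by
  have h1 : ContDiffOn ℝ ∞ (fderivWithin ℝ h s) s := hh.fderivWithin hs (by simp)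
  have h2 : ContDiffOn ℝ ∞ (fderivWithin ℝ (fderivWithin ℝ h s) s) s :=
    h1.fderivWithin hs (by simp)
  obtain ⟨C₀, hC₀⟩ := hL.exists_bound_of_continuousOn (hh.continuousOn.mono hLs)
  obtain ⟨C₁, hC₁⟩ := hL.exists_bound_of_continuousOn (h1.continuousOn.mono hLs)
  obtain ⟨C₂, hC₂⟩ := hL.exists_bound_of_continuousOn (h2.continuousOn.mono hLs)
  refine ⟨max C₀ (max C₁ C₂), fun y hy => ⟨(hC₀ y hy).trans (le_max_left _ _), fun hn => ?_⟩⟩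
  have e1 : fderivWithin ℝ h s =ᶠ[𝓝 y] fderiv ℝ h := by
    filter_upwards [eventually_mem_nhds_iff.mpr hn] with z hz using fderivWithin_of_mem_nhds hz
  constructor
  · rw [← fderivWithin_of_mem_nhds hn]
    exact (hC₁ y hy).trans ((le_max_left _ _).trans (le_max_right _ _))
  · rw [← e1.fderiv_eq, ← fderivWithin_of_mem_nhds hn]
    exact (hC₂ y hy).trans ((le_max_right _ _).trans (le_max_right _ _))

end Bounds

section HessCLM

variable {E : Type*} [NormedAddCommGroup E] [NormedSpace ℝ E]

/-- `hessForm` as a continuous bilinear form. -/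
def hessCLM (B : E → E →L[ℝ] E →L[ℝ] E) (X : E → E →L[ℝ] E →L[ℝ] ℝ) (v : E → ℝ) (y : E) :
    E →L[ℝ] E →L[ℝ] ℝ :=
  fderiv ℝ (fderiv ℝ v) y - (ContinuousLinearMap.compL ℝ E E ℝ (fderiv ℝ v y)).comp (B y) + X y

lemma hessCLM_apply (B : E → E →L[ℝ] E →L[ℝ] E) (X : E → E →L[ℝ] E →L[ℝ] ℝ) (v : E → ℝ)
    (y e e' : E) : hessCLM B X v y e e' = hessForm B X v y e e' := rfl

end HessCLM

section ChartForms

open Filter Topology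

variable {n : ℕ} [NeZero n] {M : Type*} [TopologicalSpace M]
  [ChartedSpace (EuclideanHalfSpace n) M]

lemma target_mem_nhds_of_mem_interior [IsManifold (𝓡∂ n) ∞ M] {c : M}
    {y : EuclideanSpace ℝ (Fin n)}
    (hy : y ∈ (extChartAt (𝓡∂ n) c).target)
    (hint : (extChartAt (𝓡∂ n) c).symm y ∈ (𝓡∂ n).interior M) :
    (extChartAt (𝓡∂ n) c).target ∈ 𝓝 y := by
  have h := (ModelWithCorners.isInteriorPoint_iff_of_mem_atlas (I := 𝓡∂ n) (n := ∞) (by simp)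
    (chart_mem_atlas (EuclideanHalfSpace n) c) (mem_source_of_mem_target hy)).mp hint
  have e : (chartAt (EuclideanHalfSpace n) c).extend (𝓡∂ n) = extChartAt (𝓡∂ n) c := rfl
  rw [e, (extChartAt (𝓡∂ n) c).right_inv hy] at h
  exact mem_interior_iff_mem_nhds.mp h

lemma interior_of_target_mem_nhds [IsManifold (𝓡∂ n) ∞ M] {c : M}
    {y : EuclideanSpace ℝ (Fin n)} (hy : (extChartAt (𝓡∂ n) c).target ∈ 𝓝 y) :
    (extChartAt (𝓡∂ n) c).symm y ∈ (𝓡∂ n).interior M := by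
  have hy' := mem_of_mem_nhds hy
  refine (ModelWithCorners.isInteriorPoint_iff_of_mem_atlas (I := 𝓡∂ n) (n := ∞) (by simp)
    (chart_mem_atlas (EuclideanHalfSpace n) c) (mem_source_of_mem_target hy')).mpr ?_
  have e : (chartAt (EuclideanHalfSpace n) c).extend (𝓡∂ n) = extChartAt (𝓡∂ n) c := rfl
  rw [e, (extChartAt (𝓡∂ n) c).right_inv hy']
  exact mem_interior_iff_mem_nhds.mpr hy

lemma range_mem_nhds {c : M} {y : EuclideanSpace ℝ (Fin n)}
    (hy : (extChartAt (𝓡∂ n) c).target ∈ 𝓝 y) : Set.range (𝓡∂ n) ∈ 𝓝 y :=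
  Filter.mem_of_superset hy (extChartAt_target_subset_range c)

lemma coordDeriv_eq_fderiv {c : M} {y : EuclideanSpace ℝ (Fin n)}
    (hy : (extChartAt (𝓡∂ n) c).target ∈ 𝓝 y) (i : Fin n) (h : EuclideanSpace ℝ (Fin n) → ℝ) :
    coordDeriv i h y = fderiv ℝ h y (EuclideanSpace.single i 1) := by
  rw [coordDeriv, fderivWithin_of_mem_nhds (range_mem_nhds hy)]

lemma coordDeriv_coordDeriv_eq {c : M} {y : EuclideanSpace ℝ (Fin n)}
    (hy : (extChartAt (𝓡∂ n) c).target ∈ 𝓝 y) (i j : Fin n) {h : EuclideanSpace ℝ (Fin n) → ℝ}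
    (hh : ContDiffAt ℝ 2 h y) :
    coordDeriv i (coordDeriv j h) y
      = fderiv ℝ (fderiv ℝ h) y (EuclideanSpace.single i 1) (EuclideanSpace.single j 1) := by
  have h1 : DifferentiableAt ℝ (fderiv ℝ h) y :=
    (hh.fderiv_right (m := 1) (by norm_num)).differentiableAt (by simp)
  have h2 : coordDeriv j h =ᶠ[𝓝 y] fun z => fderiv ℝ h z (EuclideanSpace.single j 1) := by
    filter_upwards [eventually_mem_nhds_iff.mpr hy] with z hz using coordDeriv_eq_fderiv hz j h
  rw [coordDeriv_eq_fderiv hy, h2.fderiv_eq]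
  have h3 := h1.hasFDerivAt.clm_apply (hasFDerivAt_const (EuclideanSpace.single j (1 : ℝ)) y)
  rw [h3.fderiv]
  simp

variable [IsManifold (𝓡∂ n) ∞ M] (g : Metric n M) (χ : SymmetricTensor n M)

/-- The metric in a chart, as a field of bilinear forms. -/
def metricForm (c : M) (y : EuclideanSpace ℝ (Fin n)) :
    EuclideanSpace ℝ (Fin n) →L[ℝ] EuclideanSpace ℝ (Fin n) →L[ℝ] ℝ :=
  matrixForm (metricCoord g c y)

/-- The tensor `χ` in a chart, as a field of bilinear forms. -/
def tensorChart (c : M) (y : EuclideanSpace ℝ (Fin n)) :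
    EuclideanSpace ℝ (Fin n) →L[ℝ] EuclideanSpace ℝ (Fin n) →L[ℝ] ℝ :=
  matrixForm (coordTensor χ.form c y)

/-- The Christoffel symbols in a chart, as a field of bilinear maps. -/
def christoffelForm (c : M) (y : EuclideanSpace ℝ (Fin n)) :
    EuclideanSpace ℝ (Fin n) →L[ℝ] EuclideanSpace ℝ (Fin n) →L[ℝ] EuclideanSpace ℝ (Fin n) :=
  tensorForm fun k i j => christoffel g c k i j y

lemma contDiffOn_metricForm (c : M) :
    ContDiffOn ℝ ∞ (metricForm g c) (extChartAt (𝓡∂ n) c).target :=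
  contDiffOn_matrixForm (contDiffOn_metricCoord g c)

lemma contDiffOn_tensorChart (c : M) :
    ContDiffOn ℝ ∞ (tensorChart χ c) (extChartAt (𝓡∂ n) c).target :=
  contDiffOn_matrixForm (contDiffOn_coordTensor χ.smooth c)

lemma contDiffOn_christoffelForm (c : M) :
    ContDiffOn ℝ ∞ (christoffelForm g c) (extChartAt (𝓡∂ n) c).target := by
  change ContDiffOn ℝ ∞ (fun y => tensorForm fun k i j => christoffel g c k i j y) _
  simp only [tensorForm]
  exact ContDiffOn.sum fun i _ => ContDiffOn.sum fun j _ => ContDiffOn.sum fun k _ =>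
    (contDiffOn_christoffel g c k i j).smul contDiffOn_const

lemma hessForm_single {c : M} {y : EuclideanSpace ℝ (Fin n)}
    (hy : (extChartAt (𝓡∂ n) c).target ∈ 𝓝 y) {v : M → ℝ}
    (hv : ContDiffAt ℝ 2 (coordFun v c) y) (i j : Fin n) :
    hessForm (christoffelForm g c) (tensorChart χ c) (coordFun v c) y
      (EuclideanSpace.single i 1) (EuclideanSpace.single j 1)
      = (hessianCoord g v c y + coordTensor χ.form c y) i j := by
  rw [hessForm, Matrix.add_apply, hessianCoord, Matrix.of_apply, coordDeriv_coordDeriv_eq hy i j hv,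
    tensorChart, matrixForm_single, christoffelForm, tensorForm_single, map_sum]
  simp only [map_smul, smul_eq_mul, coordDeriv_eq_fderiv hy]

lemma frameMatrix_hessForm {c : M} {y : EuclideanSpace ℝ (Fin n)}
    (hy : (extChartAt (𝓡∂ n) c).target ∈ 𝓝 y) {v : M → ℝ}
    (hv : ContDiffAt ℝ 2 (coordFun v c) y) (P : Matrix (Fin n) (Fin n) ℝ) :
    frameMatrix (columns P) (hessForm (christoffelForm g c) (tensorChart χ c) (coordFun v c) y)
      = Pᵀ * (hessianCoord g v c y + coordTensor χ.form c y) * P := by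
  have h := frameMatrix_columns P (hessCLM (christoffelForm g c) (tensorChart χ c) (coordFun v c) y)
  simp only [hessCLM_apply] at h
  rw [show (hessForm (christoffelForm g c) (tensorChart χ c) (coordFun v c) y) = fun e e' =>
    hessForm (christoffelForm g c) (tensorChart χ c) (coordFun v c) y e e' from rfl, h]
  congr 2
  ext i j
  exact hessForm_single g χ hy hv i j

/-- Changing to the frame given by the columns of an invertible matrix does not change the
eigenvalues. -/
lemma isEigenvalueList_frame {c : M} {y : EuclideanSpace ℝ (Fin n)}
    (hy : (extChartAt (𝓡∂ n) c).target ∈ 𝓝 y) {v : M → ℝ}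
    (hv : ContDiffAt ℝ 2 (coordFun v c) y) {P : Matrix (Fin n) (Fin n) ℝ} (hP : IsUnit P.det)
    {lam : Fin n → ℝ} (h : IsEigenvalueList (metricCoord g c y)
      (hessianCoord g v c y + coordTensor χ.form c y) lam) :
    IsEigenvalueList (frameMatrix (columns P) fun e e' => metricForm g c y e e')
      (frameMatrix (columns P)
        (hessForm (christoffelForm g c) (tensorChart χ c) (coordFun v c) y)) lam := by
  rw [frameMatrix_hessForm g χ hy hv, metricForm, frameMatrix_matrixForm]
  exact h.conj hP

end ChartForms

/-! ### The squared gradient -/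

section GradSq

open Filter Topology

variable {n : ℕ} [NeZero n] {M : Type*} [TopologicalSpace M]
  [ChartedSpace (EuclideanHalfSpace n) M] [IsManifold (𝓡∂ n) ∞ M] (g : Metric n M)

/-- `|∇v|²` at the point with coordinates `y` in the chart centred at `c`. -/
def gradSq (v : M → ℝ) (c : M) (y : EuclideanSpace ℝ (Fin n)) : ℝ :=
  ∑ i, ∑ j, (metricCoord g c y)⁻¹ i j * coordDeriv i (coordFun v c) y * coordDeriv j (coordFun v c) y

lemma gradSq_eq_dotProduct (v : M → ℝ) (c : M) (y : EuclideanSpace ℝ (Fin n)) :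
    gradSq g v c y = (fun i => coordDeriv i (coordFun v c) y) ⬝ᵥ
      ((metricCoord g c y)⁻¹ *ᵥ fun i => coordDeriv i (coordFun v c) y) := by
  simp only [gradSq, dotProduct, Matrix.mulVec, Finset.mul_sum]
  exact Finset.sum_congr rfl fun i _ => Finset.sum_congr rfl fun j _ => by ring

/-- The differential of a function at a point of `M`. -/
def differential (v : M → ℝ) (x : M) : TangentSpace (𝓡∂ n) x →L[ℝ] ℝ := mfderiv (𝓡∂ n) 𝓘(ℝ, ℝ) v x

lemma dotProduct_coordDeriv {v : M → ℝ} (hv : MDifferentiable (𝓡∂ n) 𝓘(ℝ, ℝ) v) {c : M}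
    {y : EuclideanSpace ℝ (Fin n)} (hy : y ∈ (extChartAt (𝓡∂ n) c).target) (a : Fin n → ℝ) :
    (fun i => coordDeriv i (coordFun v c) y) ⬝ᵥ a
      = differential v ((extChartAt (𝓡∂ n) c).symm y) (coordCombo c y a) := by
  have hr : y ∈ Set.range (𝓡∂ n) := extChartAt_target_subset_range c hy
  have h1 := mfderiv_comp_mfderivWithin (I := 𝓘(ℝ, EuclideanSpace ℝ (Fin n))) (I' := 𝓡∂ n)
    (I'' := 𝓘(ℝ, ℝ)) (s := Set.range (𝓡∂ n)) y (hv ((extChartAt (𝓡∂ n) c).symm y))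
    (mdifferentiableWithinAt_extChartAt_symm (I := 𝓡∂ n) hy)
    ((𝓡∂ n).uniqueDiffOn _ hr).uniqueMDiffWithinAt
  rw [mfderivWithin_eq_fderivWithin] at h1
  have h2 : ∀ i, coordDeriv i (coordFun v c) y
      = differential v ((extChartAt (𝓡∂ n) c).symm y) (coordVector c i y) :=
    fun i => congrArg (fun L : EuclideanSpace ℝ (Fin n) →L[ℝ] ℝ => L (EuclideanSpace.single i 1)) h1
  rw [coordCombo_eq, map_sum, dotProduct]
  refine Finset.sum_congr rfl fun i _ => ?_
  rw [map_smul, h2, smul_eq_mul, mul_comm]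

/-- The squared gradient is the maximum over all tangent vectors `V` of `2 dv(V) - g(V, V)`; the
chart does not occur in this description. -/
lemma isGreatest_gradSq {v : M → ℝ} (hv : MDifferentiable (𝓡∂ n) 𝓘(ℝ, ℝ) v) {c : M}
    {y : EuclideanSpace ℝ (Fin n)} (hy : y ∈ (extChartAt (𝓡∂ n) c).target) {x : M}
    (hx : (extChartAt (𝓡∂ n) c).symm y = x) :
    IsGreatest (Set.range fun V : TangentSpace (𝓡∂ n) x =>
      2 * differential v x V - g.inner x V V) (gradSq g v c y) := by
  subst hx
  have h := two_mul_dotProduct_sub_le (metricCoord_posDef g c hy)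
    fun i => coordDeriv i (coordFun v c) y
  constructor
  · refine ⟨coordCombo c y ((metricCoord g c y)⁻¹ *ᵥ fun i => coordDeriv i (coordFun v c) y), ?_⟩
    dsimp only
    rw [inner_coordCombo, ← dotProduct_coordDeriv hv hy, (h 0).2, gradSq_eq_dotProduct]
  · rintro _ ⟨V, rfl⟩
    obtain ⟨a, rfl⟩ := coordCombo_surjective c hy V
    dsimp only
    rw [inner_coordCombo, ← dotProduct_coordDeriv hv hy, gradSq_eq_dotProduct]
    exact (h a).1

/-- `|∇v|²` at a point of `M`, computed in the chart centred there. -/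
def gradSqAt (v : M → ℝ) (x : M) : ℝ := gradSq g v x (extChartAt (𝓡∂ n) x x)

lemma gradSqAt_symm {v : M → ℝ} (hv : MDifferentiable (𝓡∂ n) 𝓘(ℝ, ℝ) v) {c : M}
    {y : EuclideanSpace ℝ (Fin n)} (hy : y ∈ (extChartAt (𝓡∂ n) c).target) :
    gradSqAt g v ((extChartAt (𝓡∂ n) c).symm y) = gradSq g v c y :=
  (isGreatest_gradSq g hv (mem_extChartAt_target _) (extChartAt_to_inv _)).unique
    (isGreatest_gradSq g hv hy rfl)

lemma gradSq_nonneg (v : M → ℝ) {c : M} {y : EuclideanSpace ℝ (Fin n)}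
    (hy : y ∈ (extChartAt (𝓡∂ n) c).target) : 0 ≤ gradSq g v c y := by
  have h := (two_mul_dotProduct_sub_le (metricCoord_posDef g c hy)
    (fun i => coordDeriv i (coordFun v c) y) 0).1
  rw [gradSq_eq_dotProduct]
  simpa using h

section InteriorPoint

variable {v : M → ℝ} {c : M} {y : EuclideanSpace ℝ (Fin n)}

lemma two_mul_fderiv_sub_le_gradSq (hy : (extChartAt (𝓡∂ n) c).target ∈ 𝓝 y)
    (V : EuclideanSpace ℝ (Fin n)) :
    2 * fderiv ℝ (coordFun v c) y V - metricForm g c y V V ≤ gradSq g v c y := by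
  have h := (two_mul_dotProduct_sub_le (metricCoord_posDef g c (mem_of_mem_nhds hy))
    (fun i => coordDeriv i (coordFun v c) y) V.ofLp).1
  rw [gradSq_eq_dotProduct]
  refine le_trans (le_of_eq ?_) h
  have e : V = ∑ i, V i • EuclideanSpace.single i (1 : ℝ) := by
    ext j
    simp [Pi.single_apply]
  congr 1
  · conv_lhs => rw [e]
    simp only [map_sum, map_smul, smul_eq_mul, dotProduct, coordDeriv_eq_fderiv hy]
    congr 1
    exact Finset.sum_congr rfl fun i _ => mul_comm _ _
  · simp only [metricForm, matrixForm_apply, dotProduct, Matrix.mulVec, Finset.mul_sum]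
    exact Finset.sum_congr rfl fun i _ => Finset.sum_congr rfl fun j _ => by ring

lemma gradSq_eq_sum_sq (hy : (extChartAt (𝓡∂ n) c).target ∈ 𝓝 y)
    {P : Matrix (Fin n) (Fin n) ℝ} (hP : Pᵀ * metricCoord g c y * P = 1) :
    gradSq g v c y = ∑ k, fderiv ℝ (coordFun v c) y (columns P k) ^ 2 := by
  rw [← sum_inv_mul_eq_sum_sq hP, gradSq]
  simp only [coordDeriv_eq_fderiv hy]

lemma norm_fderiv_le_of_gradSq (hy : (extChartAt (𝓡∂ n) c).target ∈ 𝓝 y) {a m : ℝ}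
    (ha : gradSq g v c y ≤ a) (hm : ‖metricForm g c y‖ ≤ m) :
    ‖fderiv ℝ (coordFun v c) y‖ ≤ (a + m) / 2 := by
  have h0 := gradSq_nonneg g v (mem_of_mem_nhds hy)
  have hm0 := (norm_nonneg _).trans hm
  have key : ∀ V : EuclideanSpace ℝ (Fin n), ‖V‖ = 1 → fderiv ℝ (coordFun v c) y V ≤ (a + m) / 2 := by
    intro V hV
    have h1 := two_mul_fderiv_sub_le_gradSq g (v := v) hy V
    have h2 := (le_abs_self _).trans (abs_apply₂_le (metricForm g c y) V V)
    rw [hV] at h2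
    linarith
  refine ContinuousLinearMap.opNorm_le_of_unit_norm (by linarith) fun V hV => ?_
  refine abs_le.mpr ⟨?_, key V hV⟩
  have := key (-V) (by rwa [norm_neg])
  rw [map_neg] at this
  linarith

end InteriorPoint

lemma norm_frameGrad_le {E : Type*} [NormedAddCommGroup E] [NormedSpace ℝ E] {v : E → ℝ}
    {p : Fin n → E} {y₀ : E} {a m : ℝ} (ha : ‖fderiv ℝ v y₀‖ ≤ a) (hm : ∀ i, ‖p i‖ ≤ m) :
    ‖frameGrad v p y₀‖ ≤ n * (a * m * m) := by
  have hm0 : 0 ≤ m := (norm_nonneg _).trans (hm 0)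
  refine (norm_sum_le _ _).trans ?_
  refine (Finset.sum_le_card_nsmul _ _ (a * m * m) fun k _ => ?_).trans (by simp)
  rw [norm_smul]
  exact mul_le_mul (abs_apply_le_of_bounds ha (hm k)) (hm k) (norm_nonneg _)
    (mul_nonneg ((norm_nonneg _).trans ha) hm0)

end GradSq

/-! ### Interchange of space and time derivatives -/

section Swap

open Filter Topology

/-- If `∂_s∂_t w` exists near a point and is continuous there, then `∂_s w` can be differentiated
in time at this point, from one side. -/
lemma hasDerivWithinAt_partial {w wt φ : ℝ → ℝ → ℝ} {dw : ℝ → ℝ} {t₀ r : ℝ} (hr : 0 < r)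
    (hw : ∀ s ∈ Metric.ball (0 : ℝ) r, ∀ t ∈ Set.Icc (t₀ - r) t₀,
      HasDerivWithinAt (w s) (wt s t) (Set.Icc (t₀ - r) t₀) t)
    (hwt : ∀ s ∈ Metric.ball (0 : ℝ) r, ∀ t ∈ Set.Icc (t₀ - r) t₀,
      HasDerivAt (fun s => wt s t) (φ s t) s)
    (hφ : ContinuousWithinAt (fun q : ℝ × ℝ => φ q.1 q.2)
      (Metric.ball 0 r ×ˢ Set.Icc (t₀ - r) t₀) (0, t₀))
    (hdw : ∀ t ∈ Set.Icc (t₀ - r) t₀, HasDerivAt (fun s => w s t) (dw t) 0) :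
    HasDerivWithinAt dw (φ 0 t₀) (Set.Iic t₀) t₀ := by
  rw [hasDerivWithinAt_iff_isLittleO, Asymptotics.isLittleO_iff]
  intro ε hε
  obtain ⟨ρ, hρ, hρε⟩ := Metric.continuousWithinAt_iff.mp hφ ε hε
  set d := min (ρ / 2) r with hd
  have hd0 : 0 < d := lt_min (by positivity) hr
  have hdr : d ≤ r := min_le_right _ _
  have hdρ : d < ρ := (min_le_left _ _).trans_lt (by linarith)
  have hb : ∀ s ∈ Metric.ball (0 : ℝ) d, ∀ t ∈ Set.Icc (t₀ - d) t₀, ‖φ s t - φ 0 t₀‖ ≤ ε := by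
    intro s hs t ht
    rw [Metric.mem_ball] at hs
    have := @hρε (s, t) ⟨Metric.mem_ball.mpr (hs.trans_le hdr),
      ⟨by linarith [ht.1], ht.2⟩⟩ (by
        rw [Prod.dist_eq, max_lt_iff]
        refine ⟨hs.trans hdρ, ?_⟩
        rw [Real.dist_eq, abs_lt]
        constructor <;> linarith [ht.1, ht.2])
    rw [Real.dist_eq] at this
    exact this.le
  filter_upwards [Icc_mem_nhdsLE (show t₀ - d < t₀ by linarith)] with t ht
  have ht' : t ∈ Set.Icc (t₀ - r) t₀ := ⟨by linarith [ht.1], ht.2⟩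
  have ht₀ : t₀ ∈ Set.Icc (t₀ - r) t₀ := ⟨by linarith, le_rfl⟩
  have hζ : HasDerivAt (fun s => w s t - w s t₀ - s * ((t - t₀) * φ 0 t₀))
      (dw t - dw t₀ - (t - t₀) • φ 0 t₀) 0 := by
    have := ((hdw t ht').sub (hdw t₀ ht₀)).sub
      ((hasDerivAt_id (0 : ℝ)).mul_const ((t - t₀) * φ 0 t₀))
    exact this.congr_deriv (by simp)
  refine hζ.le_of_lip' (by positivity) ?_
  filter_upwards [Metric.ball_mem_nhds (0 : ℝ) hd0] with s hs
  have hs' : s ∈ Metric.ball (0 : ℝ) r := Metric.ball_subset_ball hdr hs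
  have h0' : (0 : ℝ) ∈ Metric.ball (0 : ℝ) r := Metric.mem_ball_self hr
  -- the mean value theorem in `t`, with the derivative bounded by the mean value theorem in `s`
  have hη : ∀ τ ∈ Set.Icc (t₀ - d) t₀, HasDerivWithinAt
      (fun τ => w s τ - w 0 τ - τ * (s * φ 0 t₀)) (wt s τ - wt 0 τ - s * φ 0 t₀)
      (Set.Icc (t₀ - d) t₀) τ := by
    intro τ hτ
    have hτ' : τ ∈ Set.Icc (t₀ - r) t₀ := ⟨by linarith [hτ.1], hτ.2⟩
    have := (((hw s hs' τ hτ').sub (hw 0 h0' τ hτ')).sub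
      ((hasDerivWithinAt_id τ _).mul_const (s * φ 0 t₀))).mono
      (Set.Icc_subset_Icc_left (show t₀ - r ≤ t₀ - d by linarith))
    exact this.congr_deriv (by simp)
  have hηb : ∀ τ ∈ Set.Icc (t₀ - d) t₀, ‖wt s τ - wt 0 τ - s * φ 0 t₀‖ ≤ ε * ‖s‖ := by
    intro τ hτ
    have hτ' : τ ∈ Set.Icc (t₀ - r) t₀ := ⟨by linarith [hτ.1], hτ.2⟩
    have h1 : ∀ σ ∈ Metric.ball (0 : ℝ) d, HasDerivWithinAt (fun σ => wt σ τ - σ * φ 0 t₀)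
        (φ σ τ - φ 0 t₀) (Metric.ball 0 d) σ := by
      intro σ hσ
      have := ((hwt σ (Metric.ball_subset_ball hdr hσ) τ hτ').sub
        ((hasDerivAt_id σ).mul_const (φ 0 t₀))).hasDerivWithinAt (s := Metric.ball 0 d)
      exact this.congr_deriv (by simp)
    have := (convex_ball (0 : ℝ) d).norm_image_sub_le_of_norm_hasDerivWithin_le h1
      (fun σ hσ => hb σ hσ τ hτ) (Metric.mem_ball_self hd0) hs
    simp only [zero_mul, sub_zero] at this
    rwa [sub_right_comm] at this
  have := (convex_Icc (t₀ - d) t₀).norm_image_sub_le_of_norm_hasDerivWithin_le hη hηb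
    (show t₀ ∈ Set.Icc (t₀ - d) t₀ from ⟨by linarith, le_rfl⟩) ht
  calc _ = ‖w s t - w 0 t - t * (s * φ 0 t₀) - (w s t₀ - w 0 t₀ - t₀ * (s * φ 0 t₀))‖ := by
        congr 1; ring
    _ ≤ ε * ‖s‖ * ‖t - t₀‖ := this
    _ = _ := by rw [sub_zero]; ring

end Swap

/-! ### Functions on the space-time cylinder -/

section Cylinder

open Filter Topology

lemma mem_timeInterval_of_le {T : EReal} {s t : ℝ} (ht : t ∈ timeInterval T) (h0 : 0 ≤ s)
    (hst : s ≤ t) : s ∈ timeInterval T :=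
  ⟨h0, (EReal.coe_le_coe_iff.mpr hst).trans ht.2⟩

lemma convex_timeInterval (T : EReal) : Convex ℝ (timeInterval T) := by
  rw [convex_iff_ordConnected]
  exact ⟨fun x hx y hy z hz => mem_timeInterval_of_le hy (hx.1.trans hz.1) hz.2⟩

lemma timeInterval_mem_nhdsLE {T : EReal} {t : ℝ} (ht : t ∈ timeInterval T) (h0 : 0 < t) :
    timeInterval T ∈ 𝓝[Set.Iic t] t :=
  mem_of_superset (Icc_mem_nhdsLE h0) fun _ hs => mem_timeInterval_of_le ht hs.1 hs.2

variable {n : ℕ} [NeZero n] {M : Type*} [TopologicalSpace M]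
  [ChartedSpace (EuclideanHalfSpace n) M] {T : EReal} {k : ℕ} {u : M → ℝ → ℝ}

lemma continuousOn_of_charts {F : M → ℝ → ℝ} {J : Set ℝ}
    (h : ∀ c : M, ContinuousOn (fun p : EuclideanSpace ℝ (Fin n) × ℝ =>
      F ((extChartAt (𝓡∂ n) c).symm p.1) p.2) ((extChartAt (𝓡∂ n) c).target ×ˢ J)) :
    ContinuousOn (fun p : M × ℝ => F p.1 p.2) (Set.univ ×ˢ J) := by
  rintro ⟨x, t⟩ ⟨-, ht⟩
  have h1 : ContinuousOn (fun p : M × ℝ => (extChartAt (𝓡∂ n) x p.1, p.2))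
      ((extChartAt (𝓡∂ n) x).source ×ˢ J) :=
    ((continuousOn_extChartAt x).comp continuousOn_fst fun p hp => hp.1).prodMk continuousOn_snd
  have h2 := (h x).comp h1 fun p hp => ⟨(extChartAt (𝓡∂ n) x).map_source hp.1, hp.2⟩
  have h3 : ContinuousOn (fun p : M × ℝ => F p.1 p.2) ((extChartAt (𝓡∂ n) x).source ×ˢ J) :=
    h2.congr fun p hp => by
      simp only [Function.comp_apply, (extChartAt (𝓡∂ n) x).left_inv hp.1]
  refine (h3 (x, t) ⟨mem_extChartAt_source x, ht⟩).mono_of_mem_nhdsWithin ?_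
  rw [nhdsWithin_prod_eq]
  exact prod_mem_prod (mem_nhdsWithin_of_mem_nhds (extChartAt_source_mem_nhds x))
    self_mem_nhdsWithin

namespace IsParabolicC

variable (hu : IsParabolicC n k T u)
include hu

lemma hasDerivWithinAt_timeDeriv (hk : 2 ≤ k) (x : M) {t : ℝ} (ht : t ∈ timeInterval T) :
    HasDerivWithinAt (u x) (timeDeriv T u x t) (timeInterval T) t := by
  refine ((hu.time x).differentiableOn ?_ t ht).hasDerivWithinAt
  have : k / 2 ≠ 0 := by omega
  exact_mod_cast this

lemma abs_sub_sub_le_of_timeDeriv (hk : 2 ≤ k) (x : M) {s t a ε : ℝ} (hs : s ∈ timeInterval T)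
    (ht : t ∈ timeInterval T) (ha : ∀ τ ∈ Set.uIcc s t, |timeDeriv T u x τ - a| ≤ ε) :
    |u x t - u x s - (t - s) * a| ≤ ε * |t - s| := by
  have hsub : Set.uIcc s t ⊆ timeInterval T :=
    (convex_iff_ordConnected.mp (convex_timeInterval T)).uIcc_subset hs ht
  have hd : ∀ τ ∈ Set.uIcc s t, HasDerivWithinAt (fun τ => u x τ - τ * a)
      (timeDeriv T u x τ - a) (Set.uIcc s t) τ := fun τ hτ =>
    (((hu.hasDerivWithinAt_timeDeriv hk x (hsub hτ)).mono hsub).sub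
      ((hasDerivWithinAt_id τ _).mul_const a)).congr_deriv (by simp)
  have := (convex_uIcc s t).norm_image_sub_le_of_norm_hasDerivWithin_le hd ha
    Set.left_mem_uIcc Set.right_mem_uIcc
  rw [show u x t - u x s - (t - s) * a = u x t - t * a - (u x s - s * a) by ring]
  exact this

lemma abs_sub_le_of_timeDeriv (hk : 2 ≤ k) (x : M) {s t a : ℝ} (hs : s ∈ timeInterval T)
    (ht : t ∈ timeInterval T) (ha : ∀ τ ∈ Set.uIcc s t, |timeDeriv T u x τ| ≤ a) :
    |u x t - u x s| ≤ a * |t - s| := by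
  have := hu.abs_sub_sub_le_of_timeDeriv hk x hs ht (a := 0) (by simpa using ha)
  simpa using this

lemma contMDiff_slice {t : ℝ} (ht : t ∈ timeInterval T) :
    ContMDiff (𝓡∂ n) 𝓘(ℝ, ℝ) (k : ℕ∞ω) (fun x => u x t) := by
  have := hu.space 0 (by omega) t ht
  simpa using this

lemma contMDiff_timeDeriv (hk : 2 ≤ k) {t : ℝ} (ht : t ∈ timeInterval T) :
    ContMDiff (𝓡∂ n) 𝓘(ℝ, ℝ) ((k - 2 : ℕ) : ℕ∞ω) (fun x => timeDeriv T u x t) := by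
  have := hu.space 1 (by omega) t ht
  simp only [iteratedDerivWithin_one, mul_one] at this
  exact this

lemma continuousOn_iterated {r : ℕ} (hr : 2 * r ≤ k) (c : M) :
    ContinuousOn (fun p : EuclideanSpace ℝ (Fin n) × ℝ => iteratedDerivWithin r
      (u ((extChartAt (𝓡∂ n) c).symm p.1)) (timeInterval T) p.2)
      ((extChartAt (𝓡∂ n) c).target ×ˢ timeInterval T) := by
  have h := hu.continuous r 0 (by omega) c
  have he : Continuous fun m : ContinuousMultilinearMap ℝ
      (fun _ : Fin 0 => EuclideanSpace ℝ (Fin n)) ℝ => m ![] := by fun_prop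
  exact he.comp_continuousOn h

lemma continuousOn_fderivWithin {r : ℕ} (hr : 1 + 2 * r ≤ k) (c : M)
    (e : EuclideanSpace ℝ (Fin n)) :
    ContinuousOn (fun p : EuclideanSpace ℝ (Fin n) × ℝ => fderivWithin ℝ
      (fun y => iteratedDerivWithin r (u ((extChartAt (𝓡∂ n) c).symm y)) (timeInterval T) p.2)
        (Set.range (𝓡∂ n)) p.1 e)
      ((extChartAt (𝓡∂ n) c).target ×ˢ timeInterval T) := by
  have h := hu.continuous r 1 hr c
  have he : Continuous fun m : ContinuousMultilinearMap ℝ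
      (fun _ : Fin 1 => EuclideanSpace ℝ (Fin n)) ℝ => m ![e] := by fun_prop
  refine (he.comp_continuousOn h).congr fun p hp => ?_
  have hp' : p.1 ∈ Set.range (𝓡∂ n) := extChartAt_target_subset_range c hp.1
  rw [Function.comp_apply, iteratedFDerivWithin_one_apply ((𝓡∂ n).uniqueDiffOn _ hp')]
  rfl

lemma continuousOn_uncurry :
    ContinuousOn (fun p : M × ℝ => u p.1 p.2) (Set.univ ×ˢ timeInterval T) := by
  refine continuousOn_of_charts (n := n) fun c => ?_
  have := hu.continuousOn_iterated (r := 0) (by omega) c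
  simpa using this

lemma continuousOn_timeDeriv (hk : 2 ≤ k) :
    ContinuousOn (fun p : M × ℝ => timeDeriv T u p.1 p.2) (Set.univ ×ˢ timeInterval T) := by
  refine continuousOn_of_charts (n := n) fun c => ?_
  have := hu.continuousOn_iterated (r := 1) (by omega) c
  simp only [iteratedDerivWithin_one] at this
  exact this

lemma mdifferentiable (hk : 1 ≤ k) {t : ℝ} (ht : t ∈ timeInterval T) :
    MDifferentiable (𝓡∂ n) 𝓘(ℝ, ℝ) (fun x => u x t) :=
  (hu.contMDiff_slice ht).mdifferentiable (by exact_mod_cast (by omega : k ≠ 0))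

end IsParabolicC

variable [IsManifold (𝓡∂ n) ∞ M]

lemma contDiffOn_coordFun {v : M → ℝ} {k : ℕ} (hv : ContMDiff (𝓡∂ n) 𝓘(ℝ, ℝ) (k : ℕ∞ω) v) (c : M) :
    ContDiffOn ℝ (k : ℕ∞ω) (coordFun v c) (extChartAt (𝓡∂ n) c).target := by
  have h1 : ContMDiffOn 𝓘(ℝ, EuclideanSpace ℝ (Fin n)) (𝓡∂ n) (k : ℕ∞ω)
      (extChartAt (𝓡∂ n) c).symm (extChartAt (𝓡∂ n) c).target :=
    (contMDiffOn_extChartAt_symm (n := ∞) c).of_le (by exact_mod_cast le_top)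
  exact contMDiffOn_iff_contDiffOn.mp (hv.comp_contMDiffOn h1)

namespace IsParabolicC

lemma contDiffAt_coordFun (hu : IsParabolicC n k T u) {t : ℝ} (ht : t ∈ timeInterval T) {c : M}
    {y : EuclideanSpace ℝ (Fin n)} (hy : (extChartAt (𝓡∂ n) c).target ∈ 𝓝 y) :
    ContDiffAt ℝ (k : ℕ∞ω) (coordFun (fun x => u x t) c) y :=
  (contDiffOn_coordFun (hu.contMDiff_slice ht) c).contDiffAt hy

lemma differentiableAt_timeDeriv (hu : IsParabolicC n k T u) (hk : 3 ≤ k) {t : ℝ}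
    (ht : t ∈ timeInterval T) {c : M} {y : EuclideanSpace ℝ (Fin n)}
    (hy : (extChartAt (𝓡∂ n) c).target ∈ 𝓝 y) :
    DifferentiableAt ℝ (coordFun (fun x => timeDeriv T u x t) c) y :=
  ((contDiffOn_coordFun (hu.contMDiff_timeDeriv (by omega) ht) c).contDiffAt hy).differentiableAt
    (by exact_mod_cast (by omega : k - 2 ≠ 0))

/-- At interior points the spatial derivatives of a function of class `C³` are differentiable in
time from below, with derivative `∇u_t`. -/
lemma hasDerivWithinAt_fderiv (hu : IsParabolicC n k T u) (hk : 3 ≤ k) {t₀ : ℝ}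
    (ht₀ : t₀ ∈ timeInterval T) (h0 : 0 < t₀) {c : M} {y₀ : EuclideanSpace ℝ (Fin n)}
    (hy : (extChartAt (𝓡∂ n) c).target ∈ 𝓝 y₀) (a : EuclideanSpace ℝ (Fin n)) :
    HasDerivWithinAt (fun t => fderiv ℝ (coordFun (fun x => u x t) c) y₀ a)
      (fderiv ℝ (coordFun (fun x => timeDeriv T u x t₀) c) y₀ a) (Set.Iic t₀) t₀ := by
  have hline : Continuous fun s : ℝ => y₀ + s • a := by fun_prop
  have hnear : ∀ᶠ s : ℝ in 𝓝 0, (extChartAt (𝓡∂ n) c).target ∈ 𝓝 (y₀ + s • a) := by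
    have h1 : ∀ᶠ y in 𝓝 (y₀ + (0 : ℝ) • a), (extChartAt (𝓡∂ n) c).target ∈ 𝓝 y := by
      simpa using eventually_mem_nhds_iff.mpr hy
    exact hline.continuousAt.eventually h1
  obtain ⟨r', hr', hball⟩ := Metric.eventually_nhds_iff_ball.mp hnear
  set r := min r' t₀ with hr
  have hr0 : 0 < r := lt_min hr' h0
  have hbr : ∀ s ∈ Metric.ball (0 : ℝ) r, (extChartAt (𝓡∂ n) c).target ∈ 𝓝 (y₀ + s • a) :=
    fun s hs => hball s (Metric.ball_subset_ball (min_le_left _ _) hs)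
  have hJ : Set.Icc (t₀ - r) t₀ ⊆ timeInterval T := fun t ht =>
    mem_timeInterval_of_le ht₀ (by linarith [ht.1, min_le_right r' t₀]) ht.2
  have hlineD : ∀ s : ℝ, HasDerivAt (fun s : ℝ => y₀ + s • a) a s := fun s => by
    simpa using ((hasDerivAt_id s).smul_const a).const_add y₀
  have key := hasDerivWithinAt_partial (t₀ := t₀)
    (w := fun s t => coordFun (fun x => u x t) c (y₀ + s • a))
    (wt := fun s t => coordFun (fun x => timeDeriv T u x t) c (y₀ + s • a))
    (φ := fun s t => fderiv ℝ (coordFun (fun x => timeDeriv T u x t) c) (y₀ + s • a) a)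
    (dw := fun t => fderiv ℝ (coordFun (fun x => u x t) c) y₀ a) hr0
    (fun s hs t ht => (hu.hasDerivWithinAt_timeDeriv (by omega) _ (hJ ht)).mono hJ)
    (fun s hs t ht => ?_) ?_ (fun t ht => ?_)
  · simpa using key
  · have := (hu.differentiableAt_timeDeriv hk (hJ ht)
      (hbr s hs)).hasFDerivAt.comp_hasDerivAt s (hlineD s)
    exact this
  · have h1 := hu.continuousOn_fderivWithin (r := 1) (by omega) c a
    have h2 : ContinuousOn (fun q : ℝ × ℝ => (y₀ + q.1 • a, q.2))
        (Metric.ball 0 r ×ˢ Set.Icc (t₀ - r) t₀) := by fun_prop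
    have h3 := h1.comp h2 fun q hq => ⟨mem_of_mem_nhds (hbr q.1 hq.1), hJ hq.2⟩
    refine (h3.congr fun q hq => ?_) (0, t₀) ⟨Metric.mem_ball_self hr0, by linarith, le_rfl⟩
    simp only [Function.comp_apply, iteratedDerivWithin_one]
    rw [fderivWithin_of_mem_nhds (range_mem_nhds (hbr q.1 hq.1))]
    rfl
  · have h1 : DifferentiableAt ℝ (coordFun (fun x => u x t) c) (y₀ + (0 : ℝ) • a) :=
      (hu.contDiffAt_coordFun (hJ ht) (hbr 0 (Metric.mem_ball_self hr0))).differentiableAt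
        (by exact_mod_cast (by omega : k ≠ 0))
    have := h1.hasFDerivAt.comp_hasDerivAt 0 (hlineD 0)
    exact this.congr_deriv (by simp)

lemma continuousOn_gradSqAt (hu : IsParabolicC n k T u) (hk : 1 ≤ k) (g : Metric n M) :
    ContinuousOn (fun p : M × ℝ => gradSqAt g (fun x => u x p.2) p.1)
      (Set.univ ×ˢ timeInterval T) := by
  refine continuousOn_of_charts (n := n) (F := fun x t => gradSqAt g (fun x => u x t) x) fun c => ?_
  have hd : ∀ i, ContinuousOn (fun p : EuclideanSpace ℝ (Fin n) × ℝ =>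
      coordDeriv i (coordFun (fun x => u x p.2) c) p.1)
      ((extChartAt (𝓡∂ n) c).target ×ˢ timeInterval T) := fun i => by
    have := hu.continuousOn_fderivWithin (r := 0) (by omega) c (EuclideanSpace.single i 1)
    simp only [iteratedDerivWithin_zero] at this
    exact this
  have hG : ∀ i j, ContinuousOn (fun p : EuclideanSpace ℝ (Fin n) × ℝ =>
      (metricCoord g c p.1)⁻¹ i j) ((extChartAt (𝓡∂ n) c).target ×ˢ timeInterval T) := fun i j =>
    (contDiffOn_metricCoord_inv g c i j).continuousOn.comp continuousOn_fst fun p hp => hp.1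
  refine ContinuousOn.congr (f := fun p : EuclideanSpace ℝ (Fin n) × ℝ =>
    gradSq g (fun x => u x p.2) c p.1) ?_ fun p hp => ?_
  · simp only [gradSq]
    exact continuousOn_finsetSum _ fun i _ => continuousOn_finsetSum _ fun j _ =>
      ((hG i j).mul (hd i)).mul (hd j)
  · exact gradSqAt_symm g (hu.mdifferentiable hk hp.2) hp.1

end IsParabolicC

end Cylinder

/-! ### Uniform bounds in charts -/

section UniformBounds

open Filter Topology

lemma PointBounds.mono {n : ℕ} {E : Type*} [NormedAddCommGroup E] [NormedSpace ℝ E]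
    {G X : E → E →L[ℝ] E →L[ℝ] ℝ} {B : E → E →L[ℝ] E →L[ℝ] E} {p : Fin n → E} {v : E → ℝ} {y₀ : E}
    {Λ Λ' : ℝ} (h : PointBounds G X B p v y₀ Λ) (hΛ : Λ ≤ Λ') : PointBounds G X B p v y₀ Λ' :=
  ⟨h.one_le.trans hΛ, fun i => (h.frame i).trans hΛ, h.dG.trans hΛ, h.ddG.trans hΛ,
    h.normX.trans hΛ, h.dX.trans hΛ, h.normB.trans hΛ, h.dB.trans hΛ, h.dv.trans hΛ,
    h.grad.trans hΛ⟩

variable {n : ℕ} [NeZero n] {M : Type*} [TopologicalSpace M]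
  [ChartedSpace (EuclideanHalfSpace n) M] [IsManifold (𝓡∂ n) ∞ M] (g : Metric n M)
  (χ : SymmetricTensor n M)

lemma exists_chart_bounds (A : ℝ) (c : M) {L : Set (EuclideanSpace ℝ (Fin n))} (hL : IsCompact L)
    (hLt : L ⊆ (extChartAt (𝓡∂ n) c).target) :
    ∃ Λ : ℝ, ∀ y ∈ L, (extChartAt (𝓡∂ n) c).target ∈ 𝓝 y → ∀ (P : Matrix (Fin n) (Fin n) ℝ)
      (v : M → ℝ), Pᵀ * metricCoord g c y * P = 1 → gradSq g v c y ≤ A →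
      PointBounds (metricForm g c) (tensorChart χ c) (christoffelForm g c) (columns P)
        (coordFun v c) y Λ := by
  have hU := uniqueDiffOn_extChartAt_target (I := 𝓡∂ n) c
  obtain ⟨CG, hG⟩ := exists_bound_fderiv hU (contDiffOn_metricForm g c) hL hLt
  obtain ⟨CX, hX⟩ := exists_bound_fderiv hU (contDiffOn_tensorChart χ c) hL hLt
  obtain ⟨CB, hB⟩ := exists_bound_fderiv hU (contDiffOn_christoffelForm g c) hL hLt
  have hinv : ContinuousOn (fun y => ∑ a, (metricCoord g c y)⁻¹ a a) L :=
    continuousOn_finsetSum _ fun a _ => (contDiffOn_metricCoord_inv g c a a).continuousOn.mono hLt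
  obtain ⟨CP, hP⟩ := hL.exists_bound_of_continuousOn hinv
  set p := √CP with hp
  set d := (A + CG) / 2 with hd
  set Λ := 1 ⊔ p ⊔ CG ⊔ CX ⊔ CB ⊔ d ⊔ (n * (d * p * p)) with hΛ
  have e7 : n * (d * p * p) ≤ Λ := le_sup_right
  have e6 : d ≤ Λ := le_sup_right.trans le_sup_left
  have e5 : CB ≤ Λ := le_sup_right.trans (le_sup_left.trans le_sup_left)
  have e4 : CX ≤ Λ := le_sup_right.trans (le_sup_left.trans (le_sup_left.trans le_sup_left))
  have e3 : CG ≤ Λ :=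
    le_sup_right.trans (le_sup_left.trans (le_sup_left.trans (le_sup_left.trans le_sup_left)))
  have e2 : p ≤ Λ := le_sup_right.trans
    (le_sup_left.trans (le_sup_left.trans (le_sup_left.trans (le_sup_left.trans le_sup_left))))
  have e1 : 1 ≤ Λ := le_sup_left.trans
    (le_sup_left.trans (le_sup_left.trans (le_sup_left.trans (le_sup_left.trans le_sup_left))))
  refine ⟨Λ, fun y hy hyn P v hPG hv => ?_⟩
  have hcol : ∀ i, ‖columns P i‖ ≤ p := fun i =>
    Real.le_sqrt_of_sq_le ((norm_columns_sq_le hPG i).trans ((le_abs_self _).trans (hP y hy)))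
  have hdv := norm_fderiv_le_of_gradSq g hyn hv (hG y hy).1
  exact ⟨e1, fun i => (hcol i).trans e2, ((hG y hy).2 hyn).1.trans e3,
    ((hG y hy).2 hyn).2.trans e3, (hX y hy).1.trans e4, ((hX y hy).2 hyn).1.trans e4,
    (hB y hy).1.trans e5, ((hB y hy).2 hyn).1.trans e5, hdv.trans e6,
    (norm_frameGrad_le hdv hcol).trans e7⟩

/-- On a compact manifold every point has coordinates in which the geometry is uniformly
controlled. -/
lemma exists_uniform_bounds [T2Space M] [CompactSpace M] (A : ℝ) :
    ∃ Λ : ℝ, 1 ≤ Λ ∧ ∀ x : M, ∃ c : M, ∃ y ∈ (extChartAt (𝓡∂ n) c).target,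
      (extChartAt (𝓡∂ n) c).symm y = x ∧ ((extChartAt (𝓡∂ n) c).target ∈ 𝓝 y →
      ∀ (P : Matrix (Fin n) (Fin n) ℝ) (v : M → ℝ), Pᵀ * metricCoord g c y * P = 1 →
      gradSq g v c y ≤ A → PointBounds (metricForm g c) (tensorChart χ c) (christoffelForm g c)
        (columns P) (coordFun v c) y Λ) := by
  have h1 : ∀ c : M, ∃ s ∈ 𝓝 c, s ⊆ (extChartAt (𝓡∂ n) c).source ∧ IsCompact s := fun c =>
    local_compact_nhds (extChartAt_source_mem_nhds c)
  choose s hs hsub hcomp using h1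
  have h2 : ∀ c : M, ∃ Λ : ℝ, ∀ y ∈ extChartAt (𝓡∂ n) c '' s c,
      (extChartAt (𝓡∂ n) c).target ∈ 𝓝 y → ∀ (P : Matrix (Fin n) (Fin n) ℝ)
      (v : M → ℝ), Pᵀ * metricCoord g c y * P = 1 → gradSq g v c y ≤ A →
      PointBounds (metricForm g c) (tensorChart χ c) (christoffelForm g c) (columns P)
        (coordFun v c) y Λ := fun c =>
    exists_chart_bounds g χ A c ((hcomp c).image_of_continuousOn
      ((continuousOn_extChartAt c).mono (hsub c))) (by
        rintro _ ⟨x, hx, rfl⟩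
        exact (extChartAt (𝓡∂ n) c).map_source (hsub c hx))
  choose Λ hΛ using h2
  obtain ⟨t, ht⟩ := CompactSpace.elim_nhds_subcover s hs
  obtain ⟨m, hm⟩ := (t.image Λ).exists_le
  refine ⟨max 1 m, le_max_left _ _, fun x => ?_⟩
  have hx : x ∈ ⋃ c ∈ t, s c := by rw [ht]; trivial
  simp only [Set.mem_iUnion, exists_prop] at hx
  obtain ⟨c, hct, hxc⟩ := hx
  refine ⟨c, extChartAt (𝓡∂ n) c x, (extChartAt (𝓡∂ n) c).map_source (hsub c hxc),
    (extChartAt (𝓡∂ n) c).left_inv (hsub c hxc), fun hn P v hP hv => ?_⟩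
  exact (hΛ c _ ⟨x, hxc, rfl⟩ hn P v hP hv).mono
    ((hm _ (Finset.mem_image_of_mem _ hct)).trans (le_max_right _ _))

variable {T : EReal} {v : M → ℝ → ℝ} {A : ℝ≥0}

omit [NeZero n] [TopologicalSpace M] [ChartedSpace (EuclideanHalfSpace n) M]
  [IsManifold (𝓡∂ n) ∞ M] in
lemma abs_le_of_supNorm_le (h : supNorm T v ≤ A) (x : M) {t : ℝ} (ht : t ∈ timeInterval T) :
    |v x t| ≤ A := by
  simp only [supNorm, iSup_le_iff] at h
  have h1 := h x t ht
  rw [← ENNReal.ofReal_coe_nnreal] at h1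
  exact (ENNReal.ofReal_le_ofReal_iff A.coe_nonneg).mp h1

lemma gradSq_le_of_supGradNorm_le (h : supGradNorm g T v ≤ A) {c : M}
    {y : EuclideanSpace ℝ (Fin n)} (hy : y ∈ (extChartAt (𝓡∂ n) c).target) {t : ℝ}
    (ht : t ∈ timeInterval T) : gradSq g (fun x => v x t) c y ≤ (A : ℝ) ^ 2 := by
  simp only [supGradNorm, iSup_le_iff] at h
  have h1 := h c y hy t ht
  rw [← ENNReal.ofReal_coe_nnreal, ENNReal.ofReal_le_ofReal_iff A.coe_nonneg] at h1
  exact Real.sqrt_le_iff.mp h1 |>.2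

end UniformBounds

/-! ### The interior maximum in a chart -/

section MaximumInChart

open Filter Topology

variable {n : ℕ} [NeZero n] {M : Type*} [TopologicalSpace M]
  [ChartedSpace (EuclideanHalfSpace n) M] [IsManifold (𝓡∂ n) ∞ M] {g : Metric n M}
  {χ : SymmetricTensor n M} {Γ K : Set (Fin (n + 1) → ℝ)} {f : (Fin (n + 1) → ℝ) → ℝ}
  {T : EReal} {ψ w u : M → ℝ → ℝ}

/-- A maximum over `M × [s₀, t₀]` at an interior point `x₀` and at the final time `t₀` gives an
`InteriorMaximum` in any chart around `x₀`, with the columns of the matrix `P` as frame. -/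
lemma interiorMaximum_of_forall_le (hψ : IsParabolicC n 2 T ψ) (hw : IsParabolicC n 2 T w)
    (hsub : IsSubsolutionIn g χ K f T ψ w) (hu : IsParabolicC n 3 T u)
    (hsol : IsAdmissibleSolution g χ Γ f T ψ u) {Λ A A' δ b : ℝ} {c : M}
    {y₀ : EuclideanSpace ℝ (Fin n)} {s₀ t₀ k : ℝ} (hy : (extChartAt (𝓡∂ n) c).target ∈ 𝓝 y₀)
    (hk : k ≠ 0) (hs₀ : 0 ≤ s₀) (hst : s₀ < t₀) (ht₀ : t₀ ∈ timeInterval T) (hk0 : 0 < t₀ + k)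
    (htk : t₀ + k ∈ timeInterval T)
    (hΛ : ∀ (P : Matrix (Fin n) (Fin n) ℝ) (v : M → ℝ), Pᵀ * metricCoord g c y₀ * P = 1 →
      gradSq g v c y₀ ≤ A' → PointBounds (metricForm g c) (tensorChart χ c) (christoffelForm g c)
        (columns P) (coordFun v c) y₀ Λ)
    (huA : gradSq g (fun x => u x t₀) c y₀ ≤ A') (hwA : gradSq g (fun x => w x t₀) c y₀ ≤ A')
    (hψA : gradSq g (fun x => ψ x t₀) c y₀ ≤ A')
    (hψt : |ψ ((extChartAt (𝓡∂ n) c).symm y₀) (t₀ + k) - ψ ((extChartAt (𝓡∂ n) c).symm y₀) t₀|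
      ≤ A * |k|)
    (hpos : 0 < |k|⁻¹ * (u ((extChartAt (𝓡∂ n) c).symm y₀) (t₀ + k)
      - u ((extChartAt (𝓡∂ n) c).symm y₀) t₀))
    (hmax : ∀ x, ∀ t ∈ Set.Icc s₀ t₀, |k|⁻¹ * (u x (t + k) - u x t) *
        Real.exp (δ * gradSqAt g (fun x => u x t) x + b * (w x t - u x t))
      ≤ |k|⁻¹ * (u ((extChartAt (𝓡∂ n) c).symm y₀) (t₀ + k)
        - u ((extChartAt (𝓡∂ n) c).symm y₀) t₀) *
        Real.exp (δ * gradSqAt g (fun x => u x t₀) ((extChartAt (𝓡∂ n) c).symm y₀)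
          + b * (w ((extChartAt (𝓡∂ n) c).symm y₀) t₀ - u ((extChartAt (𝓡∂ n) c).symm y₀) t₀))) :
    ∃ (P : Matrix (Fin n) (Fin n) ℝ) (lam : Fin n → ℝ),
      InteriorMaximum Γ K f Λ A δ b (metricForm g c) (tensorChart χ c) (christoffelForm g c)
        (fun y t => u ((extChartAt (𝓡∂ n) c).symm y) t)
        (fun y t => w ((extChartAt (𝓡∂ n) c).symm y) t)
        (fun y t => ψ ((extChartAt (𝓡∂ n) c).symm y) t)
        (fun y t => timeDeriv T u ((extChartAt (𝓡∂ n) c).symm y) t)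
        (fun y t => timeDeriv T w ((extChartAt (𝓡∂ n) c).symm y) t)
        (fun y t => gradSq g (fun x => u x t) c y) y₀ t₀ k (columns P) lam := by
  have hyt := mem_of_mem_nhds hy
  have h0 : 0 < t₀ := hs₀.trans_lt hst
  have hint := interior_of_target_mem_nhds hy
  have hJ := timeInterval_mem_nhdsLE ht₀ h0
  have hev := eventually_mem_nhds_iff.mpr hy
  obtain ⟨μ, ⟨lam, ⟨P, hPG, hPU⟩, hμ⟩, hμΓ, hfμ⟩ := hsol c y₀ hyt hint t₀ ht₀ h0
  subst hμ
  have hP := isUnit_det_of_orthonormal hPG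
  have horth : frameMatrix (columns P) (fun e e' => metricForm g c y₀ e e') = 1 := by
    rw [metricForm, frameMatrix_matrixForm, hPG]
  have cu : ∀ {t : ℝ}, t ∈ timeInterval T → ∀ {y}, (extChartAt (𝓡∂ n) c).target ∈ 𝓝 y →
      ContDiffAt ℝ 2 (coordFun (fun x => u x t) c) y := fun ht _ hz =>
    (hu.contDiffAt_coordFun ht hz).of_le (by norm_num)
  have cG := (contDiffOn_metricForm g c).contDiffAt hy
  have hNge : ∀ {t : ℝ} {y : EuclideanSpace ℝ (Fin n)}, t ∈ timeInterval T →
      y ∈ (extChartAt (𝓡∂ n) c).target →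
      gradSqAt g (fun x => u x t) ((extChartAt (𝓡∂ n) c).symm y)
        = gradSq g (fun x => u x t) c y := fun ht hz =>
    gradSqAt_symm g (hu.mdifferentiable (by norm_num) ht) hz
  have timeD : ∀ {v : M → ℝ → ℝ} {k : ℕ}, IsParabolicC n k T v → 2 ≤ k → ∀ {t : ℝ},
      t ∈ timeInterval T → 0 < t → ∀ x, HasDerivWithinAt (v x) (timeDeriv T v x t) (Set.Iic t) t :=
    fun hv hk _ ht h0 x => (hv.hasDerivWithinAt_timeDeriv hk x ht).mono_of_mem_nhdsWithin
      (timeInterval_mem_nhdsLE ht h0)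
  refine ⟨P, lam, ?_⟩
  exact {
    step := hk
    bounds := hΛ P _ hPG huA
    dw := (hΛ P _ hPG hwA).dv
    dψ := (hΛ P _ hPG hψA).dv
    ψt := hψt
    symm := Eventually.of_forall fun y => matrixForm_symm (metricCoord_symm g c y)
    smoothG := cG.of_le ENat.LEInfty.out
    smoothX := ((contDiffOn_tensorChart χ c).contDiffAt hy).differentiableAt (by simp)
    smoothB := ((contDiffOn_christoffelForm g c).contDiffAt hy).differentiableAt (by simp)
    smoothu := hu.contDiffAt_coordFun ht₀ hy
    smoothu' := cu htk hy
    smoothw := hw.contDiffAt_coordFun ht₀ hy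
    smoothut := hu.differentiableAt_timeDeriv le_rfl ht₀ hy
    smoothψ := (hψ.contDiffAt_coordFun ht₀ hy).differentiableAt (by simp)
    timeu := timeD hu (by norm_num) ht₀ h0 _
    timeu' := by
      have h1 := timeD hu (by norm_num) htk hk0 ((extChartAt (𝓡∂ n) c).symm y₀)
      have h2 : HasDerivWithinAt (fun t => t + k) 1 (Set.Iic t₀) t₀ :=
        (hasDerivWithinAt_id t₀ _).add_const k
      have h3 := h1.comp t₀ h2 fun t ht => add_le_add_left (Set.mem_Iic.mp ht) k
      rw [mul_one] at h3
      exact h3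
    timew := timeD hw le_rfl ht₀ h0 _
    timeDu := fun a => hu.hasDerivWithinAt_fderiv le_rfl ht₀ h0 hy a
    orth := horth
    diag := (frameMatrix_hessForm g χ hy (cu ht₀ hy) P).trans hPU
    mem := hμΓ
    eq := hfμ
    eq_near := by
      filter_upwards [hev] with y hy'
      obtain ⟨μ, ⟨l, hl, hμ⟩, h1, h2⟩ := hsol c y (mem_of_mem_nhds hy')
        (interior_of_target_mem_nhds hy') t₀ ht₀ h0
      subst hμ
      exact ⟨l, isEigenvalueList_frame g χ hy' (cu ht₀ hy') hP hl, h1, h2⟩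
    eq_step := by
      obtain ⟨μ, ⟨l, hl, hμ⟩, h1, h2⟩ := hsol c y₀ hyt hint (t₀ + k) htk hk0
      subst hμ
      have := isEigenvalueList_frame g χ hy (cu htk hy) hP hl
      rw [horth] at this
      exact ⟨l, this, h1, h2⟩
    sub := by
      obtain ⟨μ, ⟨l, hl, hμ⟩, h1, h2⟩ := hsub c y₀ hyt hint t₀ ht₀ h0
      subst hμ
      have := isEigenvalueList_frame g χ hy (hw.contDiffAt_coordFun ht₀ hy) hP hl
      rw [horth] at this
      exact ⟨l, this, h1, h2⟩
    N_ge_space := by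
      filter_upwards [hev] with y hy' V using two_mul_fderiv_sub_le_gradSq g (v := fun x => u x t₀) hy' V
    N_ge_time := Eventually.of_forall fun t V => two_mul_fderiv_sub_le_gradSq g (v := fun x => u x t) hy V
    N_eq := gradSq_eq_sum_sq g hy hPG
    pos := hpos
    max_space := by
      filter_upwards [hy] with y hy'
      have := hmax ((extChartAt (𝓡∂ n) c).symm y) t₀ ⟨hst.le, le_rfl⟩
      rwa [hNge ht₀ hy', hNge ht₀ hyt] at this
    max_time := by
      filter_upwards [Ico_mem_nhdsLT hst] with t ht
      have htJ := mem_timeInterval_of_le ht₀ (hs₀.trans ht.1) ht.2.le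
      have := hmax ((extChartAt (𝓡∂ n) c).symm y₀) t ⟨ht.1, ht.2.le⟩
      rwa [hNge htJ hyt, hNge ht₀ hyt] at this }

end MaximumInChart

/-! ### The global maximum principle -/

section Global

open Filter Topology

variable {n : ℕ} [NeZero n] {M : Type*} [TopologicalSpace M]
  [ChartedSpace (EuclideanHalfSpace n) M]

/-- On a compact manifold `u_t` is uniformly continuous in time over compact time intervals. -/
lemma IsParabolicC.exists_oscillation_le [T2Space M] [CompactSpace M] {k : ℕ} {T : EReal}
    {u : M → ℝ → ℝ} (hu : IsParabolicC n k T u) (hk : 2 ≤ k) {t : ℝ} (ht : t ∈ timeInterval T) :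
    ∃ h > 0, ∀ x, ∀ s ∈ Set.Icc 0 t, ∀ s' ∈ Set.Icc 0 t, |s' - s| ≤ h →
      |timeDeriv T u x s' - timeDeriv T u x s| ≤ 1 := by
  let : UniformSpace M := uniformSpaceOfCompactR1
  have hc : IsCompact ((Set.univ : Set M) ×ˢ Set.Icc 0 t) := isCompact_univ.prod isCompact_Icc
  have hcont := (hu.continuousOn_timeDeriv hk).mono (Set.prod_mono (Set.Subset.refl Set.univ)
    fun s hs => mem_timeInterval_of_le ht hs.1 hs.2 : (Set.univ : Set M) ×ˢ Set.Icc 0 t ⊆ _)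
  have huc := hc.uniformContinuousOn_of_continuous hcont
  have h1 := huc (Metric.dist_mem_uniformity one_pos)
  rw [Filter.mem_map, Filter.mem_inf_principal, uniformity_prod_eq_comap_prod, Filter.mem_comap] at h1
  obtain ⟨V, hV, hVsub⟩ := h1
  rw [Filter.mem_prod_iff] at hV
  obtain ⟨V₁, hV₁, V₂, hV₂, hVV⟩ := hV
  obtain ⟨ε, hε, hεV⟩ := Metric.mem_uniformity_dist.mp hV₂
  refine ⟨ε / 2, by positivity, fun x s hs s' hs' hss => ?_⟩
  have h2 : ((x, s'), (x, s)) ∈ ((Set.univ : Set M) ×ˢ Set.Icc 0 t) ×ˢ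
      ((Set.univ : Set M) ×ˢ Set.Icc 0 t) := ⟨⟨trivial, hs'⟩, ⟨trivial, hs⟩⟩
  have h3 : dist s' s < ε := by rw [Real.dist_eq]; linarith
  have h4 := hVsub (show ((x, s'), (x, s)) ∈ _ from
    hVV (show (((x, x), (s', s)) : (M × M) × (ℝ × ℝ)) ∈ V₁ ×ˢ V₂ from
      ⟨refl_mem_uniformity hV₁, hεV h3⟩)) h2
  exact (show dist _ _ < 1 from h4).le

variable [IsManifold (𝓡∂ n) ∞ M] {g : Metric n M}

/-- The maximum principle for the difference quotients of step `k`, on an interval `[s₀, s₁]` at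
whose lower end one of the two times is `0`. The number `D` is the bound at interior maxima. -/
lemma difference_quotient_le [CompactSpace M] {T : EReal} {w u : M → ℝ → ℝ}
    (hw : IsParabolicC n 2 T w) (hu : IsParabolicC n 3 T u) {δ b D B Φ s₀ s₁ k τ : ℝ}
    (hB0 : 0 ≤ B) (hD0 : 0 ≤ D) (hk : k ≠ 0) (hs₀ : 0 ≤ s₀) (hs₀k : 0 ≤ s₀ + k)
    (hs₁ : s₁ ≤ τ) (hs₁k : s₁ + k ≤ τ) (hτ : τ ∈ timeInterval T) (hend : s₀ = 0 ∨ s₀ + k = 0)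
    (hosc : ∀ x, ∀ s ∈ Set.Icc 0 τ, ∀ s' ∈ Set.Icc 0 τ, |s' - s| ≤ |k| →
      |timeDeriv T u x s' - timeDeriv T u x s| ≤ 1)
    (hB : ∀ p ∈ parabolicBoundary n M T, |timeDeriv T u p.1 p.2| ≤ B)
    (hΦ : ∀ x, ∀ t ∈ timeInterval T,
      |δ * gradSqAt g (fun x => u x t) x + b * (w x t - u x t)| ≤ Φ)
    (hint : ∀ x₀ ∈ (𝓡∂ n).interior M, ∀ t₀, s₀ < t₀ → t₀ ≤ s₁ →
      0 < |k|⁻¹ * (u x₀ (t₀ + k) - u x₀ t₀) →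
      (∀ x, ∀ t ∈ Set.Icc s₀ t₀, |k|⁻¹ * (u x (t + k) - u x t) *
        Real.exp (δ * gradSqAt g (fun x => u x t) x + b * (w x t - u x t))
        ≤ |k|⁻¹ * (u x₀ (t₀ + k) - u x₀ t₀) *
          Real.exp (δ * gradSqAt g (fun x => u x t₀) x₀ + b * (w x₀ t₀ - u x₀ t₀))) →
      |k|⁻¹ * (u x₀ (t₀ + k) - u x₀ t₀) ≤ D ∨ |timeDeriv T u x₀ t₀| ≤ D)
    (x : M) {s : ℝ} (hs : s ∈ Set.Icc s₀ s₁) :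
    |k|⁻¹ * (u x (s + k) - u x s) ≤ (B + D + 1) * Real.exp (2 * Φ) := by
  have hI : ∀ s ∈ Set.Icc s₀ s₁, s ∈ Set.Icc 0 τ ∧ s + k ∈ Set.Icc 0 τ := fun s hs =>
    ⟨⟨hs₀.trans hs.1, hs.2.trans hs₁⟩, ⟨by linarith [hs.1], by linarith [hs.2]⟩⟩
  have hJ : ∀ s ∈ Set.Icc 0 τ, s ∈ timeInterval T := fun s hs =>
    mem_timeInterval_of_le hτ hs.1 hs.2
  have hsubJ : (Set.univ : Set M) ×ˢ Set.Icc s₀ s₁ ⊆ Set.univ ×ˢ timeInterval T :=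
    Set.prod_mono (Set.Subset.refl _) fun s hs => hJ s (hI s hs).1
  have hk' : 0 < |k| := abs_pos.mpr hk
  have hcont : ContinuousOn (fun p : M × ℝ => |k|⁻¹ * (u p.1 (p.2 + k) - u p.1 p.2) *
      Real.exp (δ * gradSqAt g (fun x => u x p.2) p.1 + b * (w p.1 p.2 - u p.1 p.2)))
      (Set.univ ×ˢ Set.Icc s₀ s₁) := by
    have c1 := hu.continuousOn_uncurry.mono hsubJ
    have c2 : ContinuousOn (fun p : M × ℝ => u p.1 (p.2 + k)) (Set.univ ×ˢ Set.Icc s₀ s₁) :=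
      hu.continuousOn_uncurry.comp (f := fun p : M × ℝ => (p.1, p.2 + k)) (by fun_prop)
        fun p hp => ⟨trivial, hJ _ (hI _ hp.2).2⟩
    have c3 := hw.continuousOn_uncurry.mono hsubJ
    have c4 := (hu.continuousOn_gradSqAt (by norm_num) g).mono hsubJ
    exact (continuousOn_const.mul (c2.sub c1)).mul
      ((continuousOn_const.mul c4).add (continuousOn_const.mul (c3.sub c1))).rexp
  obtain ⟨⟨x₀, t₀⟩, ⟨-, ht₀⟩, hmax⟩ := (isCompact_univ.prod isCompact_Icc).exists_isMaxOn
    ⟨(x, s), trivial, hs⟩ hcont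
  have hmax' : ∀ x, ∀ t ∈ Set.Icc s₀ s₁, |k|⁻¹ * (u x (t + k) - u x t) *
        Real.exp (δ * gradSqAt g (fun x => u x t) x + b * (w x t - u x t))
        ≤ |k|⁻¹ * (u x₀ (t₀ + k) - u x₀ t₀) *
          Real.exp (δ * gradSqAt g (fun x => u x t₀) x₀ + b * (w x₀ t₀ - u x₀ t₀)) :=
    fun x t ht => hmax (show (x, t) ∈ _ from ⟨trivial, ht⟩)
  obtain ⟨hI1, hI2⟩ := hI t₀ ht₀
  -- a bound for `u_t` between the two times bounds the quotient
  have hquot : ∀ a : ℝ, (∀ σ ∈ Set.uIcc t₀ (t₀ + k), |timeDeriv T u x₀ σ| ≤ a) →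
      |k|⁻¹ * (u x₀ (t₀ + k) - u x₀ t₀) ≤ a := by
    intro a ha
    have h1 := hu.abs_sub_le_of_timeDeriv (by norm_num) x₀ (hJ _ hI1) (hJ _ hI2) ha
    rw [add_sub_cancel_left] at h1
    rw [inv_mul_le_iff₀ hk', mul_comm]
    exact (le_abs_self _).trans h1
  have hnear : ∀ σ' ∈ Set.uIcc t₀ (t₀ + k), ∀ a : ℝ, |timeDeriv T u x₀ σ'| ≤ a →
      |k|⁻¹ * (u x₀ (t₀ + k) - u x₀ t₀) ≤ a + 1 := by
    intro σ' hσ' a ha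
    refine hquot _ fun σ hσ => ?_
    have hsub : Set.uIcc t₀ (t₀ + k) ⊆ Set.Icc 0 τ := Set.ordConnected_Icc.uIcc_subset hI1 hI2
    have h1 := hosc x₀ σ' (hsub hσ') σ (hsub hσ) (by
      have := Set.abs_sub_le_of_uIcc_subset_uIcc (Set.uIcc_subset_uIcc hσ' hσ)
      rwa [add_sub_cancel_left] at this)
    have h2 := abs_add_le (timeDeriv T u x₀ σ - timeDeriv T u x₀ σ') (timeDeriv T u x₀ σ')
    rw [sub_add_cancel] at h2
    linarith
  have hQ : |k|⁻¹ * (u x₀ (t₀ + k) - u x₀ t₀) ≤ B + D + 1 := by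
    rcases le_or_gt (|k|⁻¹ * (u x₀ (t₀ + k) - u x₀ t₀)) 0 with hz | hz
    · linarith
    by_cases hx₀ : x₀ ∈ (𝓡∂ n).interior M
    · rcases ht₀.1.eq_or_lt with h0 | h0
      -- at `t₀ = s₀` the quotient is compared with `u_t` at time `0`
      · have h1 : ∃ σ' ∈ Set.uIcc t₀ (t₀ + k), σ' = 0 := by
          rcases hend with h | h
          · exact ⟨t₀, Set.left_mem_uIcc, by linarith⟩
          · exact ⟨t₀ + k, Set.right_mem_uIcc, by linarith⟩
        obtain ⟨σ', hσ', rfl⟩ := h1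
        have := hnear 0 hσ' B (hB (x₀, 0) ⟨hJ 0 ⟨le_rfl, hI1.1.trans hI1.2⟩, Or.inl rfl⟩)
        linarith
      · rcases hint x₀ hx₀ t₀ h0 ht₀.2 hz fun x t ht => hmax' x t ⟨ht.1, ht.2.trans ht₀.2⟩ with
          h | h
        · linarith
        · have := hnear t₀ Set.left_mem_uIcc D h
          linarith
    · have hbd : x₀ ∈ (𝓡∂ n).boundary M :=
        ((𝓡∂ n).isInteriorPoint_or_isBoundaryPoint x₀).resolve_left hx₀
      have hsub : Set.uIcc t₀ (t₀ + k) ⊆ Set.Icc 0 τ := Set.ordConnected_Icc.uIcc_subset hI1 hI2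
      have := hquot B fun σ hσ => hB (x₀, σ) ⟨hJ σ (hsub hσ), Or.inr hbd⟩
      linarith
  have h1 := hmax' x s hs
  set φ := δ * gradSqAt g (fun x => u x s) x + b * (w x s - u x s) with hφ
  set φ₀ := δ * gradSqAt g (fun x => u x t₀) x₀ + b * (w x₀ t₀ - u x₀ t₀) with hφ₀
  have h2 := h1.trans (mul_le_mul_of_nonneg_right hQ (Real.exp_pos φ₀).le)
  have e1 := abs_le.mp (hΦ x s (hJ s (hI s hs).1))
  have e2 := abs_le.mp (hΦ x₀ t₀ (hJ t₀ hI1))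
  calc |k|⁻¹ * (u x (s + k) - u x s)
      = |k|⁻¹ * (u x (s + k) - u x s) * Real.exp φ * Real.exp (-φ) := by
        rw [mul_assoc, ← Real.exp_add, add_neg_cancel, Real.exp_zero, mul_one]
    _ ≤ (B + D + 1) * Real.exp φ₀ * Real.exp (-φ) :=
        mul_le_mul_of_nonneg_right h2 (Real.exp_pos _).le
    _ = (B + D + 1) * Real.exp (φ₀ - φ) := by
        rw [mul_assoc, ← Real.exp_add, sub_eq_add_neg]
    _ ≤ (B + D + 1) * Real.exp (2 * Φ) :=
        mul_le_mul_of_nonneg_left (Real.exp_le_exp.mpr (by linarith [e1.1, e2.2])) (by linarith)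

/-- The estimate with a real bound `B` for `|u_t|` on the parabolic boundary. -/
lemma exists_abs_timeDeriv_le [T2Space M] [CompactSpace M] (g : Metric n M)
    (χ : SymmetricTensor n M) {Γ : Set (Fin (n + 1) → ℝ)} (hΓ : IsSymmetricCone Γ)
    {f : (Fin (n + 1) → ℝ) → ℝ} (hf : IsStructural Γ f) {K₀ : ℝ} (hK₀ : 0 ≤ K₀)
    (hfK₀ : ∀ lam ∈ Γ, -K₀ * ∑ i, partialD f i lam ≤ ∑ i, partialD f i lam * lam i)
    (A₁ A₂ A₃ : ℝ≥0) {K : Set (Fin (n + 1) → ℝ)} (hK : IsCompact K) (hKΓ : K ⊆ Γ) :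
    ∃ C : ℝ, 0 < C ∧ ∀ (T : EReal) (ψ w u : M → ℝ → ℝ),
      IsParabolicC n 2 T ψ → normC2 g T ψ ≤ A₃ →
      IsParabolicC n 2 T w → normC2 g T w ≤ A₂ → IsSubsolutionIn g χ K f T ψ w →
      IsParabolicC n 3 T u → normC1 g T u ≤ A₁ → IsAdmissibleSolution g χ Γ f T ψ u →
      ∀ B : ℝ, 0 ≤ B → (∀ p ∈ parabolicBoundary n M T, |timeDeriv T u p.1 p.2| ≤ B) →
      ∀ x, ∀ t ∈ timeInterval T, |timeDeriv T u x t| ≤ C * (1 + B) := by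
  set A' : ℝ := (A₁ : ℝ) ^ 2 + (A₂ : ℝ) ^ 2 + (A₃ : ℝ) ^ 2 with hA'
  obtain ⟨Λ, hΛ1, hΛ⟩ := exists_uniform_bounds g χ A'
  obtain ⟨δ, b, D, hδ, hb, hD, hest⟩ := exists_interior_estimate hΓ hf hK₀ hfK₀ hK hKΓ hΛ1
    A₃.coe_nonneg (EuclideanSpace ℝ (Fin n))
  set Φ : ℝ := δ * (A₁ : ℝ) ^ 2 + b * (A₂ + A₁) with hΦ
  have hΦ0 : 0 ≤ Φ := by positivity
  refine ⟨(D + 2) * Real.exp (2 * Φ), by positivity, ?_⟩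
  intro T ψ w u hψ hψA hw hwA hsub hu huA hsol B hB0 hB x t ht
  have hu0 : supNorm T u ≤ A₁ := le_self_add.trans huA
  have hu1 : supGradNorm g T u ≤ A₁ := le_add_self.trans huA
  have hw0 : supNorm T w ≤ A₂ := le_self_add.trans (le_self_add.trans (le_self_add.trans hwA))
  have hw1 : supGradNorm g T w ≤ A₂ :=
    le_add_self.trans (le_self_add.trans (le_self_add.trans hwA))
  have hψ1 : supGradNorm g T ψ ≤ A₃ :=
    le_add_self.trans (le_self_add.trans (le_self_add.trans hψA))
  have hψ2 : supNorm T (timeDeriv T ψ) ≤ A₃ := le_add_self.trans hψA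
  have hφ : ∀ x, ∀ t ∈ timeInterval T,
      |δ * gradSqAt g (fun x => u x t) x + b * (w x t - u x t)| ≤ Φ := by
    intro x t ht
    have h1 := gradSq_le_of_supGradNorm_le g hu1 (mem_extChartAt_target (I := 𝓡∂ n) x) ht
    have h2 := gradSq_nonneg g (fun x => u x t) (mem_extChartAt_target (I := 𝓡∂ n) x)
    have h3 := abs_le_of_supNorm_le hw0 x ht
    have h4 := abs_le_of_supNorm_le hu0 x ht
    refine (abs_add_le _ _).trans (add_le_add ?_ ?_)
    · rw [abs_mul, abs_of_pos hδ, gradSqAt, abs_of_nonneg h2]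
      exact mul_le_mul_of_nonneg_left h1 hδ.le
    · rw [abs_mul, abs_of_pos hb]
      exact mul_le_mul_of_nonneg_left ((abs_sub _ _).trans (add_le_add h3 h4)) hb.le
  have hexp : 1 ≤ Real.exp (2 * Φ) := Real.one_le_exp (by positivity)
  have hfin : (B + D + 1) * Real.exp (2 * Φ) + 1 ≤ (D + 2) * Real.exp (2 * Φ) * (1 + B) := by
    nlinarith [mul_nonneg hB0 hD, mul_nonneg (mul_nonneg hB0 hD) (zero_le_one.trans hexp),
      mul_nonneg hB0 (zero_le_one.trans hexp)]
  rcases ht.1.eq_or_lt with h0 | h0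
  · have := hB (x, t) ⟨ht, Or.inl h0.symm⟩
    have h2 : B ≤ B * Real.exp (2 * Φ) := le_mul_of_one_le_right hB0 hexp
    have h3 : 0 ≤ (D + 1) * Real.exp (2 * Φ) := by positivity
    have : |timeDeriv T u x t| ≤ B := this
    linarith [hfin, h2, h3]
  obtain ⟨h, hh0, hosc⟩ := hu.exists_oscillation_le (by norm_num) ht
  -- the step of the quotients: `u_t` oscillates by at most `1` over it, and `d < t`
  set d := min h (t / 2) with hd
  have hd0 : 0 < d := lt_min hh0 (by linarith)
  have hdh : d ≤ h := min_le_left _ _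
  have hdt : d < t := (min_le_right _ _).trans_lt (by linarith)
  have hint : ∀ k : ℝ, k ≠ 0 → ∀ s₀ s₁ : ℝ, 0 ≤ s₀ → 0 ≤ s₀ + k → s₁ ≤ t → s₁ + k ≤ t →
      ∀ x₀ ∈ (𝓡∂ n).interior M, ∀ t₀, s₀ < t₀ → t₀ ≤ s₁ →
      0 < |k|⁻¹ * (u x₀ (t₀ + k) - u x₀ t₀) →
      (∀ x, ∀ t ∈ Set.Icc s₀ t₀, |k|⁻¹ * (u x (t + k) - u x t) *
        Real.exp (δ * gradSqAt g (fun x => u x t) x + b * (w x t - u x t))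
        ≤ |k|⁻¹ * (u x₀ (t₀ + k) - u x₀ t₀) *
          Real.exp (δ * gradSqAt g (fun x => u x t₀) x₀ + b * (w x₀ t₀ - u x₀ t₀))) →
      |k|⁻¹ * (u x₀ (t₀ + k) - u x₀ t₀) ≤ D ∨ |timeDeriv T u x₀ t₀| ≤ D := by
    intro k hk s₀ s₁ hs₀ hs₀k hs₁ hs₁k x₀ hx₀ t₀ hst hts hpos hmax
    obtain ⟨c, y₀, hy₀, rfl, hbd⟩ := hΛ x₀
    have hyn := target_mem_nhds_of_mem_interior hy₀ hx₀
    have ht₀ : t₀ ∈ timeInterval T := mem_timeInterval_of_le ht (hs₀.trans hst.le) (hts.trans hs₁)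
    have htk : t₀ + k ∈ timeInterval T :=
      mem_timeInterval_of_le ht (by linarith) (by linarith)
    have hsq : ∀ a : ℝ≥0, 0 ≤ (a : ℝ) ^ 2 := fun a => sq_nonneg _
    have hψt := hψ.abs_sub_le_of_timeDeriv le_rfl ((extChartAt (𝓡∂ n) c).symm y₀) ht₀ htk
      fun τ hτ => abs_le_of_supNorm_le hψ2 _
        ((convex_iff_ordConnected.mp (convex_timeInterval T)).uIcc_subset ht₀ htk hτ)
    rw [add_sub_cancel_left] at hψt
    obtain ⟨P, lam, hIM⟩ := interiorMaximum_of_forall_le hψ hw hsub hu hsol hyn hk hs₀ hst ht₀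
      (by linarith) htk (hbd hyn)
      ((gradSq_le_of_supGradNorm_le g hu1 hy₀ ht₀).trans (by linarith [hsq A₁, hsq A₂, hsq A₃]))
      ((gradSq_le_of_supGradNorm_le g hw1 hy₀ ht₀).trans (by linarith [hsq A₁, hsq A₂, hsq A₃]))
      ((gradSq_le_of_supGradNorm_le g hψ1 hy₀ ht₀).trans (by linarith [hsq A₁, hsq A₂, hsq A₃]))
      hψt hpos hmax
    exact hest _ _ _ _ _ _ _ _ _ _ _ _ _ _ hIM
  have hosc' : ∀ k : ℝ, |k| = d → ∀ x, ∀ s ∈ Set.Icc 0 t, ∀ s' ∈ Set.Icc 0 t, |s' - s| ≤ |k| →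
      |timeDeriv T u x s' - timeDeriv T u x s| ≤ 1 := fun k hk x s hs s' hs' hss =>
    hosc x s hs s' hs' (hss.trans (hk.le.trans hdh))
  have htd : t - d ∈ timeInterval T := mem_timeInterval_of_le ht (by linarith) (by linarith)
  have habs : |(-d)| = d := by rw [abs_neg, abs_of_pos hd0]
  -- forward quotients bound `u_t` from above, backward quotients from below
  have hfwd := difference_quotient_le (g := g) (D := D) (s₀ := 0) (s₁ := t - d) (k := d) hw hu hB0 hD
    hd0.ne' le_rfl (by linarith) (by linarith) (by linarith) ht (Or.inl rfl)
    (hosc' d (abs_of_pos hd0)) hB hφ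
    (hint d hd0.ne' 0 (t - d) le_rfl (by linarith) (by linarith) (by linarith)) x
    (s := t - d) ⟨by linarith, le_rfl⟩
  have hbwd := difference_quotient_le (g := g) (D := D) (s₀ := d) (s₁ := t) (k := -d) hw hu hB0 hD
    (neg_ne_zero.mpr hd0.ne') hd0.le (by linarith) le_rfl (by linarith) ht (Or.inr (by ring))
    (hosc' (-d) habs) hB hφ
    (hint (-d) (neg_ne_zero.mpr hd0.ne') d t hd0.le (by linarith) le_rfl (by linarith)) x
    (s := t) ⟨hdt.le, le_rfl⟩
  have hlin := hu.abs_sub_sub_le_of_timeDeriv (by norm_num) x htd ht (a := timeDeriv T u x t)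
    (ε := 1) fun σ hσ => by
      rw [Set.uIcc_of_le (by linarith)] at hσ
      refine hosc x t ⟨h0.le, le_rfl⟩ σ ⟨by linarith [hσ.1], hσ.2⟩ ?_
      rw [abs_le]
      constructor <;> linarith [hσ.1, hσ.2]
  rw [sub_sub_cancel, abs_of_pos hd0, one_mul, abs_le] at hlin
  rw [abs_of_pos hd0, sub_add_cancel, inv_mul_le_iff₀ hd0] at hfwd
  rw [habs, ← sub_eq_add_neg, inv_mul_le_iff₀ hd0] at hbwd
  rw [abs_le]
  refine ⟨?_, ?_⟩
  · refine le_trans (neg_le_neg hfin) ?_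
    have : d * -timeDeriv T u x t ≤ d * ((B + D + 1) * Real.exp (2 * Φ) + 1) := by linarith [hlin.1, hlin.2]
    linarith [le_of_mul_le_mul_left this hd0]
  · refine le_trans ?_ hfin
    have : d * timeDeriv T u x t ≤ d * ((B + D + 1) * Real.exp (2 * Φ) + 1) := by linarith [hlin.1, hlin.2]
    exact le_of_mul_le_mul_left this hd0

end Global

end ParabolicHessian

end

open ParabolicHessian in
theorem theorem4p1 {n : ℕ} [NeZero n] (hn : 2 ≤ n)
    {M : Type*} [TopologicalSpace M] [T2Space M] [CompactSpace M]
    [ChartedSpace (EuclideanHalfSpace n) M] [IsManifold (𝓡∂ n) ∞ M]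
    (g : ParabolicHessian.Metric n M) (χ : SymmetricTensor n M)
    (Γ : Set (Fin (n + 1) → ℝ)) (hΓ : IsSymmetricCone Γ)
    (f : (Fin (n + 1) → ℝ) → ℝ) (hf : IsStructural Γ f)
    (K₀ : ℝ) (hK₀ : 0 ≤ K₀)
    (hfK₀ : ∀ lam ∈ Γ, -K₀ * ∑ i, partialD f i lam ≤ ∑ i, partialD f i lam * lam i) :
    ∀ (A₁ A₂ A₃ : ℝ≥0) (K : Set (Fin (n + 1) → ℝ)), IsCompact K → K ⊆ Γ →
      ∃ C : ℝ≥0, 0 < C ∧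
        ∀ (T : EReal), 0 < T → ∀ ψ w u : M → ℝ → ℝ,
          IsParabolicC n 2 T ψ → normC2 g T ψ ≤ A₃ →
          IsParabolicC n 2 T w → normC2 g T w ≤ A₂ → IsSubsolutionIn g χ K f T ψ w →
          IsParabolicC n 3 T u → normC1 g T u ≤ A₁ → IsAdmissibleSolution g χ Γ f T ψ u →
          (⨆ x : M, ⨆ t ∈ timeInterval T, ENNReal.ofReal |timeDeriv T u x t|) ≤
            C * (1 + ⨆ p ∈ parabolicBoundary n M T, ENNReal.ofReal |timeDeriv T u p.1 p.2|) := by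
  intro A₁ A₂ A₃ K hK hKΓ
  obtain ⟨C, hC, hest⟩ := exists_abs_timeDeriv_le g χ hΓ hf hK₀ hfK₀ A₁ A₂ A₃ hK hKΓ
  refine ⟨C.toNNReal, Real.toNNReal_pos.mpr hC, fun T _ ψ w u hψ hψA hw hwA hsub hu huA hsol => ?_⟩
  set b := ⨆ p ∈ parabolicBoundary n M T, ENNReal.ofReal |timeDeriv T u p.1 p.2| with hb
  by_cases htop : b = ⊤
  · rw [htop, add_top, ENNReal.mul_top (ENNReal.coe_ne_zero.mpr (Real.toNNReal_pos.mpr hC).ne')]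
    exact le_top
  have hB : ∀ p ∈ parabolicBoundary n M T, |timeDeriv T u p.1 p.2| ≤ b.toReal := fun p hp =>
    (ENNReal.ofReal_le_iff_le_toReal htop).mp
      (le_iSup₂ (f := fun p (_ : p ∈ parabolicBoundary n M T) =>
        ENNReal.ofReal |timeDeriv T u p.1 p.2|) p hp)
  refine iSup_le fun x => iSup₂_le fun t ht => ?_
  have h1 := hest T ψ w u hψ hψA hw hwA hsub hu huA hsol b.toReal ENNReal.toReal_nonneg hB x t ht
  refine (ENNReal.ofReal_le_ofReal h1).trans (le_of_eq ?_)
  rw [ENNReal.ofReal_mul hC.le, ENNReal.ofReal_add zero_le_one ENNReal.toReal_nonneg,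
    ENNReal.ofReal_one, ENNReal.ofReal_toReal htop]
  rfl
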